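/- Let $d\ge 2$. For a probability measure $f$ on $\mathbb R^d$ and bounded continuous $\psi$ write $(f,\psi)=\int\psi\,df$, and put $u=v-w$; $d\omega$ is surface measure on $S^{d-1}$. Consider the following equations for $f_t$, $t\ge0$, each required to hold for all bounded continuous $\psi$: (A) $\frac{d}{dt}(f,\psi)=\int f(dv)f(dw)\,d\omega\; g\big(\tfrac{u\cdot\omega}{|u|}\big)[\psi(v')-\psi(v)]$ with $v'=\frac12(v+w+|u|\omega)$ (elastic collisions); (B) the same equation with the additional term $\theta\int f(dv)M(dw)\,d\omega\; g\big(\tfrac{u\cdot\omega}{|u|}\big)[\psi(v')-\psi(v)]$ on the right-hand side, where in this term $v'=\frac{v+m(w+|u|\omega)}{1+m}$, and $M=\delta_0$ (thermostat at temperature $T=0$); (C) $\frac{d}{dt}(f,\psi)=\int f(dv)f(dw)\,d\omega\;\frac{|u\cdot\omega|}{|u|}[\psi(v')-\psi(v)]$ with $v'=v-\frac{1+e}{2}(u\cdot\omega)\omega$ (inelastic collisions). Here $g\ge0$ on $[-1,1]$ is measurable, and $G(s)=2^{d-2}|S^{d-2}|\,g(1-2s)[s(1-s)]^{(d-3)/2}$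 satisfies $0<\int_0^1G\,ds<\infty$; in (B), $m>0$, $\beta=\frac{4m}{(1+m)^2}$ and $$0<\theta<\theta_*=-\frac{\int_0^1G(s)\,(s\log s+(1-s)\log(1-s))\,ds}{\int_0^1G(s)\,(\beta s+(1-\beta s)\log(1-\beta s))\,ds};$$ in (C), $0<e\le1$. Call (A), and (C) with $e=1$, the elastic cases. For $p>0$ let $$\mu(p)=\frac1p\int_0^1G(s)\,[s^p+(1-s)^p-1]\,ds\ \text{ in (A)},$$ $$\mu(p)=\frac1p\int_0^1G(s)\,[s^p+(1-s)^p+\theta(1-\beta s)^p-(1+\theta)]\,ds\ \text{ in (B)},$$ $$\mu(p)=\frac1p\int_0^1|S^{d-2}|(1-s)^{\frac{d-3}2}\Big[\big(\tfrac{(1+e)^2}4s\big)^p+\big(1-\tfrac{(1+e)(3-e)}4s\big)^p-1\Big]ds\ \text{ in (C)}.$$ An isotropic probability measure $f$ is said to satisfy $(E_p)$ if its characteristic function $\hat f(k)=u(|k|^2)$ satisfies $u(x)=1-x^p+O(x^{p+\varepsilon})$ as $x\to0$ for some $\varepsilon>0$. Measures are written as densities below; the formulas are meant as the corresponding push-forwards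 under dilations. Then, for each of the equations (A), (B), (C): **[i]** For every isotropic probability measure $f_0$ there is exactly one solution $f_t$, $t\ge 0$, in the class of probability measures with initial value $f_0$, and it is isotropic for all $t$. For every $0<p\le1$ there is an isotropic probability measure $F_p$ such that $f^{(p)}_s(v,t)=e^{-\frac d2\mu(p)t}F_p(ve^{-\frac12\mu(p)t})$ is a solution, $F_p$ satisfies $(E_p)$, and for every solution $f$ whose initial value is isotropic and satisfies $(E_p)$, $$e^{\frac d2\mu(p)t}f(ve^{\frac12\mu(p)t},t)\to F_p\qquad(t\to\infty)$$ in the sense of weak convergence of probability measures. $F_p$ is unique among the isotropic profiles of self-similar solutions with exponent $\mu(p)$ that satisfy $(E_p)$, and also among those that have this convergence property. **[ii]** Let $m_q=\int|v|^{2q}F_p(dv)$, $q>0$. If $0<p<1$, then $m_q<\infty$ if and only if $q<p$. If $p=1$, then in the elastic cases $\mu(1)=0$ and $F_1(v)=(4\pi)^{-d/2}e^{-|v|^2/4}$, while in (B) and in (C) with $e<1$ the equation $\mu(q)=\mu(1)$, $q>0$, has exactly two roots, $q=1$ and some $q=p_*>1$, and $m_q<\infty$ if and only if $q<p_*$. 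-/

import Mathlib

open MeasureTheory Filter Topology Asymptotics
open scoped RealInnerProductSpace BoundedContinuousFunction

noncomputable section

/-- The velocity space `ℝ^d` with its Euclidean structure. -/
abbrev Vel (d : ℕ) : Type := EuclideanSpace ℝ (Fin d)

/-- The unit sphere `S^{d-1}` of `ℝ^d`. -/
abbrev UnitSphere (d : ℕ) : Type := Metric.sphere (0 : Vel d) 1

/-- The surface measure `dω` on `S^{d-1}`. -/
def surface (d : ℕ) : Measure (UnitSphere d) := (volume : Measure (Vel d)).toSphere

/-- `|S^{d-2}|`, the area of the unit sphere of `ℝ^{d-1}` (equal to `2` when `d = 2`). -/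
def areaSphere (d : ℕ) : ℝ := (surface (d - 1)).real Set.univ

/-! ### The three collision operators, in weak form

Each of them is the right-hand side of `d/dt (f, ψ) = …` for a bounded continuous test
function `ψ`; here `u = v - w` is the relative velocity. Where `u = 0` the integrand of the
first two vanishes because then `v' = v`, and that of the third because `u·ω = 0`. -/

/-- Elastic collisions, `v' = (v + w + |u| ω) / 2`:
`∫ f(dv) f(dw) dω g(u·ω/|u|) (ψ(v') - ψ(v))`. -/
def elasticOp (d : ℕ) (g : ℝ → ℝ) (f : Measure (Vel d)) (ψ : Vel d →ᵇ ℝ) : ℝ :=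
  ∫ v, ∫ w, ∫ ω : UnitSphere d,
    g (⟪v - w, (ω : Vel d)⟫ / ‖v - w‖) *
      (ψ ((1 / 2 : ℝ) • (v + w + ‖v - w‖ • (ω : Vel d))) - ψ v) ∂(surface d) ∂f ∂f

/-- Collisions with a thermostat whose particles have mass `m` and velocity distribution `M`,
`v' = (v + m (w + |u| ω)) / (1 + m)`:
`∫ f(dv) M(dw) dω g(u·ω/|u|) (ψ(v') - ψ(v))`. -/
def thermostatOp (d : ℕ) (g : ℝ → ℝ) (m : ℝ) (M : Measure (Vel d)) (f : Measure (Vel d))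
    (ψ : Vel d →ᵇ ℝ) : ℝ :=
  ∫ v, ∫ w, ∫ ω : UnitSphere d,
    g (⟪v - w, (ω : Vel d)⟫ / ‖v - w‖) *
      (ψ ((1 + m)⁻¹ • (v + m • (w + ‖v - w‖ • (ω : Vel d)))) - ψ v) ∂(surface d) ∂M ∂f

/-- Inelastic collisions with restitution coefficient `e`,
`v' = v - (1 + e)/2 (u·ω) ω`:
`∫ f(dv) f(dw) dω (|u·ω|/|u|) (ψ(v') - ψ(v))`. -/
def inelasticOp (d : ℕ) (e : ℝ) (f : Measure (Vel d)) (ψ : Vel d →ᵇ ℝ) : ℝ :=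
  ∫ v, ∫ w, ∫ ω : UnitSphere d,
    (|⟪v - w, (ω : Vel d)⟫| / ‖v - w‖) *
      (ψ (v - ((1 + e) / 2 * ⟪v - w, (ω : Vel d)⟫) • (ω : Vel d)) - ψ v)
        ∂(surface d) ∂f ∂f

/-! ### Kernels on the unit interval -/

/-- `G(s) = 2^{d-2} |S^{d-2}| g(1-2s) [s(1-s)]^{(d-3)/2}`. -/
def kernelG (d : ℕ) (g : ℝ → ℝ) (s : ℝ) : ℝ :=
  (2 : ℝ) ^ (d - 2) * areaSphere d * g (1 - 2 * s) * (s * (1 - s)) ^ (((d : ℝ) - 3) / 2)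

/-- `G(s) = |S^{d-2}| (1-s)^{(d-3)/2}`, the kernel of the inelastic model. -/
def kernelInel (d : ℕ) (s : ℝ) : ℝ :=
  areaSphere d * (1 - s) ^ (((d : ℝ) - 3) / 2)

/-- Admissible collision kernels: measurable, non-negative on `[-1,1]`, with a finite and
nonzero total collision frequency `∫₀¹ G = ∫_{S^{d-1}} g(ω₀·ω) dω`. -/
structure IsCollisionKernel (d : ℕ) (g : ℝ → ℝ) : Prop where
  measurable : Measurable g
  nonneg : ∀ z ∈ Set.Icc (-1 : ℝ) 1, 0 ≤ g z
  integrable : IntegrableOn (kernelG d g) (Set.Ioo 0 1)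
  pos : 0 < ∫ s in (0 : ℝ)..1, kernelG d g s

/-- `β = 4m/(1+m)²`. -/
def betaOf (m : ℝ) : ℝ := 4 * m / (1 + m) ^ 2

/-- The threshold `θ_*` of the coupling constant. -/
def thetaStar (d : ℕ) (g : ℝ → ℝ) (m : ℝ) : ℝ :=
  -(∫ s in (0 : ℝ)..1, kernelG d g s * (s * Real.log s + (1 - s) * Real.log (1 - s))) /
    (∫ s in (0 : ℝ)..1, kernelG d g s *
      (betaOf m * s + (1 - betaOf m * s) * Real.log (1 - betaOf m * s)))

/-! ### The models -/

/-- The three Maxwell models with their parameters: (A) elastic collisions with kernel `g`;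
(B) the same with a cold thermostat of particles of mass `m` and coupling constant `θ`;
(C) inelastic collisions with restitution coefficient `e`. -/
inductive MaxwellModel : Type
  | elastic (g : ℝ → ℝ) : MaxwellModel
  | thermostat (g : ℝ → ℝ) (m θ : ℝ) : MaxwellModel
  | inelastic (e : ℝ) : MaxwellModel

namespace MaxwellModel

/-- The standing assumptions on the parameters. -/
def Admissible (d : ℕ) : MaxwellModel → Prop
  | elastic g => IsCollisionKernel d g
  | thermostat g m θ => IsCollisionKernel d g ∧ 0 < m ∧ 0 < θ ∧ θ < thetaStar d g m
  | inelastic e => 0 < e ∧ e ≤ 1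

/-- The energy-conserving models: (A), and (C) with `e = 1`. -/
def IsElastic : MaxwellModel → Prop
  | elastic _ => True
  | thermostat _ _ _ => False
  | inelastic e => e = 1

/-- The right-hand side of the weak form of the equation. The cold thermostat (temperature
`T = 0`) has the velocity distribution `δ_0`. -/
def op (d : ℕ) : MaxwellModel → Measure (Vel d) → (Vel d →ᵇ ℝ) → ℝ
  | elastic g, f, ψ => elasticOp d g f ψ
  | thermostat g m θ, f, ψ =>
      elasticOp d g f ψ + θ * thermostatOp d g m (Measure.dirac 0) f ψ
  | inelastic e, f, ψ => inelasticOp d e f ψ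

/-- The spectral function `μ(p)`, in the time unit of the equation as it is written (no
normalization of the total collision frequency). -/
def mu (d : ℕ) : MaxwellModel → ℝ → ℝ
  | elastic g, p =>
      1 / p * ∫ s in (0 : ℝ)..1, kernelG d g s * (s ^ p + (1 - s) ^ p - 1)
  | thermostat g m θ, p =>
      1 / p * ∫ s in (0 : ℝ)..1, kernelG d g s *
        (s ^ p + (1 - s) ^ p + θ * (1 - betaOf m * s) ^ p - (1 + θ))
  | inelastic e, p =>
      1 / p * ∫ s in (0 : ℝ)..1, kernelInel d s *
        (((1 + e) ^ 2 / 4 * s) ^ p + (1 - (1 + e) * (3 - e) / 4 * s) ^ p - 1)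

/-- `f` is a probability-measure solution on `t ≥ 0` of the equation of the model: for every
bounded continuous `ψ`, `d/dt (f, ψ)` exists at each `t ≥ 0` (one-sided at `t = 0`) and is
the collision term. -/
def IsSolution {d : ℕ} (𝓜 : MaxwellModel) (f : ℝ → ProbabilityMeasure (Vel d)) : Prop :=
  ∀ ψ : Vel d →ᵇ ℝ, ∀ t : ℝ, 0 ≤ t →
    HasDerivWithinAt (fun τ : ℝ => ∫ v, ψ v ∂(f τ : Measure (Vel d)))
      (𝓜.op d (f t : Measure (Vel d)) ψ) (Set.Ici 0) t

end MaxwellModel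

/-- Isotropy: invariance under all linear isometries of `ℝ^d`. -/
def IsIsotropic {d : ℕ} (f : ProbabilityMeasure (Vel d)) : Prop :=
  ∀ R : Vel d ≃ₗᵢ[ℝ] Vel d, (f : Measure (Vel d)).map R = f

/-- The law of `c V` when `V` has law `f`; for a density `f` on `ℝ^d` and `c > 0` it has the
density `c^{-d} f(v/c)`. -/
def dilate {d : ℕ} (c : ℝ) (f : ProbabilityMeasure (Vel d)) : ProbabilityMeasure (Vel d) :=
  f.map (f := fun v : Vel d => c • v) (by fun_prop)

/-- `u = 1 - x^p + O(x^{p+ε})` as `x = |k|² → 0` for some `ε > 0`, where `u` is the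
characteristic function of `f` (for isotropic `f` the sign convention of the Fourier transform
is immaterial). -/
def HasExpansion {d : ℕ} (p : ℝ) (f : ProbabilityMeasure (Vel d)) : Prop :=
  ∃ ε : ℝ, 0 < ε ∧
    (fun k : Vel d => charFun (f : Measure (Vel d)) k - ((1 - (‖k‖ ^ 2) ^ p : ℝ) : ℂ))
      =O[𝓝 0] (fun k : Vel d => (‖k‖ ^ 2) ^ (p + ε))

/-- The Maxwellian `(4π)^{-d/2} exp(-|v|²/4) dv`. -/
def maxwellian (d : ℕ) : Measure (Vel d) :=
  (volume : Measure (Vel d)).withDensity fun v =>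
    ENNReal.ofReal ((4 * Real.pi) ^ (-(d : ℝ) / 2) * Real.exp (-‖v‖ ^ 2 / 4))

namespace MaxwellModel

/-- `F` is the profile of a self-similar solution with exponent `μ(p)`: the densities
`e^{-dμ(p)t/2} F(v e^{-μ(p)t/2})` solve the equation. -/
def IsSelfSimilarProfile {d : ℕ} (𝓜 : MaxwellModel) (p : ℝ)
    (F : ProbabilityMeasure (Vel d)) : Prop :=
  𝓜.IsSolution fun t => dilate (Real.exp (𝓜.mu d p * t / 2)) F

/-- Self-similar asymptotics: for every isotropic solution whose initial datum has the
expansion with exponent `p`, the rescaled densities `e^{dμ(p)t/2} f(v e^{μ(p)t/2}, t)`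
converge to `F` as `t → ∞`, in the sense of weak convergence of probability measures. -/
def Attracts {d : ℕ} (𝓜 : MaxwellModel) (p : ℝ) (F : ProbabilityMeasure (Vel d)) : Prop :=
  ∀ f : ℝ → ProbabilityMeasure (Vel d), 𝓜.IsSolution f → IsIsotropic (f 0) →
    HasExpansion p (f 0) →
    Tendsto (fun t : ℝ => dilate (Real.exp (-(𝓜.mu d p * t / 2))) (f t)) atTop (𝓝 F)

end MaxwellModel

end

/-!
The three equations are treated as one. Let `ν` be a finite measure of pairs `(a, b)` of weights and
let `smooth ν f f` be the law of `a V + b W`, with `V`, `W` independent of law `f`. The collision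
operator of each model is a gain term minus `|ν| f`, and by Bobylev's identity (`charFun_gain`: in
the Fourier integral of the gain term the directions of `v - w` and of `k` can be exchanged by a
reflection of the sphere) the gain term of an isotropic `f` is `smooth ν f f`, where `(a², b²)` is
an affine function of the variable `s` of the kernel `G(s) ds` (`surface_map_inner` gives the law of
the cosine of the scattering angle). The spectral function of the model is
`μ(p) = p⁻¹ ∫ (a^{2p} + b^{2p} - 1) dν`. The structure `IsKacForm` lists what is used from there on,
and `IsKacForm.selfSimilar_asymptotics` draws the conclusion.

* *Initial value problem.* The gain term is Lipschitz in the supremum norm of characteristic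
  functions, which gives uniqueness in the class of all probability measures
  (`eq_of_charFun_equation`). Wild's series gives an isotropic solution (`exists_solution`).
* *Decay.* `∫ (a^{2q} + b^{2q}) dν` is convex in `q`, and the condition `θ < θ_*`, or the convexity
  of `x log x` in the other models, says that `μ` decreases at `1`. Hence `μ(q) < μ(p)` for all
  `p ≤ 1` and all `q > p` close to `p` (`rate_lt_rate`). The distance
  `sup_k |φ_f(k) - φ_g(k)| / |k|^{2q}` of two solutions grows at most like `exp (κ t)` for every
  `κ > q μ(q)` (`IsKacSolution.norm_sub_le`); after rescaling by `exp (-μ(p) t / 2)` it decays.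
* *Profiles.* A fixed point of smoothing with the weights `(e^{-μ(p) s/2} a, e^{-μ(p) s/2} b)`, `s`
  exponentially distributed with parameter `|ν|`, is a self-similar profile
  (`isKacSolution_of_fixedPoint`: this is the mild form of the equation). For these weights
  `∫ (a^{2p} + b^{2p}) = 1` and `∫ (a^{2q} + b^{2q}) < 1`, so the iteration from any law with the
  expansion `1 - |k|^{2p} + O(|k|^{2q})` is a contraction and preserves the expansion
  (`exists_smooth_fixedPoint`). Starting points are the Maxwellian for `p = 1` and a Gaussian
  mixture with Pareto-distributed variance for `p < 1`.
* *Moments.* For `p < 1` they are read off from the expansion at `k = 0`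
  (`absMoment_ne_top_of_charFun`, `ExpandsUpTo.not_integrable`). For `p = 1` the moments below the
  second root `p_*` of `μ(q) = μ(1)` stay bounded along the iteration (`exists_absMoment_bound`). At
  `q = p_*`, symmetrization and the parallelogram identity show that smoothing would strictly
  increase a finite moment of a fixed point (`absMoment_eq_top_of_critical`).
* *Elastic case.* There `a² + b² = 1`, so the Maxwellian is stationary and attracted to `F₁`.
-/

set_option linter.unusedSectionVars false

namespace KacMaxwell

noncomputable section

open scoped ENNReal NNReal

/-! ### The bilinear smoothing operation -/

section

variable {E : Type*} [NormedAddCommGroup E] [InnerProductSpace ℝ E] [FiniteDimensional ℝ E]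
  [MeasurableSpace E] [BorelSpace E]

/-- For a measure `ν` of weights, `smooth ν f h` is the law of `a V + b W`, where `(a, b)`, `V`, `W`
are independent with laws `ν`, `f`, `h` (total masses are multiplied, not normalized). -/
def smooth (ν : Measure (ℝ × ℝ)) (f h : Measure E) : Measure E :=
  (ν.prod (f.prod h)).map fun x => x.1.1 • x.2.1 + x.1.2 • x.2.2

lemma measurable_smooth_fun :
    Measurable fun x : (ℝ × ℝ) × (E × E) => x.1.1 • x.2.1 + x.1.2 • x.2.2 := by
  fun_prop

section basic

variable (ν : Measure (ℝ × ℝ)) (f h : Measure E)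

lemma lintegral_smooth [SFinite ν] [SFinite f] [SFinite h] {F : E → ℝ≥0∞} (hF : Measurable F) :
    ∫⁻ v, F v ∂(smooth ν f h) = ∫⁻ c, ∫⁻ v, ∫⁻ w, F (c.1 • v + c.2 • w) ∂h ∂f ∂ν := by
  rw [smooth, lintegral_map hF measurable_smooth_fun,
    lintegral_prod (fun x : (ℝ × ℝ) × (E × E) => F (x.1.1 • x.2.1 + x.1.2 • x.2.2))
      (hF.comp measurable_smooth_fun).aemeasurable]
  refine lintegral_congr fun c => ?_
  rw [lintegral_prod]
  exact (hF.comp (by fun_prop)).aemeasurable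

lemma smooth_univ [SFinite ν] [SFinite f] [SFinite h] :
    smooth ν f h Set.univ = ν Set.univ * (f Set.univ * h Set.univ) := by
  rw [smooth, Measure.map_apply measurable_smooth_fun MeasurableSet.univ, Set.preimage_univ,
    ← Set.univ_prod_univ, Measure.prod_prod, ← Set.univ_prod_univ (α := E) (β := E),
    Measure.prod_prod]

instance [IsFiniteMeasure ν] [IsFiniteMeasure f] [IsFiniteMeasure h] :
    IsFiniteMeasure (smooth ν f h) := by
  unfold smooth; infer_instance

instance [IsProbabilityMeasure ν] [IsProbabilityMeasure f] [IsProbabilityMeasure h] :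
    IsProbabilityMeasure (smooth ν f h) := by
  unfold smooth
  exact Measure.isProbabilityMeasure_map measurable_smooth_fun.aemeasurable

lemma charFun_smooth [IsFiniteMeasure ν] [IsFiniteMeasure f] [IsFiniteMeasure h] (k : E) :
    charFun (smooth ν f h) k = ∫ c, charFun f (c.1 • k) * charFun h (c.2 • k) ∂ν := by
  have hcont : Continuous fun v : E => Complex.exp ((⟪v, k⟫ : ℝ) * Complex.I) := by fun_prop
  rw [charFun_apply, smooth, integral_map measurable_smooth_fun.aemeasurable
    hcont.aestronglyMeasurable, integral_prod]
  · refine integral_congr_ae (Eventually.of_forall fun c => ?_)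
    simp only [charFun_apply]
    rw [← integral_prod_mul]
    refine integral_congr_ae (Eventually.of_forall fun x => ?_)
    simp only [← Complex.exp_add]
    congr 1
    rw [inner_add_left, real_inner_smul_left, real_inner_smul_left, real_inner_smul_right,
      real_inner_smul_right]
    push_cast
    ring
  · refine Integrable.of_bound (C := 1)
      (hcont.measurable.comp measurable_smooth_fun).aestronglyMeasurable
      (Eventually.of_forall fun x => ?_)
    rw [Complex.norm_exp_ofReal_mul_I]

lemma smooth_map_isometry [SFinite ν] [SFinite f] [SFinite h] (R : E ≃ₗᵢ[ℝ] E)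
    (hf : f.map R = f) (hh : h.map R = h) : (smooth ν f h).map R = smooth ν f h := by
  have hR : Measurable R := R.continuous.measurable
  conv_rhs => rw [smooth, ← hf, ← hh, Measure.map_prod_map _ _ hR hR]
  have : (ν.prod ((f.prod h).map (Prod.map R R))) =
      (ν.prod (f.prod h)).map (Prod.map id (Prod.map R R)) := by
    conv_lhs => rw [← Measure.map_id (μ := ν)]
    rw [Measure.map_prod_map _ _ measurable_id (hR.prodMap hR)]
  rw [this, smooth, Measure.map_map hR measurable_smooth_fun,
    Measure.map_map measurable_smooth_fun (measurable_id.prodMap (hR.prodMap hR))]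
  congr 1
  ext x
  simp

lemma smooth_sum {ι : Type*} [Countable ι] [SFinite ν] (f h : ι → Measure E)
    [∀ i, SFinite (f i)] [∀ i, SFinite (h i)] :
    smooth ν (Measure.sum f) (Measure.sum h) =
      Measure.sum fun p : ι × ι => smooth ν (f p.1) (h p.2) := by
  unfold smooth
  rw [Measure.prod_sum, Measure.prod_sum_right, Measure.map_sum measurable_smooth_fun.aemeasurable]

lemma smooth_smul [SFinite ν] [SFinite f] [SFinite h] (c c' : ℝ≥0∞) :
    smooth ν (c • f) (c' • h) = (c * c') • smooth ν f h := by
  unfold smooth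
  rw [Measure.prod_smul_left, Measure.prod_smul_right, Measure.map_smul,
    Measure.prod_smul_right, Measure.prod_smul_right, Measure.map_smul, smul_smul]

end basic

end

/-! ### Wild sums -/

section

variable {E : Type*} [NormedAddCommGroup E] [InnerProductSpace ℝ E] [FiniteDimensional ℝ E]
  [MeasurableSpace E] [BorelSpace E]

/-- The terms of the Wild expansion: `Q₀ = f₀` and
`(n + 1) |ν| Q_{n+1} = ∑_{i + j = n} smooth ν Q_i Q_j`. -/
def wildTerm (ν : Measure (ℝ × ℝ)) (f₀ : Measure E) : ℕ → Measure E
  | 0 => f₀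
  | n + 1 => (((n + 1 : ℕ) : ℝ≥0∞) * ν Set.univ)⁻¹ •
      ∑ k : Fin (n + 1), smooth ν (wildTerm ν f₀ k) (wildTerm ν f₀ (n - k))
  decreasing_by all_goals omega

section wild

variable (ν : Measure (ℝ × ℝ)) (f₀ : Measure E)

lemma wildTerm_zero : wildTerm ν f₀ 0 = f₀ := by rw [wildTerm]

lemma wildTerm_succ (n : ℕ) : wildTerm ν f₀ (n + 1) =
    (((n + 1 : ℕ) : ℝ≥0∞) * ν Set.univ)⁻¹ •
      ∑ ij ∈ Finset.HasAntidiagonal.antidiagonal n,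
        smooth ν (wildTerm ν f₀ ij.1) (wildTerm ν f₀ ij.2) := by
  rw [wildTerm, Finset.Nat.sum_antidiagonal_eq_sum_range_succ
    (fun i j => smooth ν (wildTerm ν f₀ i) (wildTerm ν f₀ j)), Finset.sum_range]

lemma isProbabilityMeasure_wildTerm [IsFiniteMeasure ν] [NeZero ν] [IsProbabilityMeasure f₀]
    (n : ℕ) : IsProbabilityMeasure (wildTerm ν f₀ n) := by
  induction n using Nat.strong_induction_on with
  | _ n ih =>
    cases n with
    | zero => rw [wildTerm_zero]; infer_instance
    | succ n =>
      constructor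
      have hsum : ∀ ij ∈ Finset.HasAntidiagonal.antidiagonal n,
          smooth ν (wildTerm ν f₀ ij.1) (wildTerm ν f₀ ij.2) Set.univ = ν Set.univ := by
        intro ij hij
        rw [Finset.HasAntidiagonal.mem_antidiagonal] at hij
        have := ih ij.1 (by omega)
        have := ih ij.2 (by omega)
        rw [smooth_univ, measure_univ (μ := wildTerm ν f₀ ij.1),
          measure_univ (μ := wildTerm ν f₀ ij.2), mul_one, mul_one]
      rw [wildTerm_succ, Measure.smul_apply, Measure.finsetSum_apply, Finset.sum_congr rfl hsum,
        Finset.sum_const, Finset.Nat.card_antidiagonal, nsmul_eq_mul, smul_eq_mul]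
      refine ENNReal.inv_mul_cancel ?_ ?_
      · exact mul_ne_zero (by simp) (by simpa using NeZero.ne ν)
      · exact ENNReal.mul_ne_top (by simp) (measure_ne_top _ _)

/-- The geometric mixture `∑ (1 - y) yⁿ Qₙ` of the Wild terms; the solution at time `t` is obtained
for `y = 1 - exp (-|ν| t)`. -/
def wildSum (y : ℝ) : Measure E :=
  Measure.sum fun n => ENNReal.ofReal ((1 - y) * y ^ n) • wildTerm ν f₀ n

lemma wildSum_zero : wildSum ν f₀ 0 = f₀ := by
  ext s hs
  rw [wildSum, Measure.sum_apply _ hs, tsum_eq_single 0]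
  · simp [wildTerm_zero]
  · intro n hn
    simp [hn]

variable [IsFiniteMeasure ν] [NeZero ν] [IsProbabilityMeasure f₀]

lemma isProbabilityMeasure_wildSum {y : ℝ} (hy0 : 0 ≤ y) (hy1 : y < 1) :
    IsProbabilityMeasure (wildSum ν f₀ y) := by
  have := isProbabilityMeasure_wildTerm ν f₀
  constructor
  rw [wildSum, Measure.sum_apply _ MeasurableSet.univ]
  simp only [Measure.smul_apply, measure_univ, smul_eq_mul, mul_one]
  have hs : HasSum (fun n : ℕ => (1 - y) * y ^ n) 1 := by
    have := (hasSum_geometric_of_lt_one hy0 hy1).mul_left (1 - y)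
    rwa [mul_inv_cancel₀ (by linarith)] at this
  rw [← ENNReal.ofReal_tsum_of_nonneg
    (fun n => mul_nonneg (by linarith) (pow_nonneg hy0 n)) hs.summable, hs.tsum_eq,
    ENNReal.ofReal_one]

lemma hasSum_integral_wildSum {y : ℝ} (hy0 : 0 ≤ y) (hy1 : y < 1) (ψ : E →ᵇ ℝ) :
    HasSum (fun n => (1 - y) * y ^ n * ∫ v, ψ v ∂(wildTerm ν f₀ n))
      (∫ v, ψ v ∂(wildSum ν f₀ y)) := by
  have := isProbabilityMeasure_wildSum ν f₀ hy0 hy1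
  have hint : Integrable (fun v => ψ v) (wildSum ν f₀ y) := ψ.integrable _
  have h := hasSum_integral_measure (μ := fun n =>
    ENNReal.ofReal ((1 - y) * y ^ n) • wildTerm ν f₀ n) (f := fun v => ψ v) hint
  refine (congrArg (fun F : ℕ → ℝ => HasSum F _) (funext fun n => ?_)).mp h
  rw [integral_smul_measure, ENNReal.toReal_ofReal
    (mul_nonneg (by linarith) (pow_nonneg hy0 n)), smul_eq_mul]

lemma integral_wildTerm_succ (n : ℕ) (ψ : E →ᵇ ℝ) :
    ((n : ℝ) + 1) * ν.real Set.univ * ∫ v, ψ v ∂(wildTerm ν f₀ (n + 1)) =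
      ∑ ij ∈ Finset.HasAntidiagonal.antidiagonal n,
        ∫ v, ψ v ∂(smooth ν (wildTerm ν f₀ ij.1) (wildTerm ν f₀ ij.2)) := by
  have := isProbabilityMeasure_wildTerm ν f₀
  have hν : ν.real Set.univ ≠ 0 := by simp [Measure.real, ENNReal.toReal_eq_zero_iff, NeZero.ne ν]
  rw [wildTerm_succ, integral_smul_measure, integral_finsetSum_measure
    (fun ij _ => ψ.integrable _), ENNReal.toReal_inv, ENNReal.toReal_mul, ENNReal.toReal_natCast,
    smul_eq_mul, ← mul_assoc, Nat.cast_succ]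
  change ((n : ℝ) + 1) * ν.real Set.univ * (((n : ℝ) + 1) * ν.real Set.univ)⁻¹ * _ = _
  rw [mul_inv_cancel₀, one_mul]
  positivity

/-- The square of the geometric mixture is the Cauchy product of the Wild terms; the recursion for
`Q_{n+1}` identifies its coefficients. -/
lemma hasSum_integral_smooth_wildSum {y : ℝ} (hy0 : 0 ≤ y) (hy1 : y < 1) (ψ : E →ᵇ ℝ) :
    HasSum (fun n : ℕ => (1 - y) ^ 2 * y ^ n *
        (((n : ℝ) + 1) * ν.real Set.univ * ∫ v, ψ v ∂(wildTerm ν f₀ (n + 1))))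
      (∫ v, ψ v ∂(smooth ν (wildSum ν f₀ y) (wildSum ν f₀ y))) := by
  have := isProbabilityMeasure_wildTerm ν f₀
  have := isProbabilityMeasure_wildSum ν f₀ hy0 hy1
  have hint : Integrable (fun v => ψ v) (smooth ν (wildSum ν f₀ y) (wildSum ν f₀ y)) :=
    ψ.integrable _
  have hS : smooth ν (wildSum ν f₀ y) (wildSum ν f₀ y) = _ := smooth_sum ν
    (fun n => ENNReal.ofReal ((1 - y) * y ^ n) • wildTerm ν f₀ n)
    (fun n => ENNReal.ofReal ((1 - y) * y ^ n) • wildTerm ν f₀ n)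
  rw [hS] at hint ⊢
  have h := hasSum_integral_measure hint
  have hnn : ∀ n : ℕ, 0 ≤ (1 - y) * y ^ n :=
    fun n => mul_nonneg (by linarith) (pow_nonneg hy0 n)
  rw [← (Finset.HasAntidiagonal.sigmaAntidiagonalEquivProd (A := ℕ)).hasSum_iff] at h
  have h2 := h.sigma (fun n => hasSum_fintype _)
  refine (congrArg (fun F : ℕ → ℝ => HasSum F _) (funext fun n => ?_)).mp h2
  symm
  rw [integral_wildTerm_succ, Finset.mul_sum]
  rw [← Finset.sum_coe_sort (Finset.HasAntidiagonal.antidiagonal n)]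
  refine Finset.sum_congr rfl fun ij _ => ?_
  have hij : ij.1.1 + ij.1.2 = n := Finset.HasAntidiagonal.mem_antidiagonal.1 ij.2
  simp only [Function.comp_apply, Finset.HasAntidiagonal.sigmaAntidiagonalEquivProd_apply]
  rw [smooth_smul, integral_smul_measure, ENNReal.toReal_mul, ENNReal.toReal_ofReal (hnn _),
    ENNReal.toReal_ofReal (hnn _), smul_eq_mul]
  congr 1
  have hpow : y ^ n = y ^ ij.1.1 * y ^ ij.1.2 := by rw [← pow_add, hij]
  rw [hpow]
  ring

end wild

lemma hasDerivAt_tsum_pow_mul {c : ℕ → ℝ} {C : ℝ} (hc : ∀ n, |c n| ≤ C) {y : ℝ} (hy : |y| < 1) :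
    HasDerivAt (fun z => ∑' n, z ^ n * c n) (∑' n : ℕ, y ^ n * (((n : ℝ) + 1) * c (n + 1))) y := by
  obtain ⟨r, hyr, hr1⟩ := exists_between hy
  have hr0 : 0 < r := (abs_nonneg y).trans_lt hyr
  have hrn : ‖r‖ < 1 := by rwa [Real.norm_of_nonneg hr0.le]
  have hsum : Summable fun n : ℕ => (n : ℝ) * r ^ (n - 1) * C := by
    refine Summable.mul_right _ ((summable_nat_add_iff 1).1 ?_)
    have h1 := (summable_pow_mul_geometric_of_norm_lt_one 1 hrn).add
      (summable_geometric_of_lt_one hr0.le hr1)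
    refine h1.congr fun n => ?_
    simp; ring
  have key := hasDerivAt_tsum_of_isPreconnected (g := fun n z => z ^ n * c n)
    (g' := fun n z => (n : ℝ) * z ^ (n - 1) * c n) (t := Set.Ioo (-r) r) (y₀ := 0) (y := y)
    hsum isOpen_Ioo isPreconnected_Ioo
    (fun n z _ => (hasDerivAt_pow n z).mul_const (c n))
    (fun n z hz => by
      rw [norm_mul, norm_mul, norm_pow, Real.norm_natCast]
      have hz' : ‖z‖ ≤ r := abs_le.2 ⟨hz.1.le, hz.2.le⟩
      have : ‖c n‖ ≤ C := hc n
      gcongr)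
    ⟨by linarith, hr0⟩
    (summable_of_ne_finset_zero (s := {0}) fun n hn => by
      have : n ≠ 0 := by simpa using hn
      simp [this])
    (abs_lt.1 hyr)
  refine key.congr_deriv ?_
  have hsum' : Summable fun n : ℕ => (n : ℝ) * y ^ (n - 1) * c n := by
    refine Summable.of_norm_bounded hsum fun n => ?_
    rw [norm_mul, norm_mul, norm_pow, Real.norm_natCast]
    have hz' : ‖y‖ ≤ r := hyr.le
    have : ‖c n‖ ≤ C := hc n
    gcongr
  rw [hsum'.tsum_eq_zero_add]
  simp only [CharP.cast_eq_zero, zero_mul, zero_add, Nat.cast_add, Nat.cast_one,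
    Nat.add_sub_cancel]
  exact tsum_congr fun n => by ring

/-- The Wild sum solves the Kac-type equation `d/dt (f, ψ) = (smooth ν f f, ψ) - |ν| (f, ψ)`. -/
lemma exists_solution (ν : Measure (ℝ × ℝ)) [IsFiniteMeasure ν] [NeZero ν]
    (f₀ : ProbabilityMeasure E) :
    ∃ f : ℝ → ProbabilityMeasure E, f 0 = f₀ ∧
      (∀ ψ : E →ᵇ ℝ, ∀ t : ℝ, 0 ≤ t →
        HasDerivWithinAt (fun τ : ℝ => ∫ v, ψ v ∂(f τ : Measure E))
          (∫ v, ψ v ∂(smooth ν (f t : Measure E) (f t : Measure E)) -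
            ν.real Set.univ * ∫ v, ψ v ∂(f t : Measure E)) (Set.Ici 0) t) ∧
      ∀ R : E ≃ₗᵢ[ℝ] E, (f₀ : Measure E).map R = f₀ → ∀ t,
        (f t : Measure E).map R = f t := by
  set Λ := ν.real Set.univ with hΛ
  have hΛ0 : 0 < Λ := by
    have : Λ ≠ 0 := by simp [hΛ, Measure.real, ENNReal.toReal_eq_zero_iff, NeZero.ne ν]
    exact lt_of_le_of_ne measureReal_nonneg this.symm
  -- For `t < 0`, where nothing is claimed, the solution is continued by its value at `0`.
  set y : ℝ → ℝ := fun t => 1 - Real.exp (-Λ * max t 0) with hy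
  have hy0 : ∀ t, 0 ≤ y t := fun t => by
    have : Real.exp (-Λ * max t 0) ≤ 1 := Real.exp_le_one_iff.2 (by
      have := mul_nonneg hΛ0.le (le_max_right t 0); linarith)
    simp only [hy]; linarith
  have hy1 : ∀ t, y t < 1 := fun t => by
    have := Real.exp_pos (-Λ * max t 0)
    simp only [hy]; linarith
  have hprob := isProbabilityMeasure_wildTerm ν (f₀ : Measure E)
  obtain ⟨f, hf⟩ : ∃ f : ℝ → ProbabilityMeasure E, ∀ t, (f t : Measure E) = wildSum ν f₀ (y t) :=
    ⟨fun t => ⟨wildSum ν f₀ (y t), isProbabilityMeasure_wildSum ν _ (hy0 t) (hy1 t)⟩,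
      fun _ => rfl⟩
  refine ⟨f, ?_, ?_, ?_⟩
  · apply Subtype.ext
    have : y 0 = 0 := by simp [hy]
    change (f 0 : Measure E) = f₀
    rw [hf, this, wildSum_zero]
  · intro ψ t ht
    simp only [hf]
    set c : ℕ → ℝ := fun n => ∫ v, ψ v ∂(wildTerm ν (f₀ : Measure E) n) with hc
    have hcb : ∀ n, |c n| ≤ ‖ψ‖ := fun n => by
      have := ψ.norm_integral_le_norm (μ := wildTerm ν (f₀ : Measure E) n)
      exact this
    have hint : ∀ τ, ∫ v, ψ v ∂(wildSum ν (f₀ : Measure E) (y τ)) =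
        (1 - y τ) * ∑' n, (y τ) ^ n * c n := fun τ => by
      rw [← (hasSum_integral_wildSum ν (f₀ : Measure E) (hy0 τ) (hy1 τ) ψ).tsum_eq,
        ← tsum_mul_left]
      exact tsum_congr fun n => by ring
    have hsm : ∫ v, ψ v ∂(smooth ν (wildSum ν (f₀ : Measure E) (y t))
        (wildSum ν (f₀ : Measure E) (y t))) =
        Λ * (1 - y t) ^ 2 * ∑' n : ℕ, (y t) ^ n * (((n : ℝ) + 1) * c (n + 1)) := by
      rw [← (hasSum_integral_smooth_wildSum ν (f₀ : Measure E) (hy0 t) (hy1 t) ψ).tsum_eq,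
        ← tsum_mul_left]
      exact tsum_congr fun n => by simp only [hc]; ring
    rw [hsm]
    simp_rw [hint]
    have hyd : HasDerivWithinAt y (Λ * (1 - y t)) (Set.Ici 0) t := by
      have h1 : HasDerivAt (fun τ => 1 - Real.exp (-Λ * τ)) (-(Real.exp (-Λ * t) * (-Λ * 1))) t :=
        (((hasDerivAt_id t).const_mul (-Λ)).exp).const_sub 1
      have h2 : HasDerivWithinAt y (-(Real.exp (-Λ * t) * (-Λ * 1))) (Set.Ici 0) t :=
        h1.hasDerivWithinAt.congr (fun τ hτ => by
          simp only [hy]; rw [max_eq_left hτ]) (by simp only [hy]; rw [max_eq_left ht])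
      convert h2 using 1
      simp only [hy]; rw [max_eq_left ht]; ring
    have habs : |y t| < 1 := by rw [abs_of_nonneg (hy0 t)]; exact hy1 t
    -- In the variable `y` the equation reads `∂_y ((1 - y) ∑ yⁿ cₙ) = (1 - y) ∑ (n + 1) yⁿ cₙ₊₁ - ∑
    -- yⁿ cₙ`.
    have hH := (hasDerivAt_tsum_pow_mul hcb habs).comp_hasDerivWithinAt t hyd
    have := (hyd.const_sub 1).mul hH
    refine this.congr_deriv ?_
    simp only [Function.comp_apply]
    ring
  · intro R hR t
    have hRm : Measurable R := R.continuous.measurable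
    have hterm : ∀ n, (wildTerm ν (f₀ : Measure E) n).map R = wildTerm ν (f₀ : Measure E) n := by
      intro n
      induction n using Nat.strong_induction_on with
      | _ n ih =>
        cases n with
        | zero => rw [wildTerm_zero]; exact hR
        | succ n =>
          rw [wildTerm_succ, Measure.map_smul]
          congr 1
          rw [← Measure.mapₗ_apply_of_measurable hRm, map_sum]
          refine Finset.sum_congr rfl fun ij hij => ?_
          rw [Finset.HasAntidiagonal.mem_antidiagonal] at hij
          rw [Measure.mapₗ_apply_of_measurable hRm]
          exact smooth_map_isometry ν _ _ R (ih _ (by omega)) (ih _ (by omega))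
    rw [hf, wildSum]
    rw [Measure.map_sum hRm.aemeasurable]
    congr 1
    ext1 n
    rw [Measure.map_smul, hterm]

end

/-! ### A weighted comparison principle -/

section

/-- Duhamel's formula as an estimate: a source of size `B exp (κ t)` in `D' = R - Λ D` contributes
at most `B / (Λ + κ) exp (κ t)`. -/
lemma norm_le_of_deriv_sub_smul {F : Type*} [NormedAddCommGroup F] [NormedSpace ℝ F]
    {D R : ℝ → F} {Λ κ A B T : ℝ} (hκ : 0 < Λ + κ) (hA : 0 ≤ A) (hB : 0 ≤ B)
    (hD : ∀ t, 0 ≤ t → HasDerivWithinAt D (R t - Λ • D t) (Set.Ici 0) t)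
    (h0 : ‖D 0‖ ≤ A) (hR : ∀ t ∈ Set.Icc 0 T, ‖R t‖ ≤ B * Real.exp (κ * t)) :
    ∀ t ∈ Set.Icc 0 T, ‖D t‖ ≤ (A + B / (Λ + κ)) * Real.exp (κ * t) := by
  have hexp : ∀ (c t : ℝ), HasDerivAt (fun τ => Real.exp (c * τ)) (Real.exp (c * t) * c) t :=
    fun c t => by simpa using ((hasDerivAt_id t).const_mul c).exp
  set G : ℝ → F := fun t => Real.exp (Λ * t) • D t with hG
  have hGd : ∀ t, 0 ≤ t → HasDerivWithinAt G (Real.exp (Λ * t) • R t) (Set.Ici 0) t := by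
    intro t ht
    refine ((hexp Λ t).hasDerivWithinAt.smul (hD t ht)).congr_deriv ?_
    rw [smul_sub, smul_smul]
    abel
  have key : ∀ ⦃t⦄, t ∈ Set.Icc 0 T →
      ‖G t‖ ≤ A + B / (Λ + κ) * Real.exp ((Λ + κ) * t) := by
    refine image_norm_le_of_norm_deriv_right_le_deriv_boundary
      (f' := fun t => Real.exp (Λ * t) • R t) (B' := fun t => B * Real.exp ((Λ + κ) * t))
      (fun t ht => ((hGd t ht.1).continuousWithinAt).mono Set.Icc_subset_Ici_self)
      (fun t ht => (hGd t ht.1).mono (Set.Ici_subset_Ici.2 ht.1)) ?_ ?_ ?_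
    · simp only [hG, mul_zero, Real.exp_zero, one_smul, mul_one]
      have : 0 ≤ B / (Λ + κ) := by positivity
      linarith
    · intro t
      refine (((hexp (Λ + κ) t).const_mul (B / (Λ + κ))).const_add A).congr_deriv ?_
      field_simp
    · intro t ht
      rw [norm_smul, Real.norm_of_nonneg (Real.exp_pos _).le]
      calc Real.exp (Λ * t) * ‖R t‖ ≤ Real.exp (Λ * t) * (B * Real.exp (κ * t)) := by
            gcongr; exact hR t ⟨ht.1, ht.2.le⟩
        _ = B * Real.exp ((Λ + κ) * t) := by rw [add_mul, Real.exp_add]; ring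
  intro t ht
  have h1 := key ht
  have hDG : ‖D t‖ = Real.exp (-(Λ * t)) * ‖G t‖ := by
    simp only [hG]
    rw [norm_smul, Real.norm_of_nonneg (Real.exp_pos _).le, ← mul_assoc, ← Real.exp_add]
    simp
  have h2 : Real.exp (-(Λ * t)) ≤ Real.exp (κ * t) := by
    apply Real.exp_le_exp.2
    have := mul_nonneg hκ.le ht.1
    linarith
  calc ‖D t‖ = Real.exp (-(Λ * t)) * ‖G t‖ := hDG
    _ ≤ Real.exp (-(Λ * t)) * (A + B / (Λ + κ) * Real.exp ((Λ + κ) * t)) := by gcongr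
    _ = Real.exp (-(Λ * t)) * A + B / (Λ + κ) *
        (Real.exp (-(Λ * t)) * Real.exp ((Λ + κ) * t)) := by ring
    _ = Real.exp (-(Λ * t)) * A + B / (Λ + κ) * Real.exp (κ * t) := by
        rw [← Real.exp_add]; congr 3; ring
    _ ≤ Real.exp (κ * t) * A + B / (Λ + κ) * Real.exp (κ * t) := by gcongr
    _ = _ := by ring

/-- Let `∂ₜ D = R - Λ D`, and let the source `R` at time `t` be at most `c M W` in norm whenever
`D` is at most `M W` at that time. If `D` starts below `C W` and is locally (in time) bounded by a
multiple of the weight `W`, then it grows at most like `exp (κ t) W` for every `κ > c - Λ`. The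
point is that the constant does not involve the a priori bound. -/
lemma weighted_comparison {K : Type*} {D R : ℝ → K → ℂ} {W : K → ℝ} {Λ κ c C : ℝ}
    (hW : ∀ k, 0 ≤ W k) (hc : 0 ≤ c) (hκ : c < Λ + κ) (hC : 0 ≤ C)
    (hD : ∀ k t, 0 ≤ t →
      HasDerivWithinAt (fun τ => D τ k) (R t k - Λ * D t k) (Set.Ici 0) t)
    (h0 : ∀ k, ‖D 0 k‖ ≤ C * W k)
    (hR : ∀ t, 0 ≤ t → ∀ M, 0 ≤ M → (∀ k, ‖D t k‖ ≤ M * W k) → ∀ k, ‖R t k‖ ≤ c * M * W k)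
    (hap : ∀ T, 0 ≤ T → ∃ B, 0 ≤ B ∧ ∀ t ∈ Set.Icc 0 T, ∀ k, ‖D t k‖ ≤ B * W k) :
    ∀ t, 0 ≤ t → ∀ k, ‖D t k‖ ≤ C * (Λ + κ) / (Λ + κ - c) * Real.exp (κ * t) * W k := by
  intro T hT
  have hκ0 : 0 < Λ + κ := hc.trans_lt hκ
  set S : Set ℝ := {M | 0 ≤ M ∧ ∀ t ∈ Set.Icc 0 T, ∀ k, ‖D t k‖ ≤ M * Real.exp (κ * t) * W k}
    with hS
  have hSne : S.Nonempty := by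
    obtain ⟨B, hB, hB'⟩ := hap T hT
    refine ⟨B * Real.exp (|κ| * T), by positivity, fun t ht k => (hB' t ht k).trans ?_⟩
    refine mul_le_mul_of_nonneg_right ?_ (hW k)
    rw [mul_assoc, ← Real.exp_add]
    refine le_mul_of_one_le_right hB (Real.one_le_exp ?_)
    have h1 : |κ| * t ≤ |κ| * T := mul_le_mul_of_nonneg_left ht.2 (abs_nonneg κ)
    have h2 : -(κ * t) ≤ |κ| * t := by
      rw [← neg_mul]; exact mul_le_mul_of_nonneg_right (neg_le_abs κ) ht.1
    linarith
  have hSbdd : BddBelow S := ⟨0, fun M hM => hM.1⟩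
  have hSclosed : IsClosed S := by
    have : S = Set.Ici 0 ∩ ⋂ t ∈ Set.Icc 0 T, ⋂ k,
        {M | ‖D t k‖ ≤ M * Real.exp (κ * t) * W k} := by
      ext M; simp [hS]
    rw [this]
    refine isClosed_Ici.inter (isClosed_biInter fun t _ => isClosed_iInter fun k => ?_)
    exact isClosed_le continuous_const (by fun_prop)
  -- The best constant `M` is attained, and Duhamel's formula improves it to `C + c M / (Λ + κ)`.
  have hmem := hSclosed.csInf_mem hSne hSbdd
  set M := sInf S
  have hstep : C + c * M / (Λ + κ) ∈ S := by
    have hM := hmem.1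
    refine ⟨by positivity, fun t ht k => ?_⟩
    have hWk := hW k
    have := norm_le_of_deriv_sub_smul (D := fun τ => D τ k) (R := fun τ => R τ k) (Λ := Λ) (κ := κ)
      (A := C * W k) (B := c * M * W k) (T := T) hκ0 (by positivity) (by positivity)
      (fun t ht => by simpa using hD k t ht) (h0 k) (fun t ht => by
        refine (hR t ht.1 (M * Real.exp (κ * t)) (by positivity)
          (fun k => hmem.2 t ht k) k).trans (le_of_eq (by ring))) t ht
    refine this.trans (le_of_eq (by ring))
  have hle : M ≤ C + c * M / (Λ + κ) := csInf_le hSbdd hstep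
  have hM : M ≤ C * (Λ + κ) / (Λ + κ - c) := by
    rw [le_div_iff₀ (by linarith)]
    have h3 : M * (Λ + κ) ≤ (C + c * M / (Λ + κ)) * (Λ + κ) := by gcongr
    have h4 : (C + c * M / (Λ + κ)) * (Λ + κ) = C * (Λ + κ) + c * M := by field_simp
    linarith
  intro k
  refine (hmem.2 T ⟨hT, le_rfl⟩ k).trans ?_
  have := hW k
  gcongr

end

/-! ### Contraction of the smoothing operation in weighted Fourier distances -/

section

variable {E : Type*} [NormedAddCommGroup E] [InnerProductSpace ℝ E] [FiniteDimensional ℝ E]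
  [MeasurableSpace E] [BorelSpace E]

/-- `∫ (a^{2q} + b^{2q}) ν(da, db)`. In terms of the squared weights `α = a²`, `β = b²` this is
`∫ (α^q + β^q)`. -/
def weightMoment (ν : Measure (ℝ × ℝ)) (q : ℝ) : ℝ :=
  ∫ c, (c.1 ^ (2 * q) + c.2 ^ (2 * q)) ∂ν

/-- Smoothing acts on weighted Fourier distances like the linear operator `W ↦ ∫ (W (a k) + W (b k))
dν` on the weight, because characteristic functions are bounded by `1`. -/
lemma norm_charFun_smooth_sub_le {ν : Measure (ℝ × ℝ)} [IsFiniteMeasure ν]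
    {f g : Measure E} [IsProbabilityMeasure f] [IsProbabilityMeasure g] {W : E → ℝ} {M c : ℝ}
    {k : E} (hint : Integrable (fun x : ℝ × ℝ => W (x.1 • k) + W (x.2 • k)) ν) (hM : 0 ≤ M)
    (hW : ∫ x, (W (x.1 • k) + W (x.2 • k)) ∂ν ≤ c * W k)
    (hfg : ∀ k, ‖charFun f k - charFun g k‖ ≤ M * W k) :
    ‖charFun (smooth ν f f) k - charFun (smooth ν g g) k‖ ≤ c * M * W k := by
  have hi : ∀ (h : Measure E) [IsProbabilityMeasure h],
      Integrable (fun x : ℝ × ℝ => charFun h (x.1 • k) * charFun h (x.2 • k)) ν := by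
    intro h _
    refine Integrable.of_bound (C := 1) ?_ (Eventually.of_forall fun x => ?_)
    · have hm : Measurable (charFun h) := measurable_charFun
      exact ((hm.comp (by fun_prop)).mul (hm.comp (by fun_prop))).aestronglyMeasurable
    · rw [norm_mul]
      exact mul_le_one₀ (norm_charFun_le_one _) (norm_nonneg _) (norm_charFun_le_one _)
  rw [charFun_smooth, charFun_smooth, ← integral_sub (hi f) (hi g)]
  calc _ ≤ ∫ x, M * (W (x.1 • k) + W (x.2 • k)) ∂ν := by
        refine norm_integral_le_of_norm_le (hint.const_mul M) (Eventually.of_forall fun x => ?_)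
        have h1 := hfg (x.1 • k)
        have h2 := hfg (x.2 • k)
        calc ‖charFun f (x.1 • k) * charFun f (x.2 • k)
                - charFun g (x.1 • k) * charFun g (x.2 • k)‖
            = ‖(charFun f (x.1 • k) - charFun g (x.1 • k)) * charFun f (x.2 • k)
                + charFun g (x.1 • k) * (charFun f (x.2 • k) - charFun g (x.2 • k))‖ := by
              congr 1; ring
          _ ≤ ‖charFun f (x.1 • k) - charFun g (x.1 • k)‖ * 1
                + 1 * ‖charFun f (x.2 • k) - charFun g (x.2 • k)‖ := by
              refine (norm_add_le _ _).trans ?_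
              rw [norm_mul, norm_mul]
              gcongr
              · exact norm_charFun_le_one _
              · exact norm_charFun_le_one _
          _ ≤ M * (W (x.1 • k) + W (x.2 • k)) := by linarith
    _ = M * ∫ x, (W (x.1 • k) + W (x.2 • k)) ∂ν := integral_const_mul _ _
    _ ≤ M * (c * W k) := by gcongr
    _ = c * M * W k := by ring

lemma norm_smul_rpow {a : ℝ} (ha : 0 ≤ a) (k : E) (r : ℝ) : ‖a • k‖ ^ r = a ^ r * ‖k‖ ^ r := by
  rw [norm_smul, Real.norm_of_nonneg ha, Real.mul_rpow ha (norm_nonneg _)]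

/-- Smoothing contracts the distance `sup ‖φ_f - φ_g‖ / ‖k‖^{2q}` by the factor
`weightMoment ν q`. -/
lemma norm_charFun_smooth_sub_le_rpow {ν : Measure (ℝ × ℝ)} [IsFiniteMeasure ν]
    {f g : Measure E} [IsProbabilityMeasure f] [IsProbabilityMeasure g] {M q : ℝ}
    (hν : ∀ᵐ x ∂ν, 0 ≤ x.1 ∧ 0 ≤ x.2)
    (hint : Integrable (fun x : ℝ × ℝ => x.1 ^ (2 * q) + x.2 ^ (2 * q)) ν) (hM : 0 ≤ M)
    (hfg : ∀ k, ‖charFun f k - charFun g k‖ ≤ M * ‖k‖ ^ (2 * q)) (k : E) :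
    ‖charFun (smooth ν f f) k - charFun (smooth ν g g) k‖
      ≤ weightMoment ν q * M * ‖k‖ ^ (2 * q) := by
  have hae : (fun x : ℝ × ℝ => ‖x.1 • k‖ ^ (2 * q) + ‖x.2 • k‖ ^ (2 * q)) =ᵐ[ν]
      fun x => (x.1 ^ (2 * q) + x.2 ^ (2 * q)) * ‖k‖ ^ (2 * q) := by
    filter_upwards [hν] with x hx
    rw [norm_smul_rpow hx.1, norm_smul_rpow hx.2]; ring
  refine norm_charFun_smooth_sub_le (W := fun k => ‖k‖ ^ (2 * q))
    ((hint.mul_const _).congr hae.symm) hM (le_of_eq ?_) hfg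
  rw [integral_congr_ae hae, integral_mul_const, weightMoment]

/-! ### Stability of solutions -/

/-- The law of `(a, b)` is supported in the positive quarter of the closed unit disc: a collision
does not create energy. -/
def IsDissipative (ν : Measure (ℝ × ℝ)) : Prop :=
  ∀ᵐ x ∂ν, 0 ≤ x.1 ∧ 0 ≤ x.2 ∧ x.1 ^ 2 + x.2 ^ 2 ≤ 1

lemma IsDissipative.le_one {ν : Measure (ℝ × ℝ)} (hν : IsDissipative ν) :
    ∀ᵐ x ∂ν, (0 ≤ x.1 ∧ x.1 ≤ 1) ∧ 0 ≤ x.2 ∧ x.2 ≤ 1 := by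
  filter_upwards [hν] with x hx
  refine ⟨⟨hx.1, ?_⟩, hx.2.1, ?_⟩ <;> nlinarith [hx.1, hx.2.1, hx.2.2]

lemma measurable_rpow_add (r : ℝ) : Measurable fun x : ℝ × ℝ => x.1 ^ r + x.2 ^ r := by
  fun_prop

lemma IsDissipative.integrable {ν : Measure (ℝ × ℝ)} [IsFiniteMeasure ν] (hν : IsDissipative ν)
    {r : ℝ} (hr : 0 ≤ r) : Integrable (fun x : ℝ × ℝ => x.1 ^ r + x.2 ^ r) ν := by
  refine Integrable.of_bound (C := 2) (measurable_rpow_add r).aestronglyMeasurable ?_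
  filter_upwards [hν.le_one] with x hx
  have h1 := Real.rpow_le_one hx.1.1 hx.1.2 hr
  have h2 := Real.rpow_le_one hx.2.1 hx.2.2 hr
  have h3 := Real.rpow_nonneg hx.1.1 r
  have h4 := Real.rpow_nonneg hx.2.1 r
  rw [Real.norm_of_nonneg (by positivity)]
  linarith

/-- Solutions of the Fourier transformed Kac-type equation `∂ₜ φ = ∫ φ(a k) φ(b k) dν - |ν| φ`. -/
def IsKacSolution (ν : Measure (ℝ × ℝ)) (f : ℝ → ProbabilityMeasure E) : Prop :=
  ∀ k t, 0 ≤ t → HasDerivWithinAt (fun τ => charFun (f τ : Measure E) k)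
    (charFun (smooth ν (f t : Measure E) (f t : Measure E)) k -
      (ν.real Set.univ : ℝ) * charFun (f t : Measure E) k) (Set.Ici 0) t

/-- The weighted Fourier distance of two solutions grows at most like `exp (κ t)` for every
`κ > weightMoment ν q - |ν|`. -/
lemma IsKacSolution.norm_sub_le {ν : Measure (ℝ × ℝ)} [IsFiniteMeasure ν] (hν : IsDissipative ν)
    {f g : ℝ → ProbabilityMeasure E} (hf : IsKacSolution ν f) (hg : IsKacSolution ν g)
    {C q κ : ℝ} (hC : 0 ≤ C) (hq : 0 < q) (hκ : weightMoment ν q < ν.real Set.univ + κ)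
    (h0 : ∀ k, ‖charFun (f 0 : Measure E) k - charFun (g 0 : Measure E) k‖ ≤ C * ‖k‖ ^ (2 * q)) :
    ∃ C', 0 ≤ C' ∧ ∀ t, 0 ≤ t → ∀ k,
      ‖charFun (f t : Measure E) k - charFun (g t : Measure E) k‖
        ≤ C' * Real.exp (κ * t) * ‖k‖ ^ (2 * q) := by
  set Λ := ν.real Set.univ with hΛ
  have hΛ0 : 0 ≤ Λ := measureReal_nonneg
  set D : ℝ → E → ℂ := fun t k => charFun (f t : Measure E) k - charFun (g t : Measure E) k with hDd
  set R : ℝ → E → ℂ := fun t k => charFun (smooth ν (f t : Measure E) (f t : Measure E)) k -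
    charFun (smooth ν (g t : Measure E) (g t : Measure E)) k with hRd
  have hD : ∀ k t, 0 ≤ t →
      HasDerivWithinAt (fun τ => D τ k) (R t k - (Λ : ℝ) * D t k) (Set.Ici 0) t := by
    intro k t ht
    refine ((hf k t ht).sub (hg k t ht)).congr_deriv ?_
    simp only [hDd, hRd]
    ring
  have hD2 : ∀ t k, ‖D t k‖ ≤ 2 := fun t k => by
    refine (_root_.norm_sub_le _ _).trans ?_
    have h1 := norm_charFun_le_one (μ := (f t : Measure E)) k
    have h2 := norm_charFun_le_one (μ := (g t : Measure E)) k
    linarith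
  have hν' : ∀ᵐ x ∂ν, 0 ≤ x.1 ∧ 0 ≤ x.2 := hν.mono fun x hx => ⟨hx.1, hx.2.1⟩
  have hint := hν.integrable (r := 2 * q) (by positivity)
  -- The a priori bound by a multiple of `‖k‖^{2q}` comes from the weights `‖k‖^{2q} + δ`, `δ → 0`.
  have hap : ∀ t, 0 ≤ t → ∀ k, ‖D t k‖ ≤
      C * (Λ + (Λ + 1)) / (Λ + (Λ + 1) - 2 * Λ) * Real.exp ((Λ + 1) * t) * ‖k‖ ^ (2 * q) := by
    intro t ht k
    have hδ : ∀ δ : ℝ, 0 < δ → ‖D t k‖ ≤ C * (Λ + (Λ + 1)) / (Λ + (Λ + 1) - 2 * Λ) *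
        Real.exp ((Λ + 1) * t) * (‖k‖ ^ (2 * q) + δ) := by
      intro δ hδ
      refine weighted_comparison (D := D) (R := R) (W := fun k => ‖k‖ ^ (2 * q) + δ)
        (fun k => by positivity) (by positivity) (by linarith) hC hD
        (fun k => (h0 k).trans (by gcongr; linarith)) ?_ ?_ t ht k
      · intro t ht M hM hDM k
        have hle : ∀ a : ℝ, 0 ≤ a → a ≤ 1 → ‖a • k‖ ^ (2 * q) + δ ≤ ‖k‖ ^ (2 * q) + δ := by
          intro a ha ha1
          rw [norm_smul_rpow ha]
          have := Real.rpow_le_one ha ha1 (by positivity : 0 ≤ 2 * q)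
          have h2 : 0 ≤ ‖k‖ ^ (2 * q) := by positivity
          nlinarith
        have hint' : Integrable (fun x : ℝ × ℝ =>
            (‖x.1 • k‖ ^ (2 * q) + δ) + (‖x.2 • k‖ ^ (2 * q) + δ)) ν := by
          refine Integrable.of_bound (C := 2 * (‖k‖ ^ (2 * q) + δ))
            (Measurable.aestronglyMeasurable (by fun_prop)) ?_
          filter_upwards [hν.le_one] with x hx
          rw [Real.norm_of_nonneg (by positivity)]
          have h1 := hle _ hx.1.1 hx.1.2
          have h2 := hle _ hx.2.1 hx.2.2
          linarith
        refine norm_charFun_smooth_sub_le (W := fun k => ‖k‖ ^ (2 * q) + δ) hint' hM ?_ hDM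
        calc _ ≤ ∫ _, 2 * (‖k‖ ^ (2 * q) + δ) ∂ν := by
              refine integral_mono_ae hint' (integrable_const _) ?_
              filter_upwards [hν.le_one] with x hx
              have h1 := hle _ hx.1.1 hx.1.2
              have h2 := hle _ hx.2.1 hx.2.2
              linarith
          _ = 2 * Λ * (‖k‖ ^ (2 * q) + δ) := by
              rw [integral_const, smul_eq_mul, ← hΛ]; ring
      · intro T hT
        refine ⟨2 / δ, by positivity, fun t ht k => (hD2 t k).trans ?_⟩
        calc (2 : ℝ) = 2 / δ * δ := by field_simp
          _ ≤ 2 / δ * (‖k‖ ^ (2 * q) + δ) := by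
            gcongr
            have : 0 ≤ ‖k‖ ^ (2 * q) := by positivity
            linarith
    have hlim : Tendsto (fun δ : ℝ => C * (Λ + (Λ + 1)) / (Λ + (Λ + 1) - 2 * Λ) *
        Real.exp ((Λ + 1) * t) * (‖k‖ ^ (2 * q) + δ)) (𝓝[>] 0)
        (𝓝 (C * (Λ + (Λ + 1)) / (Λ + (Λ + 1) - 2 * Λ) *
        Real.exp ((Λ + 1) * t) * (‖k‖ ^ (2 * q) + 0))) := by
      refine (Continuous.tendsto ?_ 0).mono_left nhdsWithin_le_nhds
      fun_prop
    rw [add_zero] at hlim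
    exact ge_of_tendsto hlim (eventually_mem_nhdsWithin.mono fun δ hδ' => hδ δ hδ')
  have hm0 : 0 ≤ weightMoment ν q := integral_nonneg_of_ae (by
    filter_upwards [hν'] with x hx
    have := Real.rpow_nonneg hx.1 (2 * q)
    have := Real.rpow_nonneg hx.2 (2 * q)
    simp only [Pi.zero_apply]; positivity)
  refine ⟨C * (Λ + κ) / (Λ + κ - weightMoment ν q), ?_, ?_⟩
  · have h1 : 0 < Λ + κ := by linarith
    have h2 : 0 < Λ + κ - weightMoment ν q := by linarith
    positivity
  refine weighted_comparison (D := D) (R := R) (W := fun k => ‖k‖ ^ (2 * q))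
    (fun k => by positivity) hm0 hκ hC hD h0 ?_ ?_
  · intro t ht M hM hDM k
    exact norm_charFun_smooth_sub_le_rpow hν' hint hM hDM k
  · intro T hT
    refine ⟨C * (Λ + (Λ + 1)) / (Λ + (Λ + 1) - 2 * Λ) * Real.exp ((Λ + 1) * T), ?_, ?_⟩
    · have : Λ + (Λ + 1) - 2 * Λ = 1 := by ring
      rw [this]; positivity
    · intro t ht k
      refine (hap t ht.1 k).trans ?_
      have : Λ + (Λ + 1) - 2 * Λ = 1 := by ring
      rw [this]
      gcongr
      exact ht.2

end

/-! ### Fixed points of the smoothing operation -/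

section

variable {E : Type*} [NormedAddCommGroup E] [InnerProductSpace ℝ E] [FiniteDimensional ℝ E]
  [MeasurableSpace E] [BorelSpace E]

/-- Lévy's continuity theorem for a sequence that is geometrically Cauchy in a weighted Fourier
distance; the weight makes the limit continuous at the origin. -/
lemma exists_limit_of_geometric {f : ℕ → ProbabilityMeasure E} {C r s : ℝ}
    (hr1 : r < 1) (hs : 0 < s)
    (hf : ∀ n k, ‖charFun (f (n + 1) : Measure E) k - charFun (f n : Measure E) k‖
      ≤ C * r ^ n * ‖k‖ ^ s) :
    ∃ F : ProbabilityMeasure E, Tendsto f atTop (𝓝 F) ∧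
      ∀ k, ‖charFun (F : Measure E) k - charFun (f 0 : Measure E) k‖ ≤ C / (1 - r) * ‖k‖ ^ s := by
  have hd : ∀ k n, dist (charFun (f n : Measure E) k) (charFun (f (n + 1) : Measure E) k)
      ≤ C * ‖k‖ ^ s * r ^ n := fun k n => by
    rw [dist_comm, dist_eq_norm]; exact (hf n k).trans (le_of_eq (by ring))
  choose U hU using fun k => cauchySeq_tendsto_of_complete (cauchySeq_of_le_geometric r _ hr1 (hd k))
  have hU0 : ∀ k, ‖U k - charFun (f 0 : Measure E) k‖ ≤ C / (1 - r) * ‖k‖ ^ s := fun k => by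
    rw [← dist_eq_norm, dist_comm]
    exact (dist_le_of_le_geometric_of_tendsto₀ r _ hr1 (hd k) (hU k)).trans (le_of_eq (by ring))
  have hcont : ContinuousAt U 0 := by
    have hU1 : U 0 = charFun (f 0 : Measure E) 0 := by
      have := hU0 0
      rw [norm_zero, Real.zero_rpow hs.ne', mul_zero, norm_le_zero_iff, sub_eq_zero] at this
      exact this
    have hc : Tendsto (charFun (f 0 : Measure E)) (𝓝 0) (𝓝 (charFun (f 0 : Measure E) 0)) :=
      (continuous_charFun (μ := (f 0 : Measure E))).tendsto 0
    have hsm : Tendsto (fun k => U k - charFun (f 0 : Measure E) k) (𝓝 0) (𝓝 0) := by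
      refine squeeze_zero_norm hU0 ?_
      have : Tendsto (fun k : E => C / (1 - r) * ‖k‖ ^ s) (𝓝 0) (𝓝 (C / (1 - r) * ‖(0:E)‖ ^ s)) := by
        refine (Continuous.tendsto ?_ 0)
        exact continuous_const.mul (continuous_norm.rpow_const fun _ => Or.inr hs.le)
      simpa [Real.zero_rpow hs.ne'] using this
    have := hsm.add hc
    simp only [sub_add_cancel, zero_add] at this
    rw [ContinuousAt, hU1]
    exact this
  have htight := isTightMeasureSet_of_tendsto_charFun (μ := fun n => (f n : Measure E)) hcont hU
  have hcomp : IsCompact (closure (Set.range f)) := by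
    refine isCompact_closure_of_isTightMeasureSet ?_
    convert htight using 1
    ext μ
    simp
  obtain ⟨F, -, hF⟩ := hcomp.ultrafilter_le_nhds
    ((Ultrafilter.of (atTop : Filter ℕ)).map f) (by
      rw [Ultrafilter.coe_map, le_principal_iff, mem_map]
      exact Filter.univ_mem' fun n => subset_closure ⟨n, rfl⟩)
  have hchar : ∀ k, charFun (F : Measure E) k = U k := fun k => by
    have h1 : Tendsto (fun n => charFun (f n : Measure E) k)
        (Ultrafilter.of (atTop : Filter ℕ)) (𝓝 (charFun (F : Measure E) k)) := by
      have hF' : Tendsto f (Ultrafilter.of (atTop : Filter ℕ)) (𝓝 F) := hF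
      rw [ProbabilityMeasure.tendsto_iff_forall_integral_rclike_tendsto ℂ] at hF'
      simp_rw [charFun_eq_integral_innerProbChar]
      exact hF' _
    exact tendsto_nhds_unique h1 ((hU k).mono_left (Ultrafilter.of_le _))
  refine ⟨F, ProbabilityMeasure.tendsto_iff_tendsto_charFun.2 fun k => ?_, fun k => ?_⟩
  · rw [hchar]; exact hU k
  · rw [hchar]; exact hU0 k

lemma charFun_map_isometry (f : Measure E) (R : E ≃ₗᵢ[ℝ] E) (k : E) :
    charFun (f.map R) k = charFun f (R.symm k) := by
  rw [charFun_apply, charFun_apply, integral_map R.continuous.measurable.aemeasurable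
    (Continuous.aestronglyMeasurable (by fun_prop))]
  refine integral_congr_ae (Eventually.of_forall fun v => ?_)
  have : ⟪R v, k⟫ = ⟪v, R.symm k⟫ := by
    conv_lhs => rw [← R.apply_symm_apply k]
    exact R.inner_map_map _ _
  simp only [this]

/-- One smoothing step changes a law with the expansion `1 - ‖k‖^{2p}` only by `O(‖k‖^{2q})`,
because `weightMoment ρ p = 1`. -/
lemma norm_charFun_smooth_sub_self_le {ρ : Measure (ℝ × ℝ)} [IsProbabilityMeasure ρ]
    (hρ : ∀ᵐ x ∂ρ, 0 ≤ x.1 ∧ 0 ≤ x.2) {p q C : ℝ} (hp : 0 < p) (hpq : p < q) (hqp : q ≤ 2 * p)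
    (hip : Integrable (fun x : ℝ × ℝ => x.1 ^ (2 * p) + x.2 ^ (2 * p)) ρ)
    (hiq : Integrable (fun x : ℝ × ℝ => x.1 ^ (2 * q) + x.2 ^ (2 * q)) ρ)
    (hmp : weightMoment ρ p = 1) (f : Measure E) [IsProbabilityMeasure f] (hC : 0 ≤ C)
    (hf : ∀ k, ‖charFun f k - ((1 - ‖k‖ ^ (2 * p) : ℝ) : ℂ)‖ ≤ C * ‖k‖ ^ (2 * q)) (k : E) :
    ‖charFun (smooth ρ f f) k - charFun f k‖ ≤
      (C * (weightMoment ρ q + 1) + (2 + C) ^ 2 * weightMoment ρ q) * ‖k‖ ^ (2 * q) := by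
  have hq : 0 < q := hp.trans hpq
  -- Half of the power `2q` suffices for each factor of the product `(1 - φ(a k)) (1 - φ(b k))`
  -- below; this is where `q ≤ 2p` is used.
  have hg : ∀ k, ‖1 - charFun f k‖ ≤ (2 + C) * ‖k‖ ^ q := by
    intro k
    rcases le_total ‖k‖ 1 with hk | hk
    · have h1 : ‖k‖ ^ (2 * p) ≤ ‖k‖ ^ q :=
        Real.rpow_le_rpow_of_exponent_ge' (norm_nonneg _) hk hq.le hqp
      have h2 : ‖k‖ ^ (2 * q) ≤ ‖k‖ ^ q :=
        Real.rpow_le_rpow_of_exponent_ge' (norm_nonneg _) hk hq.le (by linarith)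
      have h3 : 0 ≤ ‖k‖ ^ q := by positivity
      calc ‖1 - charFun f k‖
          = ‖((‖k‖ ^ (2 * p) : ℝ) : ℂ) - (charFun f k - ((1 - ‖k‖ ^ (2 * p) : ℝ) : ℂ))‖ := by
            congr 1; push_cast; ring
        _ ≤ ‖k‖ ^ (2 * p) + C * ‖k‖ ^ (2 * q) := by
            refine (norm_sub_le _ _).trans (add_le_add ?_ (hf k))
            rw [Complex.norm_real, Real.norm_of_nonneg (by positivity)]
        _ ≤ ‖k‖ ^ q + C * ‖k‖ ^ q := by gcongr
        _ ≤ (2 + C) * ‖k‖ ^ q := by nlinarith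
    · have h1 : 1 ≤ ‖k‖ ^ q := Real.one_le_rpow hk hq.le
      have h2 := norm_one_sub_charFun_le_two (μ := f) (t := k)
      nlinarith
  set m := weightMoment ρ q with hm
  have hi : Integrable (fun x : ℝ × ℝ => charFun f (x.1 • k) * charFun f (x.2 • k)) ρ := by
    refine Integrable.of_bound (C := 1) ?_ (Eventually.of_forall fun x => ?_)
    · have hm : Measurable (charFun f) := measurable_charFun
      exact ((hm.comp (by fun_prop)).mul (hm.comp (by fun_prop))).aestronglyMeasurable
    · rw [norm_mul]
      exact mul_le_one₀ (norm_charFun_le_one _) (norm_nonneg _) (norm_charFun_le_one _)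
  -- The terms linear in `‖k‖^{2p}` have mean zero, since `∫ (a^{2p} + b^{2p}) dρ = 1`.
  have hlin : Integrable (fun x : ℝ × ℝ =>
      (((1 - (x.1 ^ (2 * p) + x.2 ^ (2 * p))) * ‖k‖ ^ (2 * p) : ℝ) : ℂ)) ρ :=
    (((integrable_const _).sub hip).mul_const _).ofReal
  have hlin0 : ∫ x, (((1 - (x.1 ^ (2 * p) + x.2 ^ (2 * p))) * ‖k‖ ^ (2 * p) : ℝ) : ℂ) ∂ρ = 0 := by
    rw [integral_complex_ofReal, integral_mul_const, integral_sub (integrable_const _) hip]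
    rw [weightMoment] at hmp
    rw [hmp]; simp
  have heq : charFun (smooth ρ f f) k - charFun f k =
      ∫ x, (charFun f (x.1 • k) * charFun f (x.2 • k) - charFun f k -
        (((1 - (x.1 ^ (2 * p) + x.2 ^ (2 * p))) * ‖k‖ ^ (2 * p) : ℝ) : ℂ)) ∂ρ := by
    have hi' : Integrable (fun x : ℝ × ℝ =>
        charFun f (x.1 • k) * charFun f (x.2 • k) - charFun f k) ρ := hi.sub (integrable_const _)
    rw [integral_sub hi' hlin, hlin0,
      integral_sub hi (integrable_const _), charFun_smooth]
    simp
  rw [heq]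
  have hbi : Integrable (fun x : ℝ × ℝ =>
      (C * (x.1 ^ (2 * q) + x.2 ^ (2 * q) + 1) + (2 + C) ^ 2 * (x.1 ^ (2 * q) + x.2 ^ (2 * q)))
        * ‖k‖ ^ (2 * q)) ρ :=
    (((hiq.add (integrable_const _)).const_mul _).add (hiq.const_mul _)).mul_const _
  calc _ ≤ ∫ x : ℝ × ℝ, (C * (x.1 ^ (2 * q) + x.2 ^ (2 * q) + 1)
        + (2 + C) ^ 2 * (x.1 ^ (2 * q) + x.2 ^ (2 * q))) * ‖k‖ ^ (2 * q) ∂ρ := by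
        refine norm_integral_le_of_norm_le hbi ?_
        filter_upwards [hρ] with x hx
        set e : E → ℂ := fun k => charFun f k - ((1 - ‖k‖ ^ (2 * p) : ℝ) : ℂ) with he
        have hsplit : charFun f (x.1 • k) * charFun f (x.2 • k) - charFun f k -
            (((1 - (x.1 ^ (2 * p) + x.2 ^ (2 * p))) * ‖k‖ ^ (2 * p) : ℝ) : ℂ) =
            (e (x.1 • k) + e (x.2 • k) - e k) +
              (1 - charFun f (x.1 • k)) * (1 - charFun f (x.2 • k)) := by
          simp only [he]
          rw [norm_smul_rpow hx.1, norm_smul_rpow hx.2]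
          push_cast
          ring
        rw [hsplit]
        have he1 : ‖e (x.1 • k)‖ ≤ C * (x.1 ^ (2 * q) * ‖k‖ ^ (2 * q)) := by
          rw [← norm_smul_rpow hx.1]; exact hf _
        have he2 : ‖e (x.2 • k)‖ ≤ C * (x.2 ^ (2 * q) * ‖k‖ ^ (2 * q)) := by
          rw [← norm_smul_rpow hx.2]; exact hf _
        have he0 : ‖e k‖ ≤ C * ‖k‖ ^ (2 * q) := hf k
        have hg1 : ‖1 - charFun f (x.1 • k)‖ ≤ (2 + C) * (x.1 ^ q * ‖k‖ ^ q) := by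
          rw [← norm_smul_rpow hx.1]; exact hg _
        have hg2 : ‖1 - charFun f (x.2 • k)‖ ≤ (2 + C) * (x.2 ^ q * ‖k‖ ^ q) := by
          rw [← norm_smul_rpow hx.2]; exact hg _
        have hsq : ∀ y : ℝ, 0 ≤ y → y ^ (2 * q) = (y ^ q) ^ 2 := fun y hy => by
          rw [mul_comm, Real.rpow_mul hy, Real.rpow_two]
        have hgg : ‖1 - charFun f (x.1 • k)‖ * ‖1 - charFun f (x.2 • k)‖ ≤
            (2 + C) ^ 2 * (x.1 ^ (2 * q) + x.2 ^ (2 * q)) * ‖k‖ ^ (2 * q) := by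
          have hx1 := Real.rpow_nonneg hx.1 q
          calc _ ≤ ((2 + C) * (x.1 ^ q * ‖k‖ ^ q)) * ((2 + C) * (x.2 ^ q * ‖k‖ ^ q)) := by
                gcongr
            _ = (2 + C) ^ 2 * (x.1 ^ q * x.2 ^ q) * ‖k‖ ^ (2 * q) := by
                rw [hsq _ (norm_nonneg k)]; ring
            _ ≤ _ := by
                gcongr
                rw [hsq _ hx.1, hsq _ hx.2]
                have := sq_nonneg (x.1 ^ q - x.2 ^ q)
                have h1 := Real.rpow_nonneg hx.1 q
                have h2 := Real.rpow_nonneg hx.2 q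
                nlinarith [mul_nonneg h1 h2]
        calc _ ≤ (‖e (x.1 • k)‖ + ‖e (x.2 • k)‖ + ‖e k‖) +
              ‖1 - charFun f (x.1 • k)‖ * ‖1 - charFun f (x.2 • k)‖ := by
              refine (norm_add_le _ _).trans (add_le_add ?_ (norm_mul _ _).le)
              exact (norm_sub_le _ _).trans (add_le_add_left (norm_add_le _ _) _)
          _ ≤ (C * (x.1 ^ (2 * q) * ‖k‖ ^ (2 * q)) + C * (x.2 ^ (2 * q) * ‖k‖ ^ (2 * q)) +
              C * ‖k‖ ^ (2 * q)) +
              (2 + C) ^ 2 * (x.1 ^ (2 * q) + x.2 ^ (2 * q)) * ‖k‖ ^ (2 * q) := by gcongr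
          _ = _ := by ring
    _ = _ := by
        have hi1 : Integrable (fun x : ℝ × ℝ => C * (x.1 ^ (2 * q) + x.2 ^ (2 * q) + 1)) ρ :=
          (hiq.add (integrable_const _)).const_mul _
        rw [integral_mul_const, integral_add hi1 (hiq.const_mul _), integral_const_mul,
          integral_const_mul,
          integral_add hiq (integrable_const _), hm, weightMoment]
        simp

/-- Iterating `f ↦ smooth ρ f f` from a law with the expansion `1 - ‖k‖^{2p} + O(‖k‖^{2q})`
converges weakly to a fixed point with the same expansion. -/
lemma exists_smooth_fixedPoint {ρ : Measure (ℝ × ℝ)} [IsProbabilityMeasure ρ]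
    (hρ : ∀ᵐ x ∂ρ, 0 ≤ x.1 ∧ 0 ≤ x.2) {p q C : ℝ} (hp : 0 < p) (hpq : p < q) (hqp : q ≤ 2 * p)
    (hip : Integrable (fun x : ℝ × ℝ => x.1 ^ (2 * p) + x.2 ^ (2 * p)) ρ)
    (hiq : Integrable (fun x : ℝ × ℝ => x.1 ^ (2 * q) + x.2 ^ (2 * q)) ρ)
    (hmp : weightMoment ρ p = 1) (hmq : weightMoment ρ q < 1) (f₀ : ProbabilityMeasure E)
    (hC : 0 ≤ C) (hf : ∀ k, ‖charFun (f₀ : Measure E) k - ((1 - ‖k‖ ^ (2 * p) : ℝ) : ℂ)‖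
      ≤ C * ‖k‖ ^ (2 * q)) :
    ∃ (F : ProbabilityMeasure E) (f : ℕ → ProbabilityMeasure E), f 0 = f₀ ∧
      (∀ n, (f (n + 1) : Measure E) = smooth ρ (f n : Measure E) (f n : Measure E)) ∧
      Tendsto f atTop (𝓝 F) ∧ smooth ρ (F : Measure E) (F : Measure E) = F ∧
      (∃ C', ∀ k, ‖charFun (F : Measure E) k - ((1 - ‖k‖ ^ (2 * p) : ℝ) : ℂ)‖
        ≤ C' * ‖k‖ ^ (2 * q)) ∧
      (∀ R : E ≃ₗᵢ[ℝ] E, (f₀ : Measure E).map R = f₀ → ∀ n, (f n : Measure E).map R = f n) ∧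
      ∀ R : E ≃ₗᵢ[ℝ] E, (f₀ : Measure E).map R = f₀ → (F : Measure E).map R = F := by
  have hq : 0 < q := hp.trans hpq
  set S : ProbabilityMeasure E → ProbabilityMeasure E := fun f =>
    ⟨smooth ρ (f : Measure E) (f : Measure E), inferInstance⟩ with hS
  have hScoe : ∀ f, (S f : Measure E) = smooth ρ (f : Measure E) (f : Measure E) := fun f => rfl
  set f : ℕ → ProbabilityMeasure E := fun n => S^[n] f₀ with hfdef
  have hsucc : ∀ n, f (n + 1) = S (f n) := fun n => Function.iterate_succ_apply' S n f₀
  have hm0 : 0 ≤ weightMoment ρ q := integral_nonneg_of_ae (by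
    filter_upwards [hρ] with x hx
    have := Real.rpow_nonneg hx.1 (2 * q)
    have := Real.rpow_nonneg hx.2 (2 * q)
    simp only [Pi.zero_apply]; positivity)
  set m := weightMoment ρ q with hm
  set A := C * (m + 1) + (2 + C) ^ 2 * m with hA
  have hA0 : 0 ≤ A := by positivity
  have hgeo : ∀ n k, ‖charFun (f (n + 1) : Measure E) k - charFun (f n : Measure E) k‖
      ≤ A * m ^ n * ‖k‖ ^ (2 * q) := by
    intro n
    induction n with
    | zero =>
      intro k
      rw [hsucc, hScoe, pow_zero, mul_one]
      exact norm_charFun_smooth_sub_self_le hρ hp hpq hqp hip hiq hmp _ hC hf k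
    | succ n ih =>
      intro k
      have hstep : (f (n + 1) : Measure E) = smooth ρ (f n : Measure E) (f n : Measure E) := by
        rw [hsucc, hScoe]
      rw [hsucc (n + 1), hScoe]
      conv_lhs => enter [1, 2, 1]; rw [hstep]
      refine (norm_charFun_smooth_sub_le_rpow hρ hiq (by positivity) ih k).trans (le_of_eq ?_)
      rw [pow_succ, ← hm]; ring
  obtain ⟨F, hF, hF0⟩ := exists_limit_of_geometric hmq (by positivity : 0 < 2 * q) hgeo
  have hFc := ProbabilityMeasure.tendsto_iff_tendsto_charFun.1 hF
  have hfix : smooth ρ (F : Measure E) (F : Measure E) = F := by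
    refine Measure.ext_of_charFun (funext fun k => ?_)
    refine tendsto_nhds_unique ?_ ((tendsto_add_atTop_iff_nat 1).2 (hFc k))
    simp_rw [hsucc, hScoe, charFun_smooth]
    refine tendsto_integral_of_dominated_convergence (fun _ => 1) (fun n => ?_)
      (integrable_const _) (fun n => Eventually.of_forall fun x => ?_)
      (Eventually.of_forall fun x => (hFc _).mul (hFc _))
    · have hm : Measurable (charFun (f n : Measure E)) := measurable_charFun
      exact ((hm.comp (by fun_prop)).mul (hm.comp (by fun_prop))).aestronglyMeasurable
    · rw [norm_mul]
      exact mul_le_one₀ (norm_charFun_le_one _) (norm_nonneg _) (norm_charFun_le_one _)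
  have hiso : ∀ R : E ≃ₗᵢ[ℝ] E, (f₀ : Measure E).map R = f₀ →
      ∀ n, (f n : Measure E).map R = f n := by
    intro R hR n
    induction n with
    | zero => exact hR
    | succ n ih => rw [hsucc, hScoe]; exact smooth_map_isometry ρ _ _ R ih ih
  refine ⟨F, f, rfl, fun n => by rw [hsucc, hScoe], hF, hfix, ⟨A / (1 - m) + C, fun k => ?_⟩, hiso,
    fun R hR => ?_⟩
  · have h1 := hF0 k
    have h2 := hf k
    calc _ = ‖(charFun (F : Measure E) k - charFun (f 0 : Measure E) k) +
          (charFun (f₀ : Measure E) k - ((1 - ‖k‖ ^ (2 * p) : ℝ) : ℂ))‖ := by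
            congr 1; simp only [hfdef, Function.iterate_zero, id]; ring
      _ ≤ _ := (norm_add_le _ _).trans (by linarith)
  · have : IsProbabilityMeasure ((F : Measure E).map R) :=
      Measure.isProbabilityMeasure_map R.continuous.measurable.aemeasurable
    refine Measure.ext_of_charFun (funext fun k => ?_)
    rw [charFun_map_isometry]
    refine tendsto_nhds_unique (hFc (R.symm k)) ?_
    convert hFc k using 2 with n
    rw [← charFun_map_isometry, hiso R hR]

end

/-! ### The spectral function -/

section

/-- The spectral function `μ(p) = (∫ (a^{2p} + b^{2p} - 1) dν) / p`. -/
def rate (ν : Measure (ℝ × ℝ)) (p : ℝ) : ℝ := (weightMoment ν p - ν.real Set.univ) / p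

/-- For `a = 0` the function vanishes on the open half line. -/
lemma convexOn_rpow_exponent {a : ℝ} (ha : 0 ≤ a) :
    ConvexOn ℝ (Set.Ioi 0) fun q : ℝ => a ^ (2 * q) := by
  rcases ha.eq_or_lt with rfl | ha
  · refine (convexOn_const 0 (convex_Ioi 0)).congr fun q hq => ?_
    have hq : 0 < q := hq
    rw [Real.zero_rpow (by positivity)]
  · have h := (convexOn_rpow_left (pow_pos ha 2)).subset (Set.subset_univ _) (convex_Ioi (0 : ℝ))
    refine h.congr fun q _ => ?_
    rw [Real.rpow_mul ha.le, Real.rpow_two]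

variable {ν : Measure (ℝ × ℝ)} [IsFiniteMeasure ν]

lemma convexOn_weightMoment (hν : IsDissipative ν) :
    ConvexOn ℝ (Set.Ioi 0) (weightMoment ν) := by
  refine ⟨convex_Ioi 0, fun x hx y hy a b ha hb hab => ?_⟩
  have hx : 0 < x := hx
  have hy : 0 < y := hy
  have hix := hν.integrable (r := 2 * x) (by positivity)
  have hiy := hν.integrable (r := 2 * y) (by positivity)
  have hxy : 0 < a • x + b • y := (convex_Ioi (0 : ℝ)) hx hy ha hb hab
  simp only [smul_eq_mul] at hxy ⊢
  rw [weightMoment, weightMoment, weightMoment, ← integral_const_mul, ← integral_const_mul,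
    ← integral_add (hix.const_mul _) (hiy.const_mul _)]
  refine integral_mono_ae (hν.integrable (by positivity))
    ((hix.const_mul _).add (hiy.const_mul _)) ?_
  filter_upwards [hν] with c hc
  have h1 := (convexOn_rpow_exponent hc.1).2 hx hy ha hb hab
  have h2 := (convexOn_rpow_exponent hc.2.1).2 hx hy ha hb hab
  simp only [smul_eq_mul] at h1 h2 ⊢
  linarith

lemma weightMoment_nonneg (hν : IsDissipative ν) (q : ℝ) : 0 ≤ weightMoment ν q :=
  integral_nonneg_of_ae (by
    filter_upwards [hν] with x hx
    have := Real.rpow_nonneg hx.1 (2 * q)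
    have := Real.rpow_nonneg hx.2.1 (2 * q)
    simp only [Pi.zero_apply]; positivity)

/-- Convexity of `q ↦ ∫ (a^{2q} + b^{2q} - 1) dν - c q` in three-point form. -/
lemma three_point (hν : IsDissipative ν) (c : ℝ) {x y z : ℝ} (hx : 0 < x) (hxy : x < y)
    (hyz : y < z) :
    (z - x) * (weightMoment ν y - ν.real Set.univ - c * y) ≤
      (z - y) * (weightMoment ν x - ν.real Set.univ - c * x) +
        (y - x) * (weightMoment ν z - ν.real Set.univ - c * z) := by
  have hzx : 0 < z - x := by linarith
  have ha : 0 ≤ (z - y) / (z - x) := div_nonneg (by linarith) hzx.le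
  have hb : 0 ≤ (y - x) / (z - x) := div_nonneg (by linarith) hzx.le
  have h := (convexOn_weightMoment hν).2 (Set.mem_Ioi.2 hx)
    (Set.mem_Ioi.2 (hx.trans (hxy.trans hyz))) ha hb (by field_simp; ring)
  simp only [smul_eq_mul] at h
  have he : (z - y) / (z - x) * x + (y - x) / (z - x) * z = y := by field_simp; ring
  rw [he] at h
  have h2 := mul_le_mul_of_nonneg_left h hzx.le
  have h3 : (z - x) * ((z - y) / (z - x) * weightMoment ν x + (y - x) / (z - x) * weightMoment ν z)
      = (z - y) * weightMoment ν x + (y - x) * weightMoment ν z := by field_simp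
  rw [h3] at h2
  nlinarith

lemma rate_lt_iff {q c : ℝ} (hq : 0 < q) :
    rate ν q < c ↔ weightMoment ν q - ν.real Set.univ - c * q < 0 := by
  rw [rate, div_lt_iff₀ hq, sub_neg]

lemma rate_eq_iff {q c : ℝ} (hq : 0 < q) :
    rate ν q = c ↔ weightMoment ν q - ν.real Set.univ - c * q = 0 := by
  rw [rate, div_eq_iff hq.ne', sub_eq_zero]

lemma lt_rate_iff {q c : ℝ} (hq : 0 < q) :
    c < rate ν q ↔ 0 < weightMoment ν q - ν.real Set.univ - c * q := by
  rw [rate, lt_div_iff₀ hq, sub_pos]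

/-- If the spectral function drops from `1` to some `q₀ > 1`, then it lies strictly below `μ(p)`
on `(p, q₀]` for every `p ≤ 1`. -/
lemma rate_lt_rate (hν : IsDissipative ν) {q₀ : ℝ} (hq₀ : 1 < q₀) (h : rate ν q₀ < rate ν 1)
    {p q : ℝ} (hp : 0 < p) (hp1 : p ≤ 1) (hpq : p < q) (hq : q ≤ q₀) : rate ν q < rate ν p := by
  have hq0 : 0 < q := hp.trans hpq
  -- the chord argument: below at the far end point implies below in between
  have chord : ∀ {x y z : ℝ}, 0 < x → x < y → y < z → rate ν z < rate ν x →
      rate ν y < rate ν x := by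
    intro x y z hx hxy hyz hzx
    rw [rate_lt_iff (hx.trans (hxy.trans hyz))] at hzx
    rw [rate_lt_iff (hx.trans hxy)]
    have h3 := three_point hν (rate ν x) hx hxy hyz
    rw [(rate_eq_iff hx).1 rfl, mul_zero, zero_add] at h3
    have h4 := mul_neg_of_pos_of_neg (sub_pos.2 hxy) hzx
    by_contra hcon
    have h5 := mul_nonneg (by linarith : 0 ≤ z - x) (not_lt.1 hcon)
    linarith
  have h1p : p < 1 → rate ν 1 < rate ν p := by
    intro hp1
    rw [lt_rate_iff hp]
    rw [rate_lt_iff (by linarith)] at h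
    have h3 := three_point hν (rate ν 1) hp hp1 hq₀
    rw [(rate_eq_iff one_pos).1 rfl, mul_zero] at h3
    have h4 := mul_neg_of_pos_of_neg (sub_pos.2 hp1) h
    by_contra hcon
    have h5 := mul_nonpos_of_nonneg_of_nonpos (by linarith : 0 ≤ q₀ - 1) (not_lt.1 hcon)
    linarith
  have h1q : 1 < q → rate ν q < rate ν 1 := by
    intro h1q
    rcases hq.eq_or_lt with rfl | hq
    · exact h
    · exact chord one_pos h1q hq h
  rcases hp1.eq_or_lt with rfl | hp1
  · exact h1q hpq
  rcases lt_trichotomy q 1 with hq1 | rfl | hq1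
  · exact chord hp hpq hq1 (h1p hp1)
  · exact h1p hp1
  · exact (h1q hq1).trans (h1p hp1)

/-- When the spectral function drops at `1` and `μ(1) < 0`, the equation `μ(q) = μ(1)` has exactly
one further root, and `μ(q) < μ(1)` exactly between the two roots. -/
lemma exists_second_root (hν : IsDissipative ν) {q₀ : ℝ} (hq₀ : 1 < q₀)
    (h : rate ν q₀ < rate ν 1) (hneg : rate ν 1 < 0) :
    ∃ r : ℝ, 1 < r ∧ (∀ q, 0 < q → (rate ν q = rate ν 1 ↔ q = 1 ∨ q = r)) ∧
      ∀ q, 1 < q → q < r → rate ν q < rate ν 1 := by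
  set Λ := ν.real Set.univ
  have hΛ : 0 ≤ Λ := measureReal_nonneg
  set c := rate ν 1 with hc
  set L : ℝ → ℝ := fun q => weightMoment ν q - Λ - c * q with hL
  have hq₀0 : 0 < q₀ := by linarith
  have hLq₀ : L q₀ < 0 := (rate_lt_iff hq₀0).1 h
  have hL1 : L 1 = 0 := (rate_eq_iff one_pos).1 rfl
  have hcont : ContinuousOn L (Set.Ioi 0) :=
    (((convexOn_weightMoment hν).continuousOn isOpen_Ioi).sub continuousOn_const).sub
      (by fun_prop)
  -- Since `c < 0`, the function `L` becomes positive at infinity.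
  obtain ⟨Q, hQ, hLQ⟩ : ∃ Q, q₀ < Q ∧ 0 < L Q := by
    refine ⟨q₀ + (Λ + 1) / (-c), by
      have : 0 < (Λ + 1) / (-c) := div_pos (by linarith) (by linarith)
      linarith, ?_⟩
    have h1 := weightMoment_nonneg hν (q₀ + (Λ + 1) / (-c))
    have h2 : c * (q₀ + (Λ + 1) / (-c)) = c * q₀ - (Λ + 1) := by
      have : c ≠ 0 := hneg.ne
      field_simp
      ring
    simp only [hL]
    rw [h2]
    nlinarith
  obtain ⟨r, ⟨hr1, hr2⟩, hr⟩ := intermediate_value_Icc hQ.le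
    (hcont.mono fun x hx => lt_of_lt_of_le hq₀0 hx.1) (Set.mem_Icc.2 ⟨hLq₀.le, hLQ.le⟩)
  have hq₀r : q₀ < r := lt_of_le_of_ne hr1 (by rintro rfl; exact hLq₀.ne hr)
  have tp : ∀ {x y z : ℝ}, 0 < x → x < y → y < z →
      (z - x) * L y ≤ (z - y) * L x + (y - x) * L z := fun hx hxy hyz => three_point hν c hx hxy hyz
  have hmid : ∀ q, 1 < q → q < r → L q < 0 := by
    intro q h1q hqr
    rcases lt_trichotomy q q₀ with hlt | rfl | hlt
    · have := tp one_pos h1q hlt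
      rw [hL1, mul_zero, zero_add] at this
      have h4 := mul_neg_of_pos_of_neg (sub_pos.2 h1q) hLq₀
      by_contra hcon
      have h5 := mul_nonneg (by linarith : 0 ≤ q₀ - 1) (not_lt.1 hcon)
      linarith
    · exact hLq₀
    · have := tp hq₀0 hlt hqr
      rw [hr, mul_zero, add_zero] at this
      have h4 := mul_neg_of_pos_of_neg (sub_pos.2 hqr) hLq₀
      by_contra hcon
      have h5 := mul_nonneg (by linarith : 0 ≤ r - q₀) (not_lt.1 hcon)
      linarith
  refine ⟨r, hq₀.trans hq₀r, fun q hq => ?_, fun q h1 h2 => (rate_lt_iff (by linarith)).2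
    (hmid q h1 h2)⟩
  rw [rate_eq_iff hq]
  change L q = 0 ↔ _
  constructor
  · intro hLq
    by_contra hcon
    push Not at hcon
    rcases lt_or_gt_of_ne hcon.1 with hq1 | hq1
    · have := tp hq hq1 hq₀
      rw [hL1, hLq, mul_zero, mul_zero, zero_add] at this
      have := mul_neg_of_pos_of_neg (sub_pos.2 hq1) hLq₀
      linarith
    · rcases lt_or_gt_of_ne hcon.2 with hqr | hqr
      · exact (hmid q hq1 hqr).ne hLq
      · have := tp hq₀0 hq₀r hqr
        rw [hr, hLq, mul_zero, mul_zero, add_zero] at this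
        have := mul_neg_of_pos_of_neg (sub_pos.2 hqr) hLq₀
        linarith
  · rintro (rfl | rfl)
    · exact hL1
    · exact hr

lemma abs_log_mul_rpow_le {a q : ℝ} (ha : 0 ≤ a) (ha1 : a ≤ 1) (hq : 1 / 2 ≤ q) :
    ‖a ^ (2 * q) * Real.log a * 2‖ ≤ 2 := by
  rcases ha.eq_or_lt with rfl | ha
  · simp
  · have h1 : a ^ (2 * q) ≤ a ^ (1 : ℝ) :=
      Real.rpow_le_rpow_of_exponent_ge ha ha1 (by linarith)
    rw [Real.rpow_one] at h1
    have h2 := Real.abs_log_mul_self_lt a ha ha1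
    rw [abs_mul, abs_of_pos ha] at h2
    rw [norm_mul, norm_mul, Real.norm_of_nonneg (Real.rpow_nonneg ha.le _), Real.norm_eq_abs,
      Real.norm_eq_abs, abs_two]
    have := abs_nonneg (Real.log a)
    nlinarith

/-- Differentiation under the integral sign at `q = 1`. -/
lemma hasDerivAt_weightMoment_one (hν : IsDissipative ν) :
    HasDerivAt (weightMoment ν)
      (∫ x, (x.1 ^ 2 * Real.log (x.1 ^ 2) + x.2 ^ 2 * Real.log (x.2 ^ 2)) ∂ν) 1 := by
  have hder : ∀ a : ℝ, 0 ≤ a → ∀ q : ℝ, 1 / 2 < q →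
      HasDerivAt (fun q : ℝ => a ^ (2 * q)) (a ^ (2 * q) * Real.log a * 2) q := by
    intro a ha q hq
    rcases ha.eq_or_lt with rfl | ha
    · simp only [Real.log_zero, mul_zero, zero_mul]
      refine (hasDerivAt_const q (0 : ℝ)).congr_of_eventuallyEq ?_
      filter_upwards [lt_mem_nhds hq] with y hy
      rw [Real.zero_rpow (by linarith)]
    · have h1 := (Real.hasStrictDerivAt_const_rpow ha (2 * q)).hasDerivAt
      have h2 : HasDerivAt (fun q : ℝ => 2 * q) 2 q := by
        simpa using (hasDerivAt_id q).const_mul 2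
      exact h1.comp q h2
  have key := hasDerivAt_integral_of_dominated_loc_of_deriv_le (μ := ν) (x₀ := (1 : ℝ))
    (F := fun q x => x.1 ^ (2 * q) + x.2 ^ (2 * q))
    (F' := fun q x => x.1 ^ (2 * q) * Real.log x.1 * 2 + x.2 ^ (2 * q) * Real.log x.2 * 2)
    (s := Set.Ioi (1 / 2)) (bound := fun _ => 4) (Ioi_mem_nhds (by norm_num))
    (Eventually.of_forall fun q => (measurable_rpow_add _).aestronglyMeasurable)
    (hν.integrable (by norm_num))
    (Measurable.aestronglyMeasurable (by fun_prop))
    (by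
      filter_upwards [hν.le_one] with x hx q hq
      have h1 := abs_log_mul_rpow_le hx.1.1 hx.1.2 (le_of_lt hq)
      have h2 := abs_log_mul_rpow_le hx.2.1 hx.2.2 (le_of_lt hq)
      exact (norm_add_le _ _).trans (by linarith))
    (integrable_const _)
    (by
      filter_upwards [hν] with x hx q hq
      exact (hder _ hx.1 q hq).add (hder _ hx.2.1 q hq))
  refine key.2.congr_deriv (integral_congr_ae (Eventually.of_forall fun x => ?_))
  simp only [mul_one, Real.rpow_two, Real.log_pow]
  push_cast
  ring

/-- The condition `μ'(1) < 0` in integrated form. -/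
lemma exists_rate_lt_rate_one (hν : IsDissipative ν)
    (h : ∫ x, (x.1 ^ 2 * Real.log (x.1 ^ 2) + x.2 ^ 2 * Real.log (x.2 ^ 2)) ∂ν <
      weightMoment ν 1 - ν.real Set.univ) :
    ∃ q₀, 1 < q₀ ∧ rate ν q₀ < rate ν 1 := by
  set J := ∫ x, (x.1 ^ 2 * Real.log (x.1 ^ 2) + x.2 ^ 2 * Real.log (x.2 ^ 2)) ∂ν
  set c := weightMoment ν 1 - ν.real Set.univ with hc
  have hd : HasDerivAt (fun q => weightMoment ν q - c * q) (J - c) 1 := by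
    refine ((hasDerivAt_weightMoment_one hν).sub
      ((hasDerivAt_id (1 : ℝ)).const_mul c)).congr_deriv ?_
    rw [mul_one]
  have hsub : Set.Ioi (1 : ℝ) ⊆ {1}ᶜ := fun x hx => ne_of_gt hx
  have hs := (hasDerivAt_iff_tendsto_slope.1 hd).mono_left (nhdsWithin_mono (1 : ℝ) hsub)
  have hev := hs.eventually (gt_mem_nhds (sub_neg.2 h))
  obtain ⟨q, hq, hq1⟩ := (hev.and self_mem_nhdsWithin).exists
  have hq1 : 1 < q := hq1
  refine ⟨q, hq1, ?_⟩
  have hr1 : rate ν 1 = c := by rw [rate, div_one]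
  rw [hr1, rate_lt_iff (by linarith)]
  rw [slope_def_field, div_lt_iff₀ (by linarith), zero_mul] at hq
  rw [hc] at hq ⊢
  linarith

end

/-! ### Self-similar profiles as fixed points -/

section

variable {E : Type*} [NormedAddCommGroup E] [InnerProductSpace ℝ E] [FiniteDimensional ℝ E]
  [MeasurableSpace E] [BorelSpace E]

/-- The measure `exp (-Λ s) ds` on `s > 0`. -/
def expTime (Λ : ℝ) : Measure ℝ :=
  (volume.restrict (Set.Ioi 0)).withDensity fun s => ENNReal.ofReal (Real.exp (-Λ * s))

lemma integral_expTime {F : Type*} [NormedAddCommGroup F] [NormedSpace ℝ F] (Λ : ℝ) (h : ℝ → F) :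
    ∫ s, h s ∂(expTime Λ) = ∫ s in Set.Ioi 0, Real.exp (-Λ * s) • h s := by
  rw [expTime, integral_withDensity_eq_integral_toReal_smul (by fun_prop)
    (Eventually.of_forall fun _ => ENNReal.ofReal_lt_top)]
  simp_rw [ENNReal.toReal_ofReal (Real.exp_pos _).le]

lemma integrable_exp_expTime {Λ c : ℝ} (hc : c < Λ) :
    Integrable (fun s => Real.exp (c * s)) (expTime Λ) := by
  rw [expTime, integrable_withDensity_iff_integrable_smul' (by fun_prop)
    (Eventually.of_forall fun _ => ENNReal.ofReal_lt_top)]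
  simp_rw [ENNReal.toReal_ofReal (Real.exp_pos _).le, smul_eq_mul, ← Real.exp_add]
  refine (exp_neg_integrableOn_Ioi 0 (sub_pos.2 hc)).congr_fun (fun s _ => ?_) measurableSet_Ioi
  simp only
  congr 1
  ring

lemma integral_exp_expTime {Λ c : ℝ} (hc : c < Λ) :
    ∫ s, Real.exp (c * s) ∂(expTime Λ) = 1 / (Λ - c) := by
  rw [integral_expTime]
  simp_rw [smul_eq_mul, ← Real.exp_add]
  have : ∀ s : ℝ, -Λ * s + c * s = (c - Λ) * s := fun s => by ring
  simp_rw [this]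
  rw [integral_exp_mul_Ioi (by linarith) 0, mul_zero, Real.exp_zero, neg_div, ← div_neg, neg_sub]

lemma isFiniteMeasure_expTime {Λ : ℝ} (hΛ : 0 < Λ) : IsFiniteMeasure (expTime Λ) := by
  have h := integrable_exp_expTime (Λ := Λ) (c := 0) hΛ
  simp only [zero_mul, Real.exp_zero] at h
  exact (integrable_const_iff_isFiniteMeasure one_ne_zero).1 h

/-- The law of `(e^{-μ s/2} a, e^{-μ s/2} b)` where `(a, b)` has law `ν` and `s` is exponential with
parameter `|ν|`. A profile of a self-similar solution with exponent `μ` is a fixed point of the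
smoothing operation with these weights. -/
def selfSimilarWeights (ν : Measure (ℝ × ℝ)) (μ : ℝ) : Measure (ℝ × ℝ) :=
  ((expTime (ν.real Set.univ)).prod ν).map fun x =>
    (Real.exp (-(μ / 2) * x.1) * x.2.1, Real.exp (-(μ / 2) * x.1) * x.2.2)

lemma measurable_selfSimilarWeights_fun (μ : ℝ) : Measurable fun x : ℝ × ℝ × ℝ =>
    (Real.exp (-(μ / 2) * x.1) * x.2.1, Real.exp (-(μ / 2) * x.1) * x.2.2) := by
  fun_prop

section

variable {ν : Measure (ℝ × ℝ)} [IsFiniteMeasure ν] [NeZero ν]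

variable (ν) in
lemma total_pos : 0 < ν.real Set.univ := by
  have : ν.real Set.univ ≠ 0 := by simp [Measure.real, ENNReal.toReal_eq_zero_iff, NeZero.ne ν]
  exact lt_of_le_of_ne measureReal_nonneg this.symm

lemma isProbabilityMeasure_selfSimilarWeights (μ : ℝ) :
    IsProbabilityMeasure (selfSimilarWeights ν μ) := by
  have := isFiniteMeasure_expTime (total_pos ν)
  have hreal : ((expTime (ν.real Set.univ)).prod ν).real Set.univ = 1 := by
    rw [← Set.univ_prod_univ (α := ℝ) (β := ℝ × ℝ), measureReal_prod_prod]
    have h := integral_exp_expTime (Λ := ν.real Set.univ) (c := 0) (total_pos ν)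
    simp only [zero_mul, Real.exp_zero, integral_const, smul_eq_mul, mul_one, sub_zero] at h
    rw [h, one_div, inv_mul_cancel₀ (total_pos ν).ne']
  have : IsProbabilityMeasure ((expTime (ν.real Set.univ)).prod ν) :=
    ⟨by rwa [Measure.real, ENNReal.toReal_eq_one_iff] at hreal⟩
  exact Measure.isProbabilityMeasure_map (measurable_selfSimilarWeights_fun μ).aemeasurable

lemma selfSimilarWeights_nonneg (hν : IsDissipative ν) (μ : ℝ) :
    ∀ᵐ x ∂(selfSimilarWeights ν μ), 0 ≤ x.1 ∧ 0 ≤ x.2 := by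
  have := isFiniteMeasure_expTime (total_pos ν)
  have hms : MeasurableSet {x : ℝ × ℝ | 0 ≤ x.1 ∧ 0 ≤ x.2} :=
    (measurableSet_le measurable_const measurable_fst).inter
      (measurableSet_le measurable_const measurable_snd)
  rw [selfSimilarWeights, ae_map_iff (measurable_selfSimilarWeights_fun μ).aemeasurable hms]
  filter_upwards [Measure.quasiMeasurePreserving_snd.ae hν] with x hx
  exact ⟨mul_nonneg (Real.exp_pos _).le hx.1, mul_nonneg (Real.exp_pos _).le hx.2.1⟩

lemma selfSimilarWeights_rpow_ae (hν : IsDissipative ν) (μ q : ℝ) :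
    (fun x : ℝ × ℝ × ℝ => (Real.exp (-(μ / 2) * x.1) * x.2.1) ^ (2 * q) +
      (Real.exp (-(μ / 2) * x.1) * x.2.2) ^ (2 * q)) =ᵐ[(expTime (ν.real Set.univ)).prod ν]
    fun x => Real.exp (-(μ * q) * x.1) * (x.2.1 ^ (2 * q) + x.2.2 ^ (2 * q)) := by
  have := isFiniteMeasure_expTime (total_pos ν)
  filter_upwards [Measure.quasiMeasurePreserving_snd.ae hν] with x hx
  rw [Real.mul_rpow (Real.exp_pos _).le hx.1, Real.mul_rpow (Real.exp_pos _).le hx.2.1,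
    ← Real.exp_mul, ← mul_add]
  congr 2
  ring

lemma integrable_selfSimilarWeights (hν : IsDissipative ν) {μ q : ℝ} (hq : 0 ≤ q)
    (hμ : 0 < ν.real Set.univ + μ * q) :
    Integrable (fun x : ℝ × ℝ => x.1 ^ (2 * q) + x.2 ^ (2 * q)) (selfSimilarWeights ν μ) := by
  have := isFiniteMeasure_expTime (total_pos ν)
  rw [selfSimilarWeights, integrable_map_measure
    (measurable_rpow_add _).aestronglyMeasurable (measurable_selfSimilarWeights_fun μ).aemeasurable]
  refine Integrable.congr ?_ (selfSimilarWeights_rpow_ae hν μ q).symm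
  exact (integrable_exp_expTime (by linarith)).mul_prod (hν.integrable (by positivity))

/-- In particular the moment of order `q` is `1` if `μ = μ(q)`, and less than `1` if `μ(q) < μ`. -/
lemma weightMoment_selfSimilarWeights (hν : IsDissipative ν) {μ q : ℝ}
    (hμ : 0 < ν.real Set.univ + μ * q) :
    weightMoment (selfSimilarWeights ν μ) q = weightMoment ν q / (ν.real Set.univ + μ * q) := by
  have := isFiniteMeasure_expTime (total_pos ν)
  rw [weightMoment, selfSimilarWeights, integral_map
    (measurable_selfSimilarWeights_fun μ).aemeasurable
    (measurable_rpow_add _).aestronglyMeasurable,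
    integral_congr_ae (selfSimilarWeights_rpow_ae hν μ q),
    integral_prod_mul (fun s : ℝ => Real.exp (-(μ * q) * s))
      (fun x : ℝ × ℝ => x.1 ^ (2 * q) + x.2 ^ (2 * q)),
    integral_exp_expTime (by linarith), weightMoment, sub_neg_eq_add]
  ring

end

/-- The convolution with `exp (-Λ s)` on the whole past solves `y' = H - Λ y`. -/
lemma hasDerivAt_exp_convolution {H : ℝ → ℂ} (hc : Continuous H) (hb : ∀ r, ‖H r‖ ≤ 1) {Λ : ℝ}
    (hΛ : 0 < Λ) (t : ℝ) :
    HasDerivAt (fun t => ∫ s in Set.Ioi 0, Real.exp (-Λ * s) • H (t - s))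
      (H t - Λ * ∫ s in Set.Ioi 0, Real.exp (-Λ * s) • H (t - s)) t := by
  set h : ℝ → ℂ := fun r => Real.exp (Λ * r) • H r with hh
  have hhc : Continuous h := by simp only [hh]; fun_prop
  have hint : IntegrableOn h (Set.Iic 0) := by
    have h1 : IntegrableOn (fun r : ℝ => Real.exp (Λ * r)) (Set.Iic 0) :=
      integrableOn_exp_mul_Iic hΛ 0
    refine h1.mono' hhc.aestronglyMeasurable (Eventually.of_forall fun r => ?_)
    simp only [hh]
    rw [norm_smul, Real.norm_of_nonneg (Real.exp_pos _).le]
    exact mul_le_of_le_one_right (Real.exp_pos _).le (hb r)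
  have hintt : ∀ t, IntegrableOn h (Set.Iic t) := fun t => by
    have h2 : Set.Iic t ⊆ Set.Iic 0 ∪ Set.Icc 0 t := fun x hx => by
      rcases le_total x 0 with h | h
      · exact Or.inl h
      · exact Or.inr ⟨h, hx⟩
    exact (hint.union (hhc.continuousOn.integrableOn_Icc)).mono_set h2
  have heq : ∀ t, ∫ s in Set.Ioi 0, Real.exp (-Λ * s) • H (t - s) =
      Real.exp (-Λ * t) • ((∫ r in Set.Iic 0, h r) + ∫ r in (0 : ℝ)..t, h r) := by
    intro t
    rw [← intervalIntegral.integral_Iic_sub_Iic (hintt 0) (hintt t), add_sub_cancel,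
      ← integral_indicator measurableSet_Ioi, ← integral_smul, integral_Iic_eq_integral_Iio,
      ← integral_indicator measurableSet_Iio,
      ← integral_sub_left_eq_self (fun r => (Set.Iio t).indicator
        (fun r => Real.exp (-Λ * t) • h r) r) _ t]
    refine integral_congr_ae (Eventually.of_forall fun s => ?_)
    by_cases hs : 0 < s
    · simp only [Set.indicator_of_mem (Set.mem_Ioi.2 hs),
        Set.indicator_of_mem (show t - s ∈ Set.Iio t from by simpa using hs), hh]
      rw [smul_smul, ← Real.exp_add]
      congr 2
      ring
    · have hs' : t - s ∉ Set.Iio t := by simpa using hs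
      have hs'' : s ∉ Set.Ioi (0 : ℝ) := hs
      simp only [Set.indicator_of_notMem hs', Set.indicator_of_notMem hs'']
  have hd : HasDerivAt (fun t => Real.exp (-Λ * t) •
      ((∫ r in Set.Iic 0, h r) + ∫ r in (0 : ℝ)..t, h r))
      (Real.exp (-Λ * t) • h t + (Real.exp (-Λ * t) * (-Λ)) •
        ((∫ r in Set.Iic 0, h r) + ∫ r in (0 : ℝ)..t, h r)) t := by
    have h1 : HasDerivAt (fun t => Real.exp (-Λ * t)) (Real.exp (-Λ * t) * (-Λ)) t := by
      simpa using ((hasDerivAt_id t).const_mul (-Λ)).exp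
    have h2 : HasDerivAt (fun t => ∫ r in (0 : ℝ)..t, h r) (h t) t :=
      hhc.integral_hasStrictDerivAt 0 t |>.hasDerivAt
    exact h1.smul (h2.const_add _)
  simp_rw [heq]
  refine hd.congr_deriv ?_
  have h3 : Real.exp (-Λ * t) • h t = H t := by
    simp only [hh]
    rw [smul_smul, ← Real.exp_add]
    simp
  rw [h3]
  simp only [Complex.real_smul]
  push_cast
  ring

/-- A fixed point for the self-similar weights is the profile of a self-similar solution. -/
lemma isKacSolution_of_fixedPoint {ν : Measure (ℝ × ℝ)} [IsFiniteMeasure ν] [NeZero ν] {μ : ℝ}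
    {F : ProbabilityMeasure E}
    (hF : smooth (selfSimilarWeights ν μ) (F : Measure E) (F : Measure E) = F)
    {f : ℝ → ProbabilityMeasure E}
    (hf : ∀ t k, charFun (f t : Measure E) k = charFun (F : Measure E) (Real.exp (μ * t / 2) • k)) :
    IsKacSolution ν f := by
  have := isFiniteMeasure_expTime (total_pos ν)
  have := isProbabilityMeasure_selfSimilarWeights (ν := ν) μ
  set φ := charFun (F : Measure E) with hφ
  have hφm : Measurable φ := measurable_charFun
  have hφc : Continuous φ := continuous_charFun
  set Γ : E → ℂ := fun k => ∫ x, φ (x.1 • k) * φ (x.2 • k) ∂ν with hΓ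
  have hΛ := total_pos ν
  set Λ := ν.real Set.univ with hΛd
  have hle : ∀ x y : E, ‖φ x * φ y‖ ≤ 1 := fun x y => by
    rw [norm_mul]
    exact mul_le_one₀ (norm_charFun_le_one _) (norm_nonneg _) (norm_charFun_le_one _)
  have hΓb : ∀ k, ‖Γ k‖ ≤ Λ := fun k => by
    refine (norm_integral_le_of_norm_le_const (C := 1) (Eventually.of_forall fun x => hle _ _)).trans
      (le_of_eq (by rw [one_mul]))
  have hΓc : Continuous Γ := continuous_of_dominated (bound := fun _ => 1)
    (fun k => ((hφm.comp (by fun_prop)).mul (hφm.comp (by fun_prop))).aestronglyMeasurable)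
    (fun k => Eventually.of_forall fun x => hle _ _) (integrable_const _)
    (Eventually.of_forall fun x => (hφc.comp (by fun_prop)).mul (hφc.comp (by fun_prop)))
  have hfix : ∀ k, φ k = ∫ s in Set.Ioi 0, Real.exp (-Λ * s) • Γ (Real.exp (-(μ / 2) * s) • k) := by
    intro k
    have h1 : φ k = charFun (smooth (selfSimilarWeights ν μ) (F : Measure E) (F : Measure E)) k := by
      rw [hF]
    have hm : Measurable fun x : ℝ × ℝ => φ (x.1 • k) * φ (x.2 • k) :=
      (hφm.comp (by fun_prop)).mul (hφm.comp (by fun_prop))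
    rw [h1, charFun_smooth, selfSimilarWeights, integral_map
      (measurable_selfSimilarWeights_fun μ).aemeasurable hm.aestronglyMeasurable,
      integral_prod, integral_expTime]
    · simp only [hΓ, smul_smul, mul_comm, hΛd]
    · refine Integrable.of_bound (C := 1) ?_ (Eventually.of_forall fun x => hle _ _)
      exact (hm.comp (measurable_selfSimilarWeights_fun μ)).aestronglyMeasurable
  intro k t ht
  set H : ℝ → ℂ := fun r => (Λ⁻¹ : ℝ) • Γ (Real.exp (μ * r / 2) • k) with hH
  have hHc : Continuous H := by
    simp only [hH]
    have : Continuous fun r : ℝ => Real.exp (μ * r / 2) • k := by fun_prop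
    exact (hΓc.comp this).const_smul (Λ⁻¹ : ℝ)
  have hHb : ∀ r, ‖H r‖ ≤ 1 := fun r => by
    simp only [hH]
    rw [norm_smul, Real.norm_of_nonneg (inv_nonneg.2 hΛ.le)]
    calc Λ⁻¹ * _ ≤ Λ⁻¹ * Λ := by gcongr; exact hΓb _
      _ = 1 := inv_mul_cancel₀ hΛ.ne'
  -- The fixed point equation at the dilated frequency is the mild form of the equation: the
  -- exponential time `s` is the time elapsed since the last collision.
  have hconv : ∀ τ, charFun (f τ : Measure E) k =
      Λ * ∫ s in Set.Ioi 0, Real.exp (-Λ * s) • H (τ - s) := by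
    intro τ
    rw [hf, hfix, ← integral_const_mul]
    refine integral_congr_ae (Eventually.of_forall fun s => ?_)
    simp only [hH, smul_smul, ← Real.exp_add, Complex.real_smul]
    have : -(μ / 2) * s + μ * τ / 2 = μ * (τ - s) / 2 := by ring
    rw [this]
    have hΛ' : (Λ : ℂ) ≠ 0 := by exact_mod_cast hΛ.ne'
    push_cast
    field_simp
  have hsm : charFun (smooth ν (f t : Measure E) (f t : Measure E)) k = Λ * H t := by
    rw [charFun_smooth]
    simp_rw [hf, smul_smul]
    simp only [hH, hΓ, smul_smul, Complex.real_smul]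
    rw [← mul_assoc]
    have hΛ' : (Λ : ℂ) ≠ 0 := by exact_mod_cast hΛ.ne'
    push_cast
    rw [mul_inv_cancel₀ hΛ', one_mul]
    simp only [mul_comm]
  rw [hsm]
  simp_rw [hconv]
  refine ((hasDerivAt_exp_convolution hHc hHb hΛ t).const_mul (Λ : ℂ)).hasDerivWithinAt.congr_deriv ?_
  ring

end

/-! ### Moments of fixed points -/

section

variable {E : Type*} [NormedAddCommGroup E] [InnerProductSpace ℝ E] [FiniteDimensional ℝ E]
  [MeasurableSpace E] [BorelSpace E]

lemma real_rpow_add_le_of_le {x y r : ℝ} (hy : 0 ≤ y) (hyx : y ≤ x) (hr : 1 ≤ r) :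
    (x + y) ^ r ≤ x ^ r + 2 ^ r * (x ^ (r - 1) * y) := by
  have hx : 0 ≤ x := hy.trans hyx
  rcases hx.eq_or_lt with rfl | hx
  · have : y = 0 := le_antisymm hyx hy
    subst this
    simp [Real.zero_rpow (by linarith : r ≠ 0)]
  set t := y / x with ht
  have ht0 : 0 ≤ t := by positivity
  have ht1 : t ≤ 1 := (div_le_one hx).2 hyx
  have hconv := (convexOn_rpow hr).2 (x := 1) (Set.mem_Ici.2 zero_le_one) (y := 2)
    (Set.mem_Ici.2 zero_le_two) (by linarith : 0 ≤ 1 - t) ht0 (by ring)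
  simp only [smul_eq_mul, Real.one_rpow, mul_one] at hconv
  have h1 : 1 - t + t * 2 = 1 + t := by ring
  rw [h1] at hconv
  have hxy : x + y = x * (1 + t) := by rw [ht]; field_simp
  have hxr : x ^ r = x ^ (r - 1) * x := by
    rw [← Real.rpow_add_one hx.ne']; ring_nf
  have h2 : x ^ (r - 1) * y = x ^ r * t := by
    rw [hxr, ht]; field_simp
  rw [hxy, Real.mul_rpow hx.le (by positivity), h2]
  have hxr0 : 0 ≤ x ^ r := by positivity
  nlinarith [mul_nonneg hxr0 ht0]

lemma ennreal_rpow_add_le_of_le {x y : ℝ≥0∞} {r : ℝ} (hyx : y ≤ x) (hr : 1 ≤ r) :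
    (x + y) ^ r ≤ x ^ r + 2 ^ r * (x ^ (r - 1) * y) := by
  induction x with
  | top => simp [ENNReal.top_rpow_of_pos (by linarith : 0 < r)]
  | coe x =>
    lift y to ℝ≥0 using (hyx.trans_lt ENNReal.coe_lt_top).ne
    have h0 : 0 ≤ r := by linarith
    have h1 : 0 ≤ r - 1 := by linarith
    rw [← ENNReal.coe_add, ← ENNReal.coe_rpow_of_nonneg _ h0, ← ENNReal.coe_rpow_of_nonneg _ h0,
      ← ENNReal.coe_rpow_of_nonneg _ h1, ← ENNReal.coe_ofNat, ← ENNReal.coe_rpow_of_nonneg _ h0,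
      ← ENNReal.coe_mul, ← ENNReal.coe_mul, ← ENNReal.coe_add, ENNReal.coe_le_coe]
    have := real_rpow_add_le_of_le (x := x) (y := y) y.2 (by exact_mod_cast hyx) hr
    exact_mod_cast this

/-- The cross terms in `(x + y)^r` are of lower order in each variable. -/
lemma ennreal_rpow_add_le_add {r : ℝ} (x y : ℝ≥0∞) (hr : 1 ≤ r) :
    (x + y) ^ r ≤ x ^ r + y ^ r + 2 ^ r * (x ^ (r - 1) * y + y ^ (r - 1) * x) := by
  rcases le_total y x with h | h
  · refine (ennreal_rpow_add_le_of_le h hr).trans ?_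
    gcongr
    · exact le_self_add
    · exact le_self_add
  · rw [add_comm x y]
    refine (ennreal_rpow_add_le_of_le h hr).trans ?_
    gcongr
    · exact le_add_self
    · exact le_add_self

/-- The absolute moment of order `r`. -/
def absMoment (f : Measure E) (r : ℝ) : ℝ≥0∞ := ∫⁻ v, ‖v‖ₑ ^ r ∂f

lemma lintegral_enorm_rpow_eq {ρ : Measure (ℝ × ℝ)} {q : ℝ} (hq : 0 ≤ q)
    (hρ : ∀ᵐ x ∂ρ, 0 ≤ x.1 ∧ 0 ≤ x.2)
    (hint : Integrable (fun x : ℝ × ℝ => x.1 ^ (2 * q) + x.2 ^ (2 * q)) ρ) :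
    ∫⁻ c, (‖c.1‖ₑ ^ (2 * q) + ‖c.2‖ₑ ^ (2 * q)) ∂ρ = ENNReal.ofReal (weightMoment ρ q) := by
  rw [weightMoment, ofReal_integral_eq_lintegral_ofReal hint]
  · refine lintegral_congr_ae ?_
    filter_upwards [hρ] with c hc
    rw [Real.enorm_of_nonneg hc.1, Real.enorm_of_nonneg hc.2,
      ENNReal.ofReal_rpow_of_nonneg hc.1 (by positivity),
      ENNReal.ofReal_rpow_of_nonneg hc.2 (by positivity),
      ENNReal.ofReal_add (Real.rpow_nonneg hc.1 _) (Real.rpow_nonneg hc.2 _)]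
  · filter_upwards [hρ] with c hc
    exact add_nonneg (Real.rpow_nonneg hc.1 _) (Real.rpow_nonneg hc.2 _)

lemma ennreal_rpow_sub_one_mul_le {x y : ℝ≥0∞} {r : ℝ} (hr : 1 ≤ r) :
    x ^ (r - 1) * y ≤ x ^ r + y ^ r := by
  have hsplit : ∀ z : ℝ≥0∞, z ^ r = z ^ (r - 1) * z := fun z => by
    have h : z ^ r = z ^ ((r - 1) + 1) := by ring_nf
    rw [h, ENNReal.rpow_add_of_nonneg _ _ (by linarith) zero_le_one, ENNReal.rpow_one]
  rcases le_total x y with h | h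
  · refine le_trans ?_ le_add_self
    rw [hsplit y]
    gcongr
  · refine le_trans ?_ le_self_add
    rw [hsplit x]
    gcongr

/-- Moments of order `r = 2q ≥ 1` of a smoothed law are controlled by those of order `r`, with the
factor `weightMoment ρ q`, and of order `r - 1`. -/
lemma absMoment_smooth_le {ρ : Measure (ℝ × ℝ)} [SFinite ρ] {q : ℝ} (hq : 1 ≤ 2 * q)
    (hρ : ∀ᵐ x ∂ρ, 0 ≤ x.1 ∧ 0 ≤ x.2)
    (hint : Integrable (fun x : ℝ × ℝ => x.1 ^ (2 * q) + x.2 ^ (2 * q)) ρ) (f : Measure E)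
    [IsProbabilityMeasure f] :
    absMoment (smooth ρ f f) (2 * q) ≤ ENNReal.ofReal (weightMoment ρ q) *
      (absMoment f (2 * q) +
        2 * 2 ^ (2 * q) * (absMoment f (2 * q - 1) * absMoment f 1)) := by
  set r := 2 * q with hr
  have hr0 : 0 ≤ r := by linarith
  have hr1 : 0 ≤ r - 1 := by linarith
  have hmeas : ∀ s : ℝ, Measurable fun v : E => ‖v‖ₑ ^ s := fun s => by fun_prop
  rw [absMoment, lintegral_smooth ρ f f (hmeas r)]
  have hpt : ∀ (c : ℝ × ℝ) (v w : E), ‖c.1 • v + c.2 • w‖ₑ ^ r ≤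
      ‖c.1‖ₑ ^ r * ‖v‖ₑ ^ r + ‖c.2‖ₑ ^ r * ‖w‖ₑ ^ r + 2 ^ r * (‖c.1‖ₑ ^ r + ‖c.2‖ₑ ^ r) *
        (‖v‖ₑ ^ (r - 1) * ‖w‖ₑ + ‖w‖ₑ ^ (r - 1) * ‖v‖ₑ) := by
    intro c v w
    have h1 : ‖c.1 • v + c.2 • w‖ₑ ≤ ‖c.1‖ₑ * ‖v‖ₑ + ‖c.2‖ₑ * ‖w‖ₑ := by
      refine (enorm_add_le _ _).trans (le_of_eq ?_)
      rw [enorm_smul, enorm_smul]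
    refine (ENNReal.rpow_le_rpow h1 hr0).trans ((ennreal_rpow_add_le_add _ _ hq).trans ?_)
    rw [ENNReal.mul_rpow_of_nonneg _ _ hr0, ENNReal.mul_rpow_of_nonneg _ _ hr0,
      ENNReal.mul_rpow_of_nonneg _ _ hr1, ENNReal.mul_rpow_of_nonneg _ _ hr1, mul_assoc (2 ^ r)]
    gcongr _ + 2 ^ r * ?_
    calc ‖c.1‖ₑ ^ (r - 1) * ‖v‖ₑ ^ (r - 1) * (‖c.2‖ₑ * ‖w‖ₑ) +
          ‖c.2‖ₑ ^ (r - 1) * ‖w‖ₑ ^ (r - 1) * (‖c.1‖ₑ * ‖v‖ₑ)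
        = (‖c.1‖ₑ ^ (r - 1) * ‖c.2‖ₑ) * (‖v‖ₑ ^ (r - 1) * ‖w‖ₑ) +
          (‖c.2‖ₑ ^ (r - 1) * ‖c.1‖ₑ) * (‖w‖ₑ ^ (r - 1) * ‖v‖ₑ) := by ring
      _ ≤ (‖c.1‖ₑ ^ r + ‖c.2‖ₑ ^ r) * (‖v‖ₑ ^ (r - 1) * ‖w‖ₑ) +
          (‖c.1‖ₑ ^ r + ‖c.2‖ₑ ^ r) * (‖w‖ₑ ^ (r - 1) * ‖v‖ₑ) := by
          gcongr
          · exact ennreal_rpow_sub_one_mul_le hq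
          · rw [add_comm]; exact ennreal_rpow_sub_one_mul_le hq
      _ = _ := by ring
  have hM1 : ∫⁻ v : E, ‖v‖ₑ ∂f = absMoment f 1 := by simp [absMoment]
  calc _ ≤ ∫⁻ c : ℝ × ℝ, ∫⁻ v, ∫⁻ w, (‖c.1‖ₑ ^ r * ‖v‖ₑ ^ r + ‖c.2‖ₑ ^ r * ‖w‖ₑ ^ r +
        2 ^ r * (‖c.1‖ₑ ^ r + ‖c.2‖ₑ ^ r) *
        (‖v‖ₑ ^ (r - 1) * ‖w‖ₑ + ‖w‖ₑ ^ (r - 1) * ‖v‖ₑ)) ∂f ∂f ∂ρ := by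
        gcongr with c v w
        exact hpt c v w
    _ = ∫⁻ c : ℝ × ℝ, (‖c.1‖ₑ ^ r + ‖c.2‖ₑ ^ r) * (absMoment f r +
        2 * 2 ^ r * (absMoment f (r - 1) * absMoment f 1)) ∂ρ := by
        refine lintegral_congr fun c => ?_
        have hw : ∀ v : E, ∫⁻ w, (‖c.1‖ₑ ^ r * ‖v‖ₑ ^ r + ‖c.2‖ₑ ^ r * ‖w‖ₑ ^ r +
            2 ^ r * (‖c.1‖ₑ ^ r + ‖c.2‖ₑ ^ r) *
            (‖v‖ₑ ^ (r - 1) * ‖w‖ₑ + ‖w‖ₑ ^ (r - 1) * ‖v‖ₑ)) ∂f =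
            ‖c.1‖ₑ ^ r * ‖v‖ₑ ^ r + ‖c.2‖ₑ ^ r * absMoment f r +
            2 ^ r * (‖c.1‖ₑ ^ r + ‖c.2‖ₑ ^ r) *
            (‖v‖ₑ ^ (r - 1) * absMoment f 1 + absMoment f (r - 1) * ‖v‖ₑ) := by
          intro v
          rw [lintegral_add_left (by fun_prop), lintegral_add_left (by fun_prop), lintegral_const,
            lintegral_const_mul _ (hmeas r), lintegral_const_mul _ (by fun_prop),
            lintegral_add_left (by fun_prop), lintegral_const_mul _ (by fun_prop),
            lintegral_mul_const _ (hmeas _), hM1, measure_univ, mul_one]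
          rfl
        simp_rw [hw]
        rw [lintegral_add_left (by fun_prop), lintegral_add_left (by fun_prop), lintegral_const,
            lintegral_const_mul _ (hmeas r), lintegral_const_mul _ (by fun_prop),
            lintegral_add_left (by fun_prop), lintegral_const_mul _ (by fun_prop),
            lintegral_mul_const _ (hmeas _), hM1, measure_univ, mul_one]
        change ‖c.1‖ₑ ^ r * absMoment f r + _ + _ * (absMoment f (r - 1) * _ + _) = _
        ring
    _ = _ := by
        rw [lintegral_mul_const _ (by fun_prop), hr, lintegral_enorm_rpow_eq (by linarith) hρ hint]

lemma enorm_sq_add_enorm_sq (v w : E) :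
    ‖v + w‖ₑ ^ (2 : ℝ) + ‖v - w‖ₑ ^ (2 : ℝ) = 2 * (‖v‖ₑ ^ (2 : ℝ) + ‖w‖ₑ ^ (2 : ℝ)) := by
  have h : ∀ x : E, ‖x‖ₑ ^ (2 : ℝ) = ENNReal.ofReal (‖x‖ ^ 2) := fun x => by
    rw [← ofReal_norm, ENNReal.ofReal_rpow_of_nonneg (norm_nonneg _) zero_le_two,
      Real.rpow_two]
  have h2 : (2 : ℝ≥0∞) = ENNReal.ofReal 2 := by simp
  rw [h, h, h, h, ← ENNReal.ofReal_add (by positivity) (by positivity),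
    ← ENNReal.ofReal_add (by positivity) (by positivity), h2, ← ENNReal.ofReal_mul zero_le_two]
  congr 1
  exact parallelogram_law_with_norm ℝ v w

/-- For a law invariant under `v ↦ -v` the smoothing operation may be symmetrized. -/
lemma two_mul_absMoment_smooth {ρ : Measure (ℝ × ℝ)} [SFinite ρ] {f : Measure E} [SFinite f]
    (hf : f.map (LinearIsometryEquiv.neg ℝ : E ≃ₗᵢ[ℝ] E) = f) (r : ℝ) :
    2 * absMoment (smooth ρ f f) r = ∫⁻ c, ∫⁻ v, ∫⁻ w,
      (‖c.1 • v + c.2 • w‖ₑ ^ r + ‖c.1 • v - c.2 • w‖ₑ ^ r) ∂f ∂f ∂ρ := by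
  have hmeas : Measurable fun v : E => ‖v‖ₑ ^ r := by fun_prop
  have h1 : absMoment (smooth ρ f f) r =
      ∫⁻ c, ∫⁻ v, ∫⁻ w, ‖c.1 • v + c.2 • w‖ₑ ^ r ∂f ∂f ∂ρ := lintegral_smooth ρ f f hmeas
  have h2 : absMoment (smooth ρ f f) r =
      ∫⁻ c, ∫⁻ v, ∫⁻ w, ‖c.1 • v - c.2 • w‖ₑ ^ r ∂f ∂f ∂ρ := by
    rw [h1]
    refine lintegral_congr fun c => lintegral_congr fun v => ?_
    conv_lhs => rw [← hf]
    rw [lintegral_map (by fun_prop) (LinearIsometryEquiv.continuous _).measurable]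
    simp [sub_eq_add_neg]
  rw [two_mul]
  nth_rewrite 1 [h1]
  rw [h2, ← lintegral_add_left]
  · refine lintegral_congr fun c => ?_
    rw [← lintegral_add_left]
    · refine lintegral_congr fun v => ?_
      rw [← lintegral_add_left]
      fun_prop
    · exact Measurable.lintegral_prod_right' (f := fun x : E × E => ‖c.1 • x.1 + c.2 • x.2‖ₑ ^ r)
        (by fun_prop)
  · refine Measurable.lintegral_prod_right' (f := fun x : (ℝ × ℝ) × E =>
      ∫⁻ w, ‖x.1.1 • x.2 + x.1.2 • w‖ₑ ^ r ∂f) ?_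
    exact Measurable.lintegral_prod_right' (f := fun x : ((ℝ × ℝ) × E) × E =>
      ‖x.1.1.1 • x.1.2 + x.1.1.2 • x.2‖ₑ ^ r) (by fun_prop)

lemma lintegral_smooth_const_mul {ρ : Measure (ℝ × ℝ)} {r : ℝ} (f : Measure E)
    [IsProbabilityMeasure f] :
    ∫⁻ c : ℝ × ℝ, ∫⁻ v, ∫⁻ w, (‖c.1‖ₑ ^ r * ‖v‖ₑ ^ r + ‖c.2‖ₑ ^ r * ‖w‖ₑ ^ r) ∂f ∂f ∂ρ =
      (∫⁻ c, (‖c.1‖ₑ ^ r + ‖c.2‖ₑ ^ r) ∂ρ) * absMoment f r := by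
  have hmeas : Measurable fun v : E => ‖v‖ₑ ^ r := by fun_prop
  rw [← lintegral_mul_const _ (by fun_prop)]
  refine lintegral_congr fun c => ?_
  have hw : ∀ v : E, ∫⁻ w, (‖c.1‖ₑ ^ r * ‖v‖ₑ ^ r + ‖c.2‖ₑ ^ r * ‖w‖ₑ ^ r) ∂f =
      ‖c.1‖ₑ ^ r * ‖v‖ₑ ^ r + ‖c.2‖ₑ ^ r * absMoment f r := fun v => by
    rw [lintegral_add_left (by fun_prop), lintegral_const, lintegral_const_mul _ hmeas,
      measure_univ, mul_one]
    rfl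
  simp_rw [hw]
  rw [lintegral_add_left (by fun_prop), lintegral_const, lintegral_const_mul _ hmeas,
      measure_univ, mul_one]
  change _ * absMoment f r + _ = _
  ring

/-- Mixed terms drop out by symmetry, so the second moment is multiplied by `weightMoment ρ 1`. -/
lemma absMoment_two_smooth {ρ : Measure (ℝ × ℝ)} [SFinite ρ]
    (hρ : ∀ᵐ x ∂ρ, 0 ≤ x.1 ∧ 0 ≤ x.2)
    (hint : Integrable (fun x : ℝ × ℝ => x.1 ^ (2 * (1 : ℝ)) + x.2 ^ (2 * (1 : ℝ))) ρ)
    {f : Measure E} [IsProbabilityMeasure f]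
    (hf : f.map (LinearIsometryEquiv.neg ℝ : E ≃ₗᵢ[ℝ] E) = f) :
    absMoment (smooth ρ f f) 2 = ENNReal.ofReal (weightMoment ρ 1) * absMoment f 2 := by
  have h := two_mul_absMoment_smooth (ρ := ρ) hf 2
  simp_rw [enorm_sq_add_enorm_sq, enorm_smul, ENNReal.mul_rpow_of_nonneg _ _ zero_le_two] at h
  have h2 : ∫⁻ c : ℝ × ℝ, ∫⁻ v, ∫⁻ w, 2 * (‖c.1‖ₑ ^ (2 : ℝ) * ‖v‖ₑ ^ (2 : ℝ) +
      ‖c.2‖ₑ ^ (2 : ℝ) * ‖w‖ₑ ^ (2 : ℝ)) ∂f ∂f ∂ρ =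
      2 * (ENNReal.ofReal (weightMoment ρ 1) * absMoment f 2) := by
    have e := lintegral_enorm_rpow_eq zero_le_one hρ hint
    rw [mul_one] at e
    rw [← e, ← lintegral_smooth_const_mul]
    simp_rw [lintegral_const_mul' 2 _ (by simp : (2 : ℝ≥0∞) ≠ ∞)]
  rw [h2] at h
  exact (ENNReal.mul_right_inj (by simp) (by simp)).1 h

lemma absMoment_le_one_add {f : Measure E} [IsProbabilityMeasure f] {r s : ℝ} (hr : 0 ≤ r)
    (hrs : r ≤ s) : absMoment f r ≤ 1 + absMoment f s := by
  have : (1 : ℝ≥0∞) = ∫⁻ _, 1 ∂f := by simp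
  rw [this, absMoment, absMoment, ← lintegral_add_left measurable_const]
  refine lintegral_mono fun v => ?_
  rcases le_total ‖v‖ₑ 1 with h | h
  · exact (ENNReal.rpow_le_one h hr).trans le_self_add
  · exact (ENNReal.rpow_le_rpow_of_exponent_le h hrs).trans le_add_self

lemma exists_bound_of_recursion {x : ℕ → ℝ≥0∞} {m : ℝ} {B : ℝ≥0∞} (hm0 : 0 ≤ m) (hm : m < 1)
    (hx0 : x 0 ≠ ∞) (hB : B ≠ ∞) (hx : ∀ n, x (n + 1) ≤ ENNReal.ofReal m * (x n + B)) :
    ∃ C : ℝ≥0∞, C ≠ ∞ ∧ ∀ n, x n ≤ C := by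
  lift B to ℝ≥0 using hB
  lift m to ℝ≥0 using hm0
  have hm1 : m < 1 := by exact_mod_cast hm
  refine ⟨x 0 + (m * B / (1 - m) : ℝ≥0), by simp [hx0], fun n => ?_⟩
  induction n with
  | zero => exact le_self_add
  | succ n ih =>
    have hreal : m * (m * B / (1 - m)) + m * B = m * B / (1 - m) := by
      have h1 : (1 - m : ℝ≥0) ≠ 0 := (tsub_pos_of_lt hm1).ne'
      rw [← NNReal.coe_inj]
      push_cast [NNReal.coe_sub hm1.le]
      have h2 : (1 - m : ℝ) ≠ 0 := by linarith
      field_simp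
      ring
    calc x (n + 1) ≤ ENNReal.ofReal m * (x n + B) := hx n
      _ ≤ m * ((x 0 + (m * B / (1 - m) : ℝ≥0)) + B) := by
          rw [ENNReal.ofReal_coe_nnreal]; gcongr
      _ = m * x 0 + (m * (m * B / (1 - m)) + m * B : ℝ≥0) := by push_cast; ring
      _ ≤ 1 * x 0 + (m * B / (1 - m) : ℝ≥0) := by
          rw [hreal]
          gcongr
          exact_mod_cast hm1.le
      _ = _ := by rw [one_mul]

/-- Along the iteration `f ↦ smooth ρ f f` the moments of order `r > 2` with
`weightMoment ρ (r / 2) < 1` stay bounded, if the second moment is conserved. -/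
lemma exists_absMoment_bound {ρ : Measure (ℝ × ℝ)} [SFinite ρ] (hρ : ∀ᵐ x ∂ρ, 0 ≤ x.1 ∧ 0 ≤ x.2)
    {R : ℝ} (hint : ∀ q, 1 ≤ q → 2 * q < R →
      Integrable (fun x : ℝ × ℝ => x.1 ^ (2 * q) + x.2 ^ (2 * q)) ρ)
    (hR : 2 < R) (hm1 : weightMoment ρ 1 = 1)
    (hm : ∀ q, 1 < q → 2 * q < R → 0 ≤ weightMoment ρ q ∧ weightMoment ρ q < 1)
    {f : ℕ → Measure E} [∀ n, IsProbabilityMeasure (f n)]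
    (hf : ∀ n, f (n + 1) = smooth ρ (f n) (f n))
    (hsymm : ∀ n, (f n).map (LinearIsometryEquiv.neg ℝ : E ≃ₗᵢ[ℝ] E) = f n)
    (h0 : ∀ r, 0 ≤ r → absMoment (f 0) r ≠ ∞) {r : ℝ} (hr0 : 0 ≤ r) (hrR : r < R) :
    ∃ C : ℝ≥0∞, C ≠ ∞ ∧ ∀ n, absMoment (f n) r ≤ C := by
  have h2 : ∀ n, absMoment (f n) 2 = absMoment (f 0) 2 := by
    intro n
    induction n with
    | zero => rfl
    | succ n ih =>
      rw [hf, absMoment_two_smooth hρ (hint 1 le_rfl (by linarith)) (hsymm n), hm1,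
        ENNReal.ofReal_one, one_mul, ih]
  have hle2 : ∀ r, 0 ≤ r → r ≤ 2 → ∃ C : ℝ≥0∞, C ≠ ∞ ∧ ∀ n, absMoment (f n) r ≤ C := by
    intro r hr hr2
    refine ⟨1 + absMoment (f 0) 2, by simp [h0 2 zero_le_two], fun n => ?_⟩
    rw [← h2 n]
    exact absMoment_le_one_add hr hr2
  have key : ∀ N : ℕ, ∀ r : ℝ, 0 ≤ r → r ≤ N + 2 → r < R →
      ∃ C : ℝ≥0∞, C ≠ ∞ ∧ ∀ n, absMoment (f n) r ≤ C := by
    intro N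
    induction N with
    | zero => intro r hr hr2 _; exact hle2 r hr (by simpa using hr2)
    | succ N ih =>
      intro r hr hrN hrR
      rcases le_or_gt r 2 with hr2 | hr2
      · exact hle2 r hr hr2
      obtain ⟨C₁, hC₁, hC₁'⟩ := ih (r - 1) (by linarith) (by push_cast at hrN; linarith)
        (by linarith)
      obtain ⟨C₂, hC₂, hC₂'⟩ := hle2 1 zero_le_one one_le_two
      have hq : 2 * (r / 2) = r := by ring
      obtain ⟨hw0, hw1⟩ := hm (r / 2) (by linarith) (by linarith)
      refine exists_bound_of_recursion (B := 2 * 2 ^ r * (C₁ * C₂)) hw0 hw1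
        (h0 r hr) ?_ fun n => ?_
      · refine ENNReal.mul_ne_top (ENNReal.mul_ne_top (by simp) ?_) (ENNReal.mul_ne_top hC₁ hC₂)
        exact ENNReal.rpow_ne_top_of_nonneg hr (by simp)
      · have := absMoment_smooth_le (q := r / 2) (by linarith) hρ
          (hint (r / 2) (by linarith) (by linarith)) (f n)
        rw [hq, ← hf] at this
        refine this.trans ?_
        gcongr
        · exact hC₁' n
        · exact hC₂' n
  obtain ⟨N, hN⟩ := exists_nat_ge r
  exact key N r hr0 (by linarith) hrR

lemma absMoment_eq_ofReal (f : Measure E) {r : ℝ} (hr : 0 ≤ r) :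
    absMoment f r = ∫⁻ v, ENNReal.ofReal (‖v‖ ^ r) ∂f := by
  refine lintegral_congr fun v => ?_
  rw [← ofReal_norm, ENNReal.ofReal_rpow_of_nonneg (norm_nonneg _) hr]

lemma integrable_norm_rpow_iff (f : Measure E) {r : ℝ} (hr : 0 ≤ r) :
    Integrable (fun v : E => ‖v‖ ^ r) f ↔ absMoment f r ≠ ∞ := by
  have hm : AEStronglyMeasurable (fun v : E => ‖v‖ ^ r) f :=
    Measurable.aestronglyMeasurable (by fun_prop)
  rw [absMoment_eq_ofReal f hr, ← hasFiniteIntegral_iff_ofReal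
    (Eventually.of_forall fun v => Real.rpow_nonneg (norm_nonneg _) _) |>.trans lt_top_iff_ne_top]
  exact ⟨fun h => h.2, fun h => ⟨hm, h⟩⟩

lemma absMoment_le_of_tendsto {f : ℕ → ProbabilityMeasure E} {F : ProbabilityMeasure E}
    (hF : Tendsto f atTop (𝓝 F)) {r : ℝ} (hr : 0 ≤ r) {C : ℝ≥0∞}
    (hC : ∀ n, absMoment (f n : Measure E) r ≤ C) : absMoment (F : Measure E) r ≤ C := by
  rw [absMoment_eq_ofReal _ hr]
  refine (lintegral_le_liminf_lintegral_of_forall_isOpen_measure_le_liminf_measure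
    (continuous_norm.rpow_const fun _ => Or.inr hr) (fun v => by positivity)
    (fun G hG => ProbabilityMeasure.le_liminf_measure_open_of_tendsto hF hG)).trans ?_
  refine liminf_le_of_le (by isBoundedDefault) fun b hb => ?_
  obtain ⟨n, hn⟩ := hb.exists
  refine hn.trans ?_
  rw [← absMoment_eq_ofReal _ hr]
  exact hC n

/-- At the exponent `q > 1` where the weights are critical, a nontrivial symmetric fixed point has
no moment of order `2q`: by convexity the moment would be strictly increased by smoothing. -/
lemma absMoment_eq_top_of_critical {ρ : Measure (ℝ × ℝ)} [SFinite ρ]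
    (hρ : ∀ᵐ x ∂ρ, 0 ≤ x.1 ∧ 0 ≤ x.2) {q : ℝ} (hq : 1 < q)
    (hint : Integrable (fun x : ℝ × ℝ => x.1 ^ (2 * q) + x.2 ^ (2 * q)) ρ)
    (hm : weightMoment ρ q = 1) (hpos : ρ {x | x.1 ≠ 0 ∧ x.2 ≠ 0} ≠ 0)
    {F : Measure E} [IsProbabilityMeasure F] (hF : smooth ρ F F = F)
    (hsymm : F.map (LinearIsometryEquiv.neg ℝ : E ≃ₗᵢ[ℝ] E) = F) (hne : F {0}ᶜ ≠ 0) :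
    absMoment F (2 * q) = ∞ := by
  by_contra hfin
  have hq0 : 0 ≤ q := by linarith
  have h2q : (0 : ℝ) ≤ 2 * q := by linarith
  set M := absMoment F (2 * q) with hM
  set g₁ : (ℝ × ℝ) × (E × E) → ℝ≥0∞ := fun x =>
    ‖x.1.1‖ₑ ^ (2 * q) * ‖x.2.1‖ₑ ^ (2 * q) + ‖x.1.2‖ₑ ^ (2 * q) * ‖x.2.2‖ₑ ^ (2 * q) with hg₁
  set g₂ : (ℝ × ℝ) × (E × E) → ℝ≥0∞ := fun x =>
    (‖x.1.1 • x.2.1‖ₑ ^ (2 : ℝ) + ‖x.1.2 • x.2.2‖ₑ ^ (2 : ℝ)) ^ q with hg₂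
  have hg₁m : Measurable g₁ := by simp only [hg₁]; fun_prop
  have hg₂m : Measurable g₂ := by simp only [hg₂]; fun_prop
  have hsplit : ∀ x, g₁ x = (‖x.1.1 • x.2.1‖ₑ ^ (2 : ℝ)) ^ q + (‖x.1.2 • x.2.2‖ₑ ^ (2 : ℝ)) ^ q := by
    intro x
    simp only [hg₁]
    rw [← ENNReal.rpow_mul, ← ENNReal.rpow_mul, enorm_smul, enorm_smul,
      ENNReal.mul_rpow_of_nonneg _ _ h2q, ENNReal.mul_rpow_of_nonneg _ _ h2q]
  have hle : ∀ x, g₁ x ≤ g₂ x := fun x => by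
    rw [hsplit]; exact ENNReal.add_rpow_le_rpow_add _ _ hq.le
  have hint₁ : ∫⁻ x, g₁ x ∂(ρ.prod (F.prod F)) = M := by
    rw [lintegral_prod _ hg₁m.aemeasurable]
    have : ∀ c : ℝ × ℝ, ∫⁻ y, g₁ (c, y) ∂(F.prod F) = ∫⁻ v, ∫⁻ w,
        (‖c.1‖ₑ ^ (2 * q) * ‖v‖ₑ ^ (2 * q) + ‖c.2‖ₑ ^ (2 * q) * ‖w‖ₑ ^ (2 * q)) ∂F ∂F := fun c => by
      have hmc : Measurable fun y : E × E => g₁ (c, y) := hg₁m.comp measurable_prodMk_left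
      rw [lintegral_prod _ hmc.aemeasurable]
    simp_rw [this]
    rw [lintegral_smooth_const_mul, lintegral_enorm_rpow_eq hq0 hρ hint, hm, ENNReal.ofReal_one,
      one_mul]
  have hint₂ : ∫⁻ x, g₂ x ∂(ρ.prod (F.prod F)) ≤ M := by
    have h1 := two_mul_absMoment_smooth (ρ := ρ) hsymm (2 * q)
    rw [hF] at h1
    have h2 : 2 * ∫⁻ x, g₂ x ∂(ρ.prod (F.prod F)) ≤ 2 * M := by
      rw [h1, ← lintegral_const_mul _ hg₂m, lintegral_prod _ (hg₂m.const_mul 2).aemeasurable]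
      refine lintegral_mono fun c => ?_
      have hmc : Measurable fun y : E × E => 2 * g₂ (c, y) :=
        (hg₂m.comp measurable_prodMk_left).const_mul 2
      dsimp only
      rw [lintegral_prod _ hmc.aemeasurable]
      refine lintegral_mono fun v => lintegral_mono fun w => ?_
      simp only [hg₂]
      -- convexity of `x ↦ x^q` together with the parallelogram identity
      have hJ := ENNReal.rpow_arith_mean_le_arith_mean2_rpow 2⁻¹ 2⁻¹
        (‖c.1 • v + c.2 • w‖ₑ ^ (2 : ℝ)) (‖c.1 • v - c.2 • w‖ₑ ^ (2 : ℝ))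
        ENNReal.inv_two_add_inv_two hq.le
      have h22 : (2 : ℝ≥0∞)⁻¹ * 2 = 1 := ENNReal.inv_mul_cancel (by simp) (by simp)
      rw [← mul_add, ← mul_add, enorm_sq_add_enorm_sq, ← mul_assoc, h22, one_mul,
        ← ENNReal.rpow_mul, ← ENNReal.rpow_mul] at hJ
      calc _ ≤ 2 * (2⁻¹ * (‖c.1 • v + c.2 • w‖ₑ ^ (2 * q) + ‖c.1 • v - c.2 • w‖ₑ ^ (2 * q))) := by
            gcongr
        _ = _ := by rw [← mul_assoc, mul_comm 2, h22, one_mul]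
    exact (ENNReal.mul_le_mul_iff_right (by simp) (by simp)).1 h2
  -- `g₁ ≤ g₂` pointwise with equal finite integrals, so the two agree almost everywhere.
  have hae := ae_eq_of_ae_le_of_lintegral_le (Eventually.of_forall hle) (by rw [hint₁]; exact hfin)
    hg₂m.aemeasurable (by rw [hint₁]; exact hint₂)
  have hzero : (ρ.prod (F.prod F)) ({x | x.1 ≠ 0 ∧ x.2 ≠ 0} ×ˢ ({0}ᶜ ×ˢ {0}ᶜ)) = 0 := by
    refine measure_mono_null ?_ (ae_iff.1 hae)
    rintro ⟨c, v, w⟩ ⟨⟨hc1, hc2⟩, hv, hw⟩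
    simp only [Set.mem_ofPred_eq]
    -- strict superadditivity of `x ↦ x^q`
    have hA : 0 < ‖c.1 • v‖ ^ 2 := by
      have : c.1 • v ≠ 0 := smul_ne_zero hc1 hv
      positivity
    have hB : 0 < ‖c.2 • w‖ ^ 2 := by
      have : c.2 • w ≠ 0 := smul_ne_zero hc2 hw
      positivity
    have he : ∀ x : E, ‖x‖ₑ ^ (2 : ℝ) = ENNReal.ofReal (‖x‖ ^ 2) := fun x => by
      rw [← ofReal_norm, ENNReal.ofReal_rpow_of_nonneg (norm_nonneg _) zero_le_two,
        Real.rpow_two]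
    rw [hsplit]
    simp only [hg₂]
    rw [he, he, ← ENNReal.ofReal_add hA.le hB.le, ENNReal.ofReal_rpow_of_nonneg hA.le hq0,
      ENNReal.ofReal_rpow_of_nonneg hB.le hq0, ENNReal.ofReal_rpow_of_nonneg (by positivity) hq0,
      ← ENNReal.ofReal_add (by positivity) (by positivity)]
    intro hcon
    rw [ENNReal.ofReal_eq_ofReal_iff (by positivity) (by positivity)] at hcon
    set A := ‖c.1 • v‖ ^ 2
    set B := ‖c.2 • w‖ ^ 2
    have hs : ∀ x : ℝ, 0 < x → x ^ q = x ^ (q - 1) * x := fun x hx => by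
      rw [← Real.rpow_add_one hx.ne']; ring_nf
    have h1 : A ^ (q - 1) < (A + B) ^ (q - 1) := Real.rpow_lt_rpow hA.le (by linarith) (by linarith)
    have h2 : B ^ (q - 1) < (A + B) ^ (q - 1) := Real.rpow_lt_rpow hB.le (by linarith) (by linarith)
    rw [hs A hA, hs B hB, hs (A + B) (by linarith)] at hcon
    nlinarith
  rw [Measure.prod_prod, Measure.prod_prod] at hzero
  simp only [mul_eq_zero, or_self] at hzero
  rcases hzero with h | h
  · exact hpos h
  · exact hne h

end

/-! ### Moments and the behaviour of the characteristic function at the origin -/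

section

variable {E : Type*} [NormedAddCommGroup E] [InnerProductSpace ℝ E] [FiniteDimensional ℝ E]
  [MeasurableSpace E] [BorelSpace E]

lemma re_charFun (f : Measure E) [IsFiniteMeasure f] (k : E) :
    (charFun f k).re = ∫ v, Real.cos ⟪v, k⟫ ∂f := by
  have hi : Integrable (fun v : E => Complex.exp ((⟪v, k⟫ : ℝ) * Complex.I)) f := by
    refine Integrable.of_bound (C := 1) (Continuous.aestronglyMeasurable (by fun_prop))
      (Eventually.of_forall fun x => ?_)
    rw [Complex.norm_exp_ofReal_mul_I]
  have h := integral_re hi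
  rw [charFun_apply]
  simp only [RCLike.re_eq_complex_re, Complex.exp_ofReal_mul_I_re] at h
  exact h.symm

lemma integrable_one_sub_cos (f : Measure E) [IsFiniteMeasure f] (k : E) :
    Integrable (fun v => 1 - Real.cos ⟪v, k⟫) f := by
  refine Integrable.of_bound (C := 2) (Continuous.aestronglyMeasurable (by fun_prop))
    (Eventually.of_forall fun v => ?_)
  rw [Real.norm_eq_abs, abs_le]
  constructor <;> linarith [Real.cos_le_one ⟪v, k⟫, Real.neg_one_le_cos ⟪v, k⟫]

lemma one_sub_re_charFun (f : Measure E) [IsProbabilityMeasure f] (k : E) :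
    1 - (charFun f k).re = ∫ v, (1 - Real.cos ⟪v, k⟫) ∂f := by
  have hi := integrable_one_sub_cos f k
  have hc : Integrable (fun v => Real.cos ⟪v, k⟫) f := by
    refine ((integrable_const (1 : ℝ) (μ := f)).sub hi).congr (Eventually.of_forall fun v => ?_)
    simp
  rw [integral_sub (integrable_const _) hc, re_charFun]
  simp

/-- Every `|x| ≥ 1` lies in some dyadic interval, where `1 - cos (x / 2ⁿ)` is bounded below. -/
lemma enorm_rpow_le_tsum {q : ℝ} (hq : 0 < q) (x : ℝ) :
    ‖x‖ₑ ^ (2 * q) ≤ 1 + ∑' n : ℕ, ENNReal.ofReal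
      (2 ^ (2 * q) / (1 - Real.cos 1) * ((2 : ℝ) ^ (2 * q)) ^ n * (1 - Real.cos (x / 2 ^ n))) := by
  rcases le_total |x| 1 with hx | hx
  · refine le_trans ?_ le_self_add
    refine ENNReal.rpow_le_one ?_ (by positivity)
    rw [← ofReal_norm, Real.norm_eq_abs]
    exact ENNReal.ofReal_le_one.2 hx
  · refine le_trans ?_ le_add_self
    obtain ⟨n, hn1, hn2⟩ := exists_nat_pow_near hx one_lt_two
    refine le_trans ?_ (ENNReal.le_tsum n)
    rw [← ofReal_norm, Real.norm_eq_abs, ENNReal.ofReal_rpow_of_nonneg (abs_nonneg _)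
      (by positivity)]
    refine ENNReal.ofReal_le_ofReal ?_
    have hpow : (0 : ℝ) < 2 ^ n := by positivity
    have hcos1 : Real.cos 1 < 1 := by
      have := Real.cos_lt_cos_of_nonneg_of_le_pi (x := 0) (y := 1) le_rfl
        (by linarith [Real.pi_gt_three]) one_pos
      rwa [Real.cos_zero] at this
    have hc : Real.cos (x / 2 ^ n) ≤ Real.cos 1 := by
      rw [← Real.cos_abs, abs_div, abs_of_pos hpow]
      refine Real.cos_le_cos_of_nonneg_of_le_pi zero_le_one ?_ ((one_le_div hpow).2 hn1)
      have : |x| / 2 ^ n ≤ 2 := by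
        rw [div_le_iff₀ hpow]; rw [pow_succ] at hn2; linarith
      linarith [Real.pi_gt_three]
    have hd : 0 < 1 - Real.cos 1 := by linarith
    have h1 : |x| ^ (2 * q) ≤ 2 ^ (2 * q) * ((2 : ℝ) ^ (2 * q)) ^ n := by
      have e1 : ((2 : ℝ) ^ (2 * q)) ^ n = ((2 : ℝ) ^ n) ^ (2 * q) := by
        rw [← Real.rpow_natCast, ← Real.rpow_natCast, ← Real.rpow_mul zero_le_two,
          ← Real.rpow_mul zero_le_two, mul_comm]
      rw [e1, ← Real.mul_rpow zero_le_two hpow.le, ← pow_succ']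
      exact Real.rpow_le_rpow (abs_nonneg _) hn2.le (by positivity)
    calc |x| ^ (2 * q) ≤ 2 ^ (2 * q) * ((2 : ℝ) ^ (2 * q)) ^ n := h1
      _ = 2 ^ (2 * q) / (1 - Real.cos 1) * ((2 : ℝ) ^ (2 * q)) ^ n * (1 - Real.cos 1) := by
          field_simp
      _ ≤ _ := by
          refine mul_le_mul_of_nonneg_left (by linarith) (by positivity)

/-- Directional moments below the order of `1 - Re φ` at the origin are finite. -/
lemma lintegral_inner_rpow_ne_top {f : Measure E} [IsProbabilityMeasure f] {p q A : ℝ}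
    (h : ∀ k : E, ‖k‖ ≤ 1 → 1 - (charFun f k).re ≤ A * ‖k‖ ^ (2 * p)) (hq : 0 < q) (hqp : q < p)
    {e : E} (he : ‖e‖ = 1) : ∫⁻ v, ‖⟪v, e⟫‖ₑ ^ (2 * q) ∂f ≠ ∞ := by
  set K := (2 : ℝ) ^ (2 * q) / (1 - Real.cos 1) with hK
  have hK0 : 0 ≤ K := div_nonneg (by positivity) (by linarith [Real.cos_le_one 1])
  have hmeas : ∀ n : ℕ, Measurable fun v : E => ENNReal.ofReal
      (K * ((2 : ℝ) ^ (2 * q)) ^ n * (1 - Real.cos (⟪v, e⟫ / 2 ^ n))) := fun n => by fun_prop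
  have hA : 0 ≤ A := by
    have h1 := h e he.le
    rw [he, Real.one_rpow, mul_one, one_sub_re_charFun] at h1
    exact (integral_nonneg fun v => by simpa using Real.cos_le_one _).trans h1
  have hterm : ∀ n : ℕ, ∫⁻ v : E, ENNReal.ofReal
      (K * ((2 : ℝ) ^ (2 * q)) ^ n * (1 - Real.cos (⟪v, e⟫ / 2 ^ n))) ∂f ≤
      ENNReal.ofReal (K * A * ((2 : ℝ) ^ (2 * q - 2 * p)) ^ n) := by
    intro n
    have hk : ∀ v : E, ⟪v, e⟫ / 2 ^ n = ⟪v, ((2 : ℝ) ^ n)⁻¹ • e⟫ := fun v => by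
      rw [real_inner_smul_right, div_eq_inv_mul]
    simp_rw [hk]
    rw [← ofReal_integral_eq_lintegral_ofReal ((integrable_one_sub_cos f _).const_mul _)
      (Eventually.of_forall fun v => mul_nonneg (by positivity)
        (by simpa using Real.cos_le_one _)), integral_const_mul, ← one_sub_re_charFun]
    refine ENNReal.ofReal_le_ofReal ?_
    have hnorm : ‖((2 : ℝ) ^ n)⁻¹ • e‖ = ((2 : ℝ) ^ n)⁻¹ := by
      rw [norm_smul, he, mul_one, Real.norm_of_nonneg (by positivity)]
    have h1 := h (((2 : ℝ) ^ n)⁻¹ • e) (by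
      rw [hnorm]; exact inv_le_one_of_one_le₀ (one_le_pow₀ one_le_two))
    rw [hnorm] at h1
    calc _ ≤ K * ((2 : ℝ) ^ (2 * q)) ^ n * (A * (((2 : ℝ) ^ n)⁻¹) ^ (2 * p)) := by gcongr
      _ = _ := by
        have e1 : (((2 : ℝ) ^ n)⁻¹) ^ (2 * p) = ((2 : ℝ) ^ (-(2 * p))) ^ n := by
          rw [Real.inv_rpow (by positivity), ← Real.rpow_natCast, ← Real.rpow_mul zero_le_two,
            ← Real.rpow_natCast, ← Real.rpow_mul zero_le_two, ← Real.rpow_neg zero_le_two]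
          congr 1; ring
        rw [e1, sub_eq_add_neg, Real.rpow_add two_pos, mul_pow]
        ring
  have hle : ∫⁻ v, ‖⟪v, e⟫‖ₑ ^ (2 * q) ∂f ≤
      1 + ∑' n : ℕ, ENNReal.ofReal (K * A * ((2 : ℝ) ^ (2 * q - 2 * p)) ^ n) := by
    calc _ ≤ ∫⁻ v : E, (1 + ∑' n : ℕ, ENNReal.ofReal
          (K * ((2 : ℝ) ^ (2 * q)) ^ n * (1 - Real.cos (⟪v, e⟫ / 2 ^ n)))) ∂f :=
          lintegral_mono fun v => enorm_rpow_le_tsum hq _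
      _ = 1 + ∑' n : ℕ, ∫⁻ v : E, ENNReal.ofReal
          (K * ((2 : ℝ) ^ (2 * q)) ^ n * (1 - Real.cos (⟪v, e⟫ / 2 ^ n))) ∂f := by
          rw [lintegral_add_left measurable_const, lintegral_tsum fun n => (hmeas n).aemeasurable]
          simp
      _ ≤ _ := by gcongr with n; exact hterm n
  refine ne_top_of_le_ne_top ?_ hle
  have hr : (2 : ℝ) ^ (2 * q - 2 * p) < 1 :=
    Real.rpow_lt_one_of_one_lt_of_neg one_lt_two (by linarith)
  have hs : Summable fun n : ℕ => K * A * ((2 : ℝ) ^ (2 * q - 2 * p)) ^ n :=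
    (summable_geometric_of_lt_one (by positivity) hr).mul_left _
  rw [← ENNReal.ofReal_tsum_of_nonneg (fun n => by positivity) hs]
  simp

/-- For `q ≤ 1` the moment of order `2q` is at most the sum of those of the coordinates. -/
lemma absMoment_ne_top_of_charFun {f : Measure E} [IsProbabilityMeasure f] {p q A : ℝ}
    (h : ∀ k : E, ‖k‖ ≤ 1 → 1 - (charFun f k).re ≤ A * ‖k‖ ^ (2 * p)) (hq : 0 < q) (hqp : q < p)
    (hq1 : q ≤ 1) : absMoment f (2 * q) ≠ ∞ := by
  set b := stdOrthonormalBasis ℝ E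
  have hpt : ∀ v : E, ‖v‖ₑ ^ (2 * q) ≤ ∑ i, ‖⟪v, b i⟫‖ₑ ^ (2 * q) := by
    intro v
    have h1 : ‖v‖ₑ ^ (2 : ℝ) = ∑ i, ‖⟪v, b i⟫‖ₑ ^ (2 : ℝ) := by
      have h2 := b.sum_sq_norm_inner_right v
      have h3 : ∀ {G : Type _} [SeminormedAddGroup G] (x : G),
          ‖x‖ₑ ^ (2 : ℝ) = ENNReal.ofReal (‖x‖ ^ 2) := fun x => by
        rw [← ofReal_norm, ENNReal.ofReal_rpow_of_nonneg (norm_nonneg _) zero_le_two,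
          Real.rpow_two]
      rw [h3, ← h2, ENNReal.ofReal_sum_of_nonneg fun i _ => by positivity]
      refine Finset.sum_congr rfl fun i _ => ?_
      rw [← ofReal_norm, ENNReal.ofReal_rpow_of_nonneg (norm_nonneg _) zero_le_two,
          Real.rpow_two, real_inner_comm]
    rw [ENNReal.rpow_mul, h1]
    refine (Finset.le_sum_of_subadditive (fun x : ℝ≥0∞ => x ^ q) (ENNReal.zero_rpow_of_pos hq).le
      (fun x y => ENNReal.rpow_add_le_add_rpow x y hq.le hq1) _ _).trans (le_of_eq ?_)
    refine Finset.sum_congr rfl fun i _ => ?_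
    rw [ENNReal.rpow_mul]
  refine ne_top_of_le_ne_top ?_ (lintegral_mono hpt)
  rw [lintegral_finsetSum _ fun i _ => by fun_prop]
  refine ENNReal.sum_ne_top.2 fun i _ => ?_
  exact lintegral_inner_rpow_ne_top h hq hqp (b.norm_eq_one i)

/-- The characteristic function is `1 - ‖k‖^{2p} + O(‖k‖^{2q})`, with a bound valid for all `k`. -/
def ExpandsUpTo (p q : ℝ) (f : Measure E) : Prop :=
  ∃ C, 0 ≤ C ∧ ∀ k, ‖charFun f k - ((1 - ‖k‖ ^ (2 * p) : ℝ) : ℂ)‖ ≤ C * ‖k‖ ^ (2 * q)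

lemma ExpandsUpTo.one_sub_re_le {p q : ℝ} {f : Measure E} (hf : ExpandsUpTo p q f) (hp : 0 < p)
    (hpq : p ≤ q) : ∃ A, ∀ k : E, ‖k‖ ≤ 1 → 1 - (charFun f k).re ≤ A * ‖k‖ ^ (2 * p) := by
  obtain ⟨C, hC, h⟩ := hf
  refine ⟨1 + C, fun k hk => ?_⟩
  have h1 := (Complex.abs_re_le_norm _).trans (h k)
  rw [Complex.sub_re, Complex.ofReal_re] at h1
  have h2 : ‖k‖ ^ (2 * q) ≤ ‖k‖ ^ (2 * p) :=
    Real.rpow_le_rpow_of_exponent_ge' (norm_nonneg _) hk (by positivity) (by linarith)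
  have h3 := (abs_le.1 h1).1
  nlinarith

/-- If `p < 1` and the `2p`-th moment were finite, then `1 - Re φ(k)` would be `o(‖k‖^{2p})`. -/
lemma ExpandsUpTo.not_integrable [Nontrivial E] {p q : ℝ} {f : Measure E} [IsProbabilityMeasure f]
    (hf : ExpandsUpTo p q f) (hp : 0 < p) (hp1 : p < 1) (hpq : p < q) :
    ¬ Integrable (fun v : E => ‖v‖ ^ (2 * p)) f := by
  intro hint
  obtain ⟨C, hC, h⟩ := hf
  obtain ⟨e, he⟩ := exists_norm_eq E zero_le_one
  have hev : ∀ᶠ τ : ℝ in 𝓝[>] 0, 0 < τ := self_mem_nhdsWithin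
  -- By the expansion the quotient tends to `1`, by dominated convergence it tends to `0`.
  have hlim1 : Tendsto (fun τ : ℝ => ∫ v, (1 - Real.cos ⟪v, τ • e⟫) / τ ^ (2 * p) ∂f) (𝓝[>] 0)
      (𝓝 1) := by
    have hz : Tendsto (fun τ : ℝ => C * τ ^ (2 * (q - p))) (𝓝[>] 0) (𝓝 0) := by
      have : Tendsto (fun τ : ℝ => C * τ ^ (2 * (q - p))) (𝓝 0) (𝓝 (C * 0 ^ (2 * (q - p)))) :=
        ((Real.continuous_rpow_const (by linarith)).const_mul C).tendsto 0
      rw [Real.zero_rpow (by linarith), mul_zero] at this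
      exact this.mono_left nhdsWithin_le_nhds
    rw [tendsto_iff_norm_sub_tendsto_zero]
    refine squeeze_zero' (Eventually.of_forall fun _ => norm_nonneg _) ?_ hz
    filter_upwards [hev] with τ hτ
    rw [integral_div, ← one_sub_re_charFun]
    have hn : ‖τ • e‖ = τ := by rw [norm_smul, he, mul_one, Real.norm_of_nonneg hτ.le]
    have h1 := (Complex.abs_re_le_norm _).trans (h (τ • e))
    rw [Complex.sub_re, Complex.ofReal_re, hn] at h1
    have hτp : 0 < τ ^ (2 * p) := by positivity
    have heq : (1 - (charFun f (τ • e)).re) / τ ^ (2 * p) - 1 =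
        -((charFun f (τ • e)).re - (1 - τ ^ (2 * p))) / τ ^ (2 * p) := by
      field_simp; ring
    rw [heq, norm_div, norm_neg, Real.norm_of_nonneg hτp.le, Real.norm_eq_abs, div_le_iff₀ hτp]
    refine h1.trans (le_of_eq ?_)
    rw [mul_assoc, ← Real.rpow_add hτ]
    congr 2; ring
  have hlim0 : Tendsto (fun τ : ℝ => ∫ v, (1 - Real.cos ⟪v, τ • e⟫) / τ ^ (2 * p) ∂f) (𝓝[>] 0)
      (𝓝 (∫ _ : E, (0 : ℝ) ∂f)) := by
    refine tendsto_integral_filter_of_dominated_convergence (fun v => 2 * ‖v‖ ^ (2 * p))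
      (Eventually.of_forall fun τ => Measurable.aestronglyMeasurable (by fun_prop)) ?_
      (hint.const_mul 2) ?_
    · filter_upwards [hev] with τ hτ
      refine Eventually.of_forall fun v => ?_
      have hτp : 0 < τ ^ (2 * p) := by positivity
      have hc0 : 0 ≤ 1 - Real.cos ⟪v, τ • e⟫ := by simpa using Real.cos_le_one _
      rw [Real.norm_of_nonneg (div_nonneg hc0 hτp.le), div_le_iff₀ hτp]
      have hy : |⟪v, τ • e⟫| ≤ ‖v‖ * τ := by
        have := abs_real_inner_le_norm v (τ • e)
        rwa [norm_smul, he, mul_one, Real.norm_of_nonneg hτ.le] at this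
      have hb : 1 - Real.cos ⟪v, τ • e⟫ ≤ 2 * |⟪v, τ • e⟫| ^ (2 * p) := by
        set y := ⟪v, τ • e⟫
        rcases le_total |y| 1 with h1 | h1
        · have h2 : |y| ^ (2 : ℝ) ≤ |y| ^ (2 * p) :=
            Real.rpow_le_rpow_of_exponent_ge' (abs_nonneg _) h1 (by positivity) (by linarith)
          rw [Real.rpow_two, sq_abs] at h2
          have h3 := Real.one_sub_sq_div_two_le_cos (x := y)
          nlinarith [sq_nonneg y]
        · have h2 : 1 ≤ |y| ^ (2 * p) := Real.one_le_rpow h1 (by positivity)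
          linarith [Real.neg_one_le_cos y]
      calc _ ≤ 2 * |⟪v, τ • e⟫| ^ (2 * p) := hb
        _ ≤ 2 * (‖v‖ * τ) ^ (2 * p) := by gcongr
        _ = _ := by rw [Real.mul_rpow (norm_nonneg _) hτ.le]; ring
    · refine Eventually.of_forall fun v => ?_
      have hz : Tendsto (fun τ : ℝ => τ ^ (2 - 2 * p) * (⟪v, e⟫ ^ 2 / 2)) (𝓝[>] 0) (𝓝 0) := by
        have : Tendsto (fun τ : ℝ => τ ^ (2 - 2 * p) * (⟪v, e⟫ ^ 2 / 2)) (𝓝 0)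
            (𝓝 ((0 : ℝ) ^ (2 - 2 * p) * (⟪v, e⟫ ^ 2 / 2))) :=
          ((Real.continuous_rpow_const (by linarith)).mul_const _).tendsto 0
        rw [Real.zero_rpow (by linarith), zero_mul] at this
        exact this.mono_left nhdsWithin_le_nhds
      refine squeeze_zero' ?_ ?_ hz
      · filter_upwards [hev] with τ hτ
        exact div_nonneg (by simpa using Real.cos_le_one _) (by positivity)
      · filter_upwards [hev] with τ hτ
        have hτp : 0 < τ ^ (2 * p) := by positivity
        rw [div_le_iff₀ hτp]
        have h3 := Real.one_sub_sq_div_two_le_cos (x := ⟪v, τ • e⟫)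
        have h4 : τ ^ (2 - 2 * p) * τ ^ (2 * p) = τ ^ 2 := by
          rw [← Real.rpow_add hτ, sub_add_cancel, Real.rpow_two]
        calc _ ≤ ⟪v, τ • e⟫ ^ 2 / 2 := by linarith
          _ = (τ ^ (2 - 2 * p) * τ ^ (2 * p)) * (⟪v, e⟫ ^ 2 / 2) := by
              rw [h4, real_inner_smul_right]; ring
          _ = _ := by ring
  rw [integral_zero] at hlim0
  exact zero_ne_one (tendsto_nhds_unique hlim0 hlim1)

/-- Away from the origin the bound is trivial, because characteristic functions are bounded. -/
lemma expandsUpTo_of_local {p q₀ q C δ : ℝ} {f : Measure E} [IsProbabilityMeasure f] (hp : 0 < p)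
    (hpq : p ≤ q) (hq : q ≤ q₀) (hC : 0 ≤ C) (hδ : 0 < δ)
    (h : ∀ k, ‖k‖ < δ → ‖charFun f k - ((1 - ‖k‖ ^ (2 * p) : ℝ) : ℂ)‖ ≤ C * ‖k‖ ^ (2 * q₀)) :
    ExpandsUpTo p q f := by
  have hq0 : 0 < q := hp.trans_le hpq
  set η := min δ 1 with hη
  have hη0 : 0 < η := lt_min hδ one_pos
  refine ⟨C + (2 * (η ^ (2 * q))⁻¹ + (η ^ (2 * (q - p)))⁻¹), by positivity, fun k => ?_⟩
  rw [add_mul]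
  rcases lt_or_ge ‖k‖ η with hk | hk
  · refine (h k (hk.trans_le (min_le_left _ _))).trans ?_
    have h1 : ‖k‖ ^ (2 * q₀) ≤ ‖k‖ ^ (2 * q) := Real.rpow_le_rpow_of_exponent_ge' (norm_nonneg _)
      (hk.le.trans (min_le_right _ _)) (by positivity) (by linarith)
    have h2 : 0 ≤ (2 * (η ^ (2 * q))⁻¹ + (η ^ (2 * (q - p)))⁻¹) * ‖k‖ ^ (2 * q) := by positivity
    have h3 := mul_le_mul_of_nonneg_left h1 hC
    linarith
  · have hk0 : 0 < ‖k‖ := hη0.trans_le hk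
    have h0 : 0 ≤ C * ‖k‖ ^ (2 * q) := by positivity
    have h1 : ‖charFun f k - ((1 - ‖k‖ ^ (2 * p) : ℝ) : ℂ)‖ ≤ 2 + ‖k‖ ^ (2 * p) := by
      have h2 := norm_charFun_le_one (μ := f) k
      have h3 : charFun f k - ((1 - ‖k‖ ^ (2 * p) : ℝ) : ℂ) =
          charFun f k - 1 + ((‖k‖ ^ (2 * p) : ℝ) : ℂ) := by push_cast; ring
      rw [h3]
      refine (norm_add_le _ _).trans (add_le_add ?_ ?_)
      · refine (norm_sub_le _ _).trans ?_
        rw [norm_one]; linarith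
      · rw [Complex.norm_real, Real.norm_of_nonneg (by positivity)]
    have h2 : 1 ≤ (η ^ (2 * q))⁻¹ * ‖k‖ ^ (2 * q) := by
      rw [← div_eq_inv_mul, one_le_div (by positivity)]
      exact Real.rpow_le_rpow hη0.le hk (by positivity)
    have h3 : ‖k‖ ^ (2 * p) ≤ (η ^ (2 * (q - p)))⁻¹ * ‖k‖ ^ (2 * q) := by
      have h4 : ‖k‖ ^ (2 * q) = ‖k‖ ^ (2 * (q - p)) * ‖k‖ ^ (2 * p) := by
        rw [← Real.rpow_add hk0]; congr 1; ring
      have h5 : 1 ≤ (η ^ (2 * (q - p)))⁻¹ * ‖k‖ ^ (2 * (q - p)) := by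
        rw [← div_eq_inv_mul, one_le_div (by positivity)]
        exact Real.rpow_le_rpow hη0.le hk (by linarith)
      rw [h4, ← mul_assoc]
      exact le_mul_of_one_le_left (by positivity) h5
    linarith

lemma hasExpansion_iff {d : ℕ} {p : ℝ} (hp : 0 < p) (f : ProbabilityMeasure (Vel d)) :
    HasExpansion p f ↔
      ∃ ε, 0 < ε ∧ ∀ q, p < q → q ≤ p + ε → ExpandsUpTo p q (f : Measure (Vel d)) := by
  have hsq : ∀ (k : Vel d) (r : ℝ), (‖k‖ ^ 2) ^ r = ‖k‖ ^ (2 * r) := fun k r => by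
    rw [Real.rpow_mul (norm_nonneg _), Real.rpow_two]
  constructor
  · rintro ⟨ε, hε, h⟩
    refine ⟨ε, hε, fun q hpq hq => ?_⟩
    obtain ⟨C, hC, h⟩ := h.exists_nonneg
    obtain ⟨δ, hδ, h⟩ := Metric.eventually_nhds_iff.1 h.bound
    refine expandsUpTo_of_local (C := C) (q₀ := p + ε) hp hpq.le hq hC hδ fun k hk => ?_
    have := h (y := k) (by simpa using hk)
    rw [hsq, hsq, Real.norm_of_nonneg (by positivity)] at this
    exact this
  · rintro ⟨ε, hε, h⟩
    obtain ⟨C, hC, h⟩ := h (p + ε) (by linarith) le_rfl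
    refine ⟨ε, hε, IsBigO.of_bound C (Eventually.of_forall fun k => ?_)⟩
    rw [hsq, hsq, Real.norm_of_nonneg (by positivity)]
    exact h k

end

/-! ### The Maxwellian and an isotropic law with tail exponent `2p` -/

section

/-- A law with radial characteristic function is isotropic. -/
lemma map_isometry_eq_of_charFun {E : Type*} [NormedAddCommGroup E] [InnerProductSpace ℝ E]
    [FiniteDimensional ℝ E] [MeasurableSpace E] [BorelSpace E] {f : Measure E} [IsFiniteMeasure f]
    {u : ℝ → ℂ} (h : ∀ k, charFun f k = u ‖k‖) (R : E ≃ₗᵢ[ℝ] E) : f.map R = f := by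
  refine Measure.ext_of_charFun ?_
  funext k
  rw [charFun_map_isometry, h, h, LinearIsometryEquiv.norm_map]

section Maxwellian

variable (d : ℕ)

lemma lintegral_maxwellian_density :
    ∫⁻ v : Vel d, ENNReal.ofReal
      ((4 * Real.pi) ^ (-(d : ℝ) / 2) * Real.exp (-‖v‖ ^ 2 / 4)) = 1 := by
  have h := GaussianFourier.integral_rexp_neg_mul_sq_norm (V := Vel d)
    (show (0 : ℝ) < 1 / 4 by norm_num)
  have hpi : (0 : ℝ) < Real.pi / (1 / 4) := by positivity
  have hval : (Real.pi / (1 / 4) : ℝ) = 4 * Real.pi := by ring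
  have hint : Integrable fun v : Vel d => Real.exp (-(1 / 4) * ‖v‖ ^ 2) := by
    by_contra hn
    rw [integral_undef hn] at h
    exact (Real.rpow_pos_of_pos hpi _).ne h
  have hfun : ∀ v : Vel d, (4 * Real.pi) ^ (-(d : ℝ) / 2) * Real.exp (-‖v‖ ^ 2 / 4) =
      (4 * Real.pi) ^ (-(d : ℝ) / 2) * Real.exp (-(1 / 4) * ‖v‖ ^ 2) := fun v => by
    congr 2; ring
  simp_rw [hfun]
  rw [← ofReal_integral_eq_lintegral_ofReal (hint.const_mul _)
    (Eventually.of_forall fun v => by positivity), integral_const_mul, h, hval,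
    ← Real.rpow_add (by positivity), finrank_euclideanSpace, Fintype.card_fin]
  rw [show -(d : ℝ) / 2 + d / 2 = 0 by ring, Real.rpow_zero, ENNReal.ofReal_one]

instance isProbabilityMeasure_maxwellian : IsProbabilityMeasure (maxwellian d) where
  measure_univ := by
    rw [maxwellian, withDensity_apply _ MeasurableSet.univ, setLIntegral_univ,
      lintegral_maxwellian_density]

lemma charFun_maxwellian (k : Vel d) :
    charFun (maxwellian d) k = ((Real.exp (-‖k‖ ^ 2) : ℝ) : ℂ) := by
  have hconst : ∃ c : ℂ, ∀ k, charFun (maxwellian d) k = c * ((Real.exp (-‖k‖ ^ 2) : ℝ) : ℂ) := by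
    refine ⟨((4 * Real.pi) ^ (-(d : ℝ) / 2) : ℝ) *
      (Real.pi / (1 / 4 : ℂ)) ^ (Module.finrank ℝ (Vel d) / 2 : ℂ), fun k => ?_⟩
    have h := GaussianFourier.integral_cexp_neg_mul_sq_norm_add (V := Vel d) (b := 1 / 4)
      (by norm_num) Complex.I k
    rw [charFun_apply, maxwellian, integral_withDensity_eq_integral_toReal_smul (by fun_prop)
      (by simp)]
    have hfun : ∀ v : Vel d, (ENNReal.ofReal
        ((4 * Real.pi) ^ (-(d : ℝ) / 2) * Real.exp (-‖v‖ ^ 2 / 4))).toReal •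
          Complex.exp ((⟪v, k⟫ : ℝ) * Complex.I) = ((4 * Real.pi) ^ (-(d : ℝ) / 2) : ℝ) *
          Complex.exp (-(1 / 4) * ‖v‖ ^ 2 + Complex.I * (⟪k, v⟫ : ℝ)) := fun v => by
      rw [ENNReal.toReal_ofReal (by positivity), Complex.real_smul, Complex.ofReal_mul, mul_assoc,
        Complex.ofReal_exp, ← Complex.exp_add, real_inner_comm]
      congr 2
      push_cast
      ring
    simp_rw [hfun]
    rw [integral_const_mul, h, mul_assoc]
    congr 2
    rw [Complex.ofReal_exp, Complex.I_sq]
    congr 1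
    push_cast
    ring
  obtain ⟨c, hc⟩ := hconst
  have h0 := hc 0
  rw [charFun_zero] at h0
  simp only [measureReal_def, measure_univ, norm_zero] at h0
  have hc1 : c = 1 := by simpa using h0.symm
  rw [hc, hc1, one_mul]

lemma maxwellian_map_isometry (R : Vel d ≃ₗᵢ[ℝ] Vel d) : (maxwellian d).map R = maxwellian d :=
  map_isometry_eq_of_charFun (u := fun r => ((Real.exp (-r ^ 2) : ℝ) : ℂ))
    (fun k => charFun_maxwellian d k) R

lemma absMoment_maxwellian_ne_top {r : ℝ} (hr : 0 < r) : absMoment (maxwellian d) r ≠ ∞ := by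
  -- the Maxwellian is the standard Gaussian law dilated by `√2`
  have hmap : maxwellian d = (ProbabilityTheory.stdGaussian (Vel d)).map
      ((√2 : ℝ) • ContinuousLinearMap.id ℝ (Vel d)) := by
    have : IsProbabilityMeasure ((ProbabilityTheory.stdGaussian (Vel d)).map
      ((√2 : ℝ) • ContinuousLinearMap.id ℝ (Vel d))) :=
      Measure.isProbabilityMeasure_map (by fun_prop)
    refine Measure.ext_of_charFun ?_
    funext k
    have h1 : ⇑((√2 : ℝ) • ContinuousLinearMap.id ℝ (Vel d)) = fun v => (√2 : ℝ) • v := by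
      ext v; simp
    rw [h1, charFun_map_smul, ProbabilityTheory.charFun_stdGaussian, charFun_maxwellian,
      norm_smul, Real.norm_of_nonneg (Real.sqrt_nonneg _), Complex.ofReal_exp]
    congr 1
    have : ((√2 : ℝ) : ℂ) ^ 2 = 2 := by
      rw [← Complex.ofReal_pow, Real.sq_sqrt zero_le_two]; norm_num
    push_cast
    rw [mul_pow, this]
    ring
  have hG : ProbabilityTheory.IsGaussian (maxwellian d) := by rw [hmap]; infer_instance
  rw [← integrable_norm_rpow_iff _ hr.le]
  have h := (ProbabilityTheory.IsGaussian.memLp_id (maxwellian d) (ENNReal.ofReal r)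
    ENNReal.ofReal_ne_top).integrable_norm_rpow (by simpa using hr) ENNReal.ofReal_ne_top
  simpa [ENNReal.toReal_ofReal hr.le] using h

lemma expandsUpTo_maxwellian {q : ℝ} (hq1 : 1 ≤ q) (hq2 : q ≤ 2) :
    ExpandsUpTo 1 q (maxwellian d) := by
  refine expandsUpTo_of_local (q₀ := 2) (C := 1) (δ := 1) one_pos hq1 hq2 zero_le_one
    one_pos fun k hk => ?_
  rw [charFun_maxwellian, ← Complex.ofReal_sub, Complex.norm_real, Real.norm_eq_abs, mul_one,
    one_mul, show (2 * 2 : ℝ) = ((4 : ℕ) : ℝ) by norm_num, Real.rpow_natCast, Real.rpow_two]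
  have h := Real.abs_exp_sub_one_sub_id_le (x := -‖k‖ ^ 2) (by
    rw [abs_neg, abs_of_nonneg (by positivity)]
    nlinarith [norm_nonneg k])
  refine (le_of_eq ?_).trans (h.trans (le_of_eq ?_))
  · congr 1; ring
  · ring

end Maxwellian

section Pareto

lemma measurable_paretoPDF (t p : ℝ) : Measurable (ProbabilityTheory.paretoPDF t p) :=
  (ProbabilityTheory.measurable_paretoPDFReal t p).ennreal_ofReal

lemma ae_nonneg_paretoMeasure {t : ℝ} (ht : 0 < t) (p : ℝ) :
    ∀ᵐ s ∂(ProbabilityTheory.paretoMeasure t p), 0 ≤ s := by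
  rw [ProbabilityTheory.paretoMeasure, ae_withDensity_iff (measurable_paretoPDF t p)]
  refine Eventually.of_forall fun s hs => ?_
  by_contra hs0
  exact hs (ProbabilityTheory.paretoPDF_of_lt (by linarith))

lemma integrableOn_one_sub_exp {p : ℝ} (hp : 0 < p) (hp1 : p < 1) :
    IntegrableOn (fun s : ℝ => (1 - Real.exp (-s)) * s ^ (-(p + 1))) (Set.Ioi 0) := by
  have hmeas : AEStronglyMeasurable (fun s : ℝ => (1 - Real.exp (-s)) * s ^ (-(p + 1)))
      (volume : Measure ℝ) := by
    exact (Measurable.mul (by fun_prop) (by fun_prop)).aestronglyMeasurable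
  rw [← Set.Ioc_union_Ioi_eq_Ioi zero_le_one, integrableOn_union]
  constructor
  · have h : IntegrableOn (fun s : ℝ => s ^ (-p)) (Set.Ioc 0 1) :=
      (intervalIntegrable_iff_integrableOn_Ioc_of_le zero_le_one).1
        (intervalIntegral.intervalIntegrable_rpow' (by linarith))
    refine Integrable.mono' h hmeas.restrict ((ae_restrict_iff' measurableSet_Ioc).2
      (Eventually.of_forall fun s hs => ?_))
    have h0 : 0 ≤ 1 - Real.exp (-s) := by
      have := Real.exp_le_one_iff.2 (by linarith [hs.1] : -s ≤ 0); linarith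
    have h1 : 1 - Real.exp (-s) ≤ s := by linarith [Real.add_one_le_exp (-s)]
    rw [Real.norm_of_nonneg (mul_nonneg h0 (Real.rpow_nonneg hs.1.le _))]
    have h2 : s ^ (-p) = s * s ^ (-(p + 1)) := by
      rw [← Real.rpow_one_add' hs.1.le (by linarith)]; congr 1; ring
    rw [h2]
    exact mul_le_mul_of_nonneg_right h1 (Real.rpow_nonneg hs.1.le _)
  · have h : IntegrableOn (fun s : ℝ => s ^ (-(p + 1))) (Set.Ioi 1) :=
      integrableOn_Ioi_rpow_of_lt (by linarith) one_pos
    refine Integrable.mono' h hmeas.restrict ((ae_restrict_iff' measurableSet_Ioi).2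
      (Eventually.of_forall fun s hs => ?_))
    have hs0 : (0 : ℝ) < s := one_pos.trans hs
    have h0 : 0 ≤ 1 - Real.exp (-s) := by
      have := Real.exp_le_one_iff.2 (by linarith : -s ≤ 0); linarith
    have h1 : 1 - Real.exp (-s) ≤ 1 := by linarith [Real.exp_pos (-s)]
    rw [Real.norm_of_nonneg (mul_nonneg h0 (Real.rpow_nonneg hs0.le _))]
    exact mul_le_of_le_one_left (Real.rpow_nonneg hs0.le _) h1

lemma integral_one_sub_exp_pos {p : ℝ} (hp : 0 < p) (hp1 : p < 1) :
    0 < ∫ s in Set.Ioi (0 : ℝ), (1 - Real.exp (-s)) * s ^ (-(p + 1)) := by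
  have hpos : ∀ s ∈ Set.Ioi (0 : ℝ), 0 < (1 - Real.exp (-s)) * s ^ (-(p + 1)) := fun s hs => by
    have h0 : 0 < 1 - Real.exp (-s) := by
      have := Real.exp_lt_one_iff.2 (by linarith [Set.mem_Ioi.1 hs] : -s < 0); linarith
    exact mul_pos h0 (Real.rpow_pos_of_pos hs _)
  rw [setIntegral_pos_iff_support_of_nonneg_ae
    ((ae_restrict_iff' measurableSet_Ioi).2 (Eventually.of_forall fun s hs => (hpos s hs).le))
    (integrableOn_one_sub_exp hp hp1)]
  have : Set.Ioi (0 : ℝ) ⊆ Function.support (fun s : ℝ => (1 - Real.exp (-s)) * s ^ (-(p + 1))) :=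
    fun s hs => (hpos s hs).ne'
  rw [Set.inter_eq_right.2 this]
  simp

/-- Scaling: `∫₀^∞ (1 - e^{-sx}) s^{-p-1} ds` is proportional to `x^p`. -/
lemma integrableOn_and_integral_one_sub_exp_mul {p x : ℝ} (hp : 0 < p) (hp1 : p < 1) (hx : 0 < x) :
    IntegrableOn (fun s : ℝ => (1 - Real.exp (-(s * x))) * s ^ (-(p + 1))) (Set.Ioi 0) ∧
    ∫ s in Set.Ioi (0 : ℝ), (1 - Real.exp (-(s * x))) * s ^ (-(p + 1)) =
      x ^ p * ∫ s in Set.Ioi (0 : ℝ), (1 - Real.exp (-s)) * s ^ (-(p + 1)) := by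
  set g : ℝ → ℝ := fun s => (1 - Real.exp (-s)) * s ^ (-(p + 1)) with hg
  have hfun : ∀ s ∈ Set.Ioi (0 : ℝ), (1 - Real.exp (-(s * x))) * s ^ (-(p + 1)) =
      x ^ (p + 1) * g (s * x) := fun s hs => by
    have hs0 : (0 : ℝ) < s := hs
    simp only [hg]
    rw [Real.mul_rpow hs0.le hx.le, Real.rpow_neg hx.le]
    have : x ^ (p + 1) ≠ 0 := (Real.rpow_pos_of_pos hx _).ne'
    field_simp
  have hi : IntegrableOn (fun s => g (s * x)) (Set.Ioi 0) := by
    have := (integrableOn_Ioi_comp_mul_right_iff g 0 hx).2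
    rw [zero_mul] at this
    exact this (integrableOn_one_sub_exp hp hp1)
  refine ⟨(IntegrableOn.congr_fun (Integrable.const_mul hi (x ^ (p + 1)))
    (fun s hs => (hfun s hs).symm) measurableSet_Ioi), ?_⟩
  rw [setIntegral_congr_fun measurableSet_Ioi hfun, integral_const_mul,
    integral_comp_mul_right_Ioi g 0 hx, zero_mul, smul_eq_mul, ← mul_assoc]
  congr 1
  rw [Real.rpow_add_one hx.ne', mul_assoc, mul_inv_cancel₀ hx.ne', mul_one]

/-- The Laplace transform of the Pareto law is `1 - t^p (p K x^p) + O(x)`. -/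
lemma abs_laplace_pareto_sub_le {p t x : ℝ} (hp : 0 < p) (hp1 : p < 1) (ht : 0 < t) (hx : 0 ≤ x) :
    |(∫ s, Real.exp (-(s * x)) ∂(ProbabilityTheory.paretoMeasure t p)) - (1 - p * t ^ p *
      ((∫ s in Set.Ioi (0 : ℝ), (1 - Real.exp (-s)) * s ^ (-(p + 1))) * x ^ p))| ≤
      p * t ^ p * (t ^ (1 - p) / (1 - p)) * x := by
  have hprob := ProbabilityTheory.isProbabilityMeasure_paretoMeasure ht hp
  rcases hx.eq_or_lt with rfl | hx
  · simp [Real.zero_rpow hp.ne']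
  obtain ⟨hi, hK⟩ := integrableOn_and_integral_one_sub_exp_mul hp hp1 hx
  set h : ℝ → ℝ := fun s => (1 - Real.exp (-(s * x))) * s ^ (-(p + 1)) with hh
  have htp : 0 < p * t ^ p := by positivity
  have hpos : ∀ᵐ s ∂(ProbabilityTheory.paretoMeasure t p), 0 ≤ s := ae_nonneg_paretoMeasure ht p
  have hie : Integrable (fun s => Real.exp (-(s * x))) (ProbabilityTheory.paretoMeasure t p) := by
    refine Integrable.of_bound (C := 1) (Continuous.aestronglyMeasurable (by fun_prop)) ?_
    filter_upwards [hpos] with s hs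
    rw [Real.norm_of_nonneg (Real.exp_pos _).le, Real.exp_le_one_iff]
    nlinarith
  have h1 : 1 - ∫ s, Real.exp (-(s * x)) ∂(ProbabilityTheory.paretoMeasure t p) =
      p * t ^ p * ∫ s in Set.Ioi t, h s := by
    have e1 : 1 - ∫ s, Real.exp (-(s * x)) ∂(ProbabilityTheory.paretoMeasure t p) =
        ∫ s, (1 - Real.exp (-(s * x))) ∂(ProbabilityTheory.paretoMeasure t p) := by
      rw [integral_sub (integrable_const _) hie]; simp
    rw [e1, ProbabilityTheory.paretoMeasure, integral_withDensity_eq_integral_toReal_smul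
      (measurable_paretoPDF t p)
      (Eventually.of_forall fun s => ENNReal.ofReal_lt_top), ← integral_const_mul,
      ← integral_Ici_eq_integral_Ioi, ← integral_indicator measurableSet_Ici]
    refine integral_congr_ae (Eventually.of_forall fun s => ?_)
    by_cases hs : t ≤ s
    · have hs0 : 0 < s := ht.trans_le hs
      simp only [ProbabilityTheory.paretoPDF_of_le hs]
      rw [Set.indicator_of_mem (show s ∈ Set.Ici t from hs),
        ENNReal.toReal_ofReal (by positivity), smul_eq_mul, hh]
      ring
    · simp only [ProbabilityTheory.paretoPDF_of_lt (not_le.1 hs)]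
      rw [Set.indicator_of_notMem (show s ∉ Set.Ici t from hs)]
      simp
  -- On all of `(0, ∞)` the integral is the exact power `x^p`; the missing part `(0, t]` is `O(x)`.
  have hsplit : (∫ s in Set.Ioc 0 t, h s) + ∫ s in Set.Ioi t, h s = ∫ s in Set.Ioi 0, h s := by
    rw [← Set.Ioc_union_Ioi_eq_Ioi ht.le]
    rw [← Set.Ioc_union_Ioi_eq_Ioi ht.le] at hi
    exact (setIntegral_union (Set.Ioc_disjoint_Ioi le_rfl) measurableSet_Ioi
      (hi.mono_set Set.subset_union_left) (hi.mono_set Set.subset_union_right)).symm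
  have hnn : ∀ s ∈ Set.Ioc (0 : ℝ) t, 0 ≤ h s := fun s hs => by
    have := Real.exp_le_one_iff.2 (by nlinarith [hs.1] : -(s * x) ≤ 0)
    exact mul_nonneg (by linarith) (Real.rpow_nonneg hs.1.le _)
  have hle : ∫ s in Set.Ioc 0 t, h s ≤ t ^ (1 - p) / (1 - p) * x := by
    have hi2 : IntegrableOn (fun s : ℝ => x * s ^ (-p)) (Set.Ioc 0 t) :=
      ((intervalIntegrable_iff_integrableOn_Ioc_of_le ht.le).1
        (intervalIntegral.intervalIntegrable_rpow' (by linarith))).const_mul x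
    have h2 : ∫ s in Set.Ioc 0 t, h s ≤ ∫ s in Set.Ioc 0 t, x * s ^ (-p) := by
      refine setIntegral_mono_on (hi.mono_set Set.Ioc_subset_Ioi_self) hi2 measurableSet_Ioc
        fun s hs => ?_
      have h3 : s ^ (-p) = s * s ^ (-(p + 1)) := by
        rw [← Real.rpow_one_add' hs.1.le (by linarith)]; congr 1; ring
      rw [h3, ← mul_assoc, mul_comm x s]
      exact mul_le_mul_of_nonneg_right (by linarith [Real.add_one_le_exp (-(s * x))])
        (Real.rpow_nonneg hs.1.le _)
    refine h2.trans (le_of_eq ?_)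
    rw [integral_const_mul, ← intervalIntegral.integral_of_le ht.le,
      integral_rpow (Or.inl (by linarith)), show -p + 1 = 1 - p by ring,
      Real.zero_rpow (by linarith : (1 - p) ≠ 0), sub_zero, mul_comm]
  have h0 : 0 ≤ ∫ s in Set.Ioc 0 t, h s := setIntegral_nonneg measurableSet_Ioc hnn
  have hval : (∫ s, Real.exp (-(s * x)) ∂(ProbabilityTheory.paretoMeasure t p)) -
      (1 - p * t ^ p *
      ((∫ s in Set.Ioi (0 : ℝ), (1 - Real.exp (-s)) * s ^ (-(p + 1))) * x ^ p)) =
      p * t ^ p * ∫ s in Set.Ioc 0 t, h s := by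
    rw [mul_comm _ (x ^ p), ← hK, ← hsplit, mul_add, ← h1]; ring
  rw [hval, abs_of_nonneg (by positivity), mul_assoc (p * t ^ p)]
  exact mul_le_mul_of_nonneg_left hle htp.le

/-- A Gaussian mixture with Pareto-distributed variance has the expansion `1 - ‖k‖^{2p}`. -/
lemma exists_isotropic_expandsUpTo (d : ℕ) {p : ℝ} (hp : 0 < p) (hp1 : p < 1) :
    ∃ f : ProbabilityMeasure (Vel d), IsIsotropic f ∧
      ∀ q, p < q → q ≤ 1 → ExpandsUpTo p q (f : Measure (Vel d)) := by
  set K := ∫ s in Set.Ioi (0 : ℝ), (1 - Real.exp (-s)) * s ^ (-(p + 1)) with hK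
  have hK0 : 0 < K := integral_one_sub_exp_pos hp hp1
  -- The scale `t` of the Pareto law normalizes the coefficient of `‖k‖^{2p}` to `1`.
  obtain ⟨t, ht, htp⟩ : ∃ t : ℝ, 0 < t ∧ p * t ^ p * K = 1 := by
    refine ⟨((p * K)⁻¹) ^ p⁻¹, by positivity, ?_⟩
    rw [← Real.rpow_mul (by positivity), inv_mul_cancel₀ hp.ne', Real.rpow_one]
    field_simp
  have hprob := ProbabilityTheory.isProbabilityMeasure_paretoMeasure ht hp
  set π := (ProbabilityTheory.paretoMeasure t p).prod (maxwellian d) with hπ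
  have hmeas : Measurable fun z : ℝ × Vel d => √z.1 • z.2 := by fun_prop
  have hfp : IsProbabilityMeasure (π.map fun z : ℝ × Vel d => √z.1 • z.2) :=
    Measure.isProbabilityMeasure_map hmeas.aemeasurable
  have hpos : ∀ᵐ s ∂(ProbabilityTheory.paretoMeasure t p), 0 ≤ s := ae_nonneg_paretoMeasure ht p
  have hchar : ∀ k, charFun (π.map fun z : ℝ × Vel d => √z.1 • z.2) k =
      ((∫ s, Real.exp (-(s * ‖k‖ ^ 2)) ∂(ProbabilityTheory.paretoMeasure t p) : ℝ) : ℂ) := by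
    intro k
    have hi : Integrable (fun z : ℝ × Vel d =>
        Complex.exp ((⟪√z.1 • z.2, k⟫ : ℝ) * Complex.I)) π := by
      refine Integrable.of_bound (C := 1) (Continuous.aestronglyMeasurable (by fun_prop))
        (Eventually.of_forall fun z => ?_)
      rw [Complex.norm_exp_ofReal_mul_I]
    rw [charFun_apply, integral_map hmeas.aemeasurable
      (Continuous.aestronglyMeasurable (by fun_prop)), integral_prod _ hi]
    refine Eq.trans (integral_congr_ae ?_) integral_ofReal
    filter_upwards [hpos] with s hs
    have h1 : ∀ v : Vel d, ⟪√s • v, k⟫ = ⟪v, √s • k⟫ := fun v => by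
      rw [real_inner_smul_left, real_inner_smul_right]
    simp only [h1]
    rw [← charFun_apply, charFun_maxwellian, norm_smul, Real.norm_of_nonneg (Real.sqrt_nonneg _),
      mul_pow, Real.sq_sqrt hs]
    rfl
  refine ⟨⟨_, hfp⟩, fun R => map_isometry_eq_of_charFun (u := fun r =>
    ((∫ s, Real.exp (-(s * r ^ 2)) ∂(ProbabilityTheory.paretoMeasure t p) : ℝ) : ℂ)) hchar R,
    fun q hpq hq => ?_⟩
  have hC : 0 ≤ p * t ^ p * (t ^ (1 - p) / (1 - p)) := by
    have : 0 < 1 - p := by linarith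
    positivity
  refine expandsUpTo_of_local (f := π.map fun z : ℝ × Vel d => √z.1 • z.2) (q₀ := 1) hp hpq.le hq hC
    one_pos fun k _ => ?_
  have h := abs_laplace_pareto_sub_le hp hp1 ht (sq_nonneg ‖k‖)
  rw [← hK, ← mul_assoc, htp, one_mul, ← Real.rpow_two, ← Real.rpow_mul (norm_nonneg _)] at h
  rw [hchar, ← Complex.ofReal_sub, Complex.norm_real, Real.norm_eq_abs, mul_one]
  rw [Real.rpow_two] at h ⊢
  exact h

end Pareto

end

/-! ### Passing between weak solutions and equations for characteristic functions -/

section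

section Fourier

variable {E : Type*} [NormedAddCommGroup E] [InnerProductSpace ℝ E] [FiniteDimensional ℝ E]
  [MeasurableSpace E] [BorelSpace E]

/-- The test function `v ↦ cos ⟨v, k⟩`. -/
def cosTest (k : E) : E →ᵇ ℝ :=
  BoundedContinuousFunction.ofNormedAddCommGroup (fun v => Real.cos ⟪v, k⟫) (by fun_prop) 1
    fun v => by simpa using Real.abs_cos_le_one _

/-- The test function `v ↦ sin ⟨v, k⟩`. -/
def sinTest (k : E) : E →ᵇ ℝ :=
  BoundedContinuousFunction.ofNormedAddCommGroup (fun v => Real.sin ⟪v, k⟫) (by fun_prop) 1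
    fun v => by simpa using Real.abs_sin_le_one _

lemma charFun_eq_integral_test (f : Measure E) [IsFiniteMeasure f] (k : E) :
    charFun f k = ((∫ v, cosTest k v ∂f : ℝ) : ℂ) + ((∫ v, sinTest k v ∂f : ℝ) : ℂ) * Complex.I := by
  have hc : Integrable (fun v => ((cosTest k v : ℝ) : ℂ)) f :=
    ((cosTest k).integrable f).ofReal
  have hs : Integrable (fun v => ((sinTest k v : ℝ) : ℂ)) f :=
    ((sinTest k).integrable f).ofReal
  have e : ∀ g : E → ℝ, ((∫ v, g v ∂f : ℝ) : ℂ) = ∫ v, ((g v : ℝ) : ℂ) ∂f := fun g =>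
    integral_ofReal.symm
  rw [charFun_apply, e, e, ← integral_mul_const, ← integral_add hc (hs.mul_const _)]
  refine integral_congr_ae (Eventually.of_forall fun v => ?_)
  simp only [cosTest, sinTest, BoundedContinuousFunction.coe_ofNormedAddCommGroup]
  rw [Complex.exp_mul_I]
  push_cast
  rfl

lemma hasDerivWithinAt_charFun {f : ℝ → ProbabilityMeasure E} {Q : Measure E} [IsFiniteMeasure Q]
    {Λ t : ℝ} (h : ∀ ψ : E →ᵇ ℝ, HasDerivWithinAt (fun τ => ∫ v, ψ v ∂(f τ : Measure E))
      (∫ v, ψ v ∂Q - Λ * ∫ v, ψ v ∂(f t : Measure E)) (Set.Ici 0) t) (k : E) :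
    HasDerivWithinAt (fun τ => charFun (f τ : Measure E) k)
      (charFun Q k - (Λ : ℝ) * charFun (f t : Measure E) k) (Set.Ici 0) t := by
  have h1 := (h (cosTest k)).ofReal_comp
  have h2 := ((h (sinTest k)).ofReal_comp).mul_const Complex.I
  have h3 := h1.add h2
  refine (h3.congr_deriv ?_).congr (fun τ _ => ?_) ?_
  · rw [charFun_eq_integral_test Q k, charFun_eq_integral_test (f t : Measure E) k]
    push_cast
    ring
  · exact charFun_eq_integral_test _ k
  · exact charFun_eq_integral_test _ k

lemma ext_of_charFun_eq {f g : ProbabilityMeasure E}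
    (h : ∀ k, charFun (f : Measure E) k = charFun (g : Measure E) k) : f = g :=
  Subtype.ext (Measure.ext_of_charFun (μ := (f : Measure E)) (ν := (g : Measure E)) (funext h))

/-- Uniqueness for `∂ₜ φ = Q - Λ φ` when the gain term is Lipschitz in the supremum norm of
characteristic functions. -/
lemma eq_of_charFun_equation {Λ c : ℝ} (hΛ : 0 ≤ Λ) (hc : 0 ≤ c) {f g : ℝ → ProbabilityMeasure E}
    {Qf Qg : ℝ → E → ℂ}
    (hf : ∀ k t, 0 ≤ t → HasDerivWithinAt (fun τ => charFun (f τ : Measure E) k)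
      (Qf t k - (Λ : ℝ) * charFun (f t : Measure E) k) (Set.Ici 0) t)
    (hg : ∀ k t, 0 ≤ t → HasDerivWithinAt (fun τ => charFun (g τ : Measure E) k)
      (Qg t k - (Λ : ℝ) * charFun (g t : Measure E) k) (Set.Ici 0) t)
    (hQ : ∀ t, 0 ≤ t → ∀ M, 0 ≤ M →
      (∀ k, ‖charFun (f t : Measure E) k - charFun (g t : Measure E) k‖ ≤ M) →
      ∀ k, ‖Qf t k - Qg t k‖ ≤ c * M)
    (h0 : f 0 = g 0) (t : ℝ) (ht : 0 ≤ t) : f t = g t := by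
  have h := weighted_comparison (C := 0) (κ := c + 1) (Λ := Λ) (c := c) (W := fun _ : E => 1)
    (D := fun t k => charFun (f t : Measure E) k - charFun (g t : Measure E) k)
    (R := fun t k => Qf t k - Qg t k) (fun _ => zero_le_one) hc (by linarith) le_rfl
    (fun k t ht => ((hf k t ht).sub (hg k t ht)).congr_deriv (by ring))
    (fun k => by simp [h0])
    (fun t ht M hM hD k => by simpa using hQ t ht M hM (by simpa using hD) k)
    (fun T _ => ⟨2, zero_le_two, fun t _ k => by
      refine (norm_sub_le _ _).trans ?_
      have h1 := norm_charFun_le_one (μ := (f t : Measure E)) k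
      have h2 := norm_charFun_le_one (μ := (g t : Measure E)) k
      linarith⟩) t ht
  refine ext_of_charFun_eq fun k => ?_
  have := h k
  simp only [zero_mul, zero_div] at this
  exact sub_eq_zero.1 (norm_le_zero_iff.1 this)

lemma norm_charFun_smooth_sub_le_of_sup {ν : Measure (ℝ × ℝ)} [IsFiniteMeasure ν]
    {f g : Measure E} [IsProbabilityMeasure f] [IsProbabilityMeasure g] {M : ℝ} (hM : 0 ≤ M)
    (hfg : ∀ k, ‖charFun f k - charFun g k‖ ≤ M) (k : E) :
    ‖charFun (smooth ν f f) k - charFun (smooth ν g g) k‖ ≤ 2 * ν.real Set.univ * M := by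
  have h := norm_charFun_smooth_sub_le (ν := ν) (f := f) (g := g) (W := fun _ => 1) (M := M)
    (c := 2 * ν.real Set.univ) (k := k) (integrable_const _) hM (by
      rw [integral_const, smul_eq_mul]; linarith) (by simpa using hfg)
  simpa using h

end Fourier

/-! ### Maxwell models whose isotropic collision operator is of Kac form -/

/-- The collision operator of the model is `gain f - |ν| f` with a gain term that is Lipschitz in
the supremum norm of characteristic functions, and on isotropic laws the gain term is the law of
`a V + b W` with `(a, b)` distributed by `ν`. -/
structure IsKacForm {d : ℕ} (𝓜 : MaxwellModel) (ν : Measure (ℝ × ℝ))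
    (gain : ProbabilityMeasure (Vel d) → Measure (Vel d)) : Prop where
  /-- collisions do not create energy -/
  dissipative : IsDissipative ν
  /-- both particles contribute to `v'` with positive probability; this excludes that `smooth ν` is
  a mere dilation -/
  overlap : ν {x | x.1 ≠ 0 ∧ x.2 ≠ 0} ≠ 0
  mu_eq : ∀ p, 0 < p → 𝓜.mu d p = rate ν p
  /-- the spectral function drops at `1` -/
  exists_rate_lt : ∃ q, 1 < q ∧ rate ν q < rate ν 1
  op_eq : ∀ (f : ProbabilityMeasure (Vel d)) (ψ : Vel d →ᵇ ℝ),
    𝓜.op d (f : Measure (Vel d)) ψ =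
      ∫ v, ψ v ∂(gain f) - ν.real Set.univ * ∫ v, ψ v ∂(f : Measure (Vel d))
  gain_finite : ∀ f, IsFiniteMeasure (gain f)
  gain_sub_le : ∀ (f g : ProbabilityMeasure (Vel d)) (M : ℝ),
    (∀ k, ‖charFun (f : Measure (Vel d)) k - charFun (g : Measure (Vel d)) k‖ ≤ M) →
    ∀ k, ‖charFun (gain f) k - charFun (gain g) k‖ ≤ 2 * ν.real Set.univ * M
  gain_isotropic : ∀ f : ProbabilityMeasure (Vel d), IsIsotropic f →
    gain f = smooth ν (f : Measure (Vel d)) (f : Measure (Vel d))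
  /-- conservation of energy in each collision -/
  elastic : 𝓜.IsElastic → ∀ᵐ x ∂ν, x.1 ^ 2 + x.2 ^ 2 = 1
  /-- loss of energy on average -/
  not_elastic : ¬ 𝓜.IsElastic → rate ν 1 < 0

lemma selfSimilarWeights_overlap {ν : Measure (ℝ × ℝ)} [IsFiniteMeasure ν] [NeZero ν]
    (h : ν {x | x.1 ≠ 0 ∧ x.2 ≠ 0} ≠ 0) (μ : ℝ) :
    selfSimilarWeights ν μ {x | x.1 ≠ 0 ∧ x.2 ≠ 0} ≠ 0 := by
  have hprob := isProbabilityMeasure_selfSimilarWeights (ν := ν) μ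
  have hfin := isFiniteMeasure_expTime (total_pos ν)
  have hms : MeasurableSet {x : ℝ × ℝ | x.1 ≠ 0 ∧ x.2 ≠ 0} := by measurability
  have huniv := hprob.measure_univ
  rw [selfSimilarWeights, Measure.map_apply (measurable_selfSimilarWeights_fun μ)
    MeasurableSet.univ, Set.preimage_univ,
    ← Set.univ_prod_univ (α := ℝ) (β := ℝ × ℝ), Measure.prod_prod] at huniv
  have hpre : (fun x : ℝ × ℝ × ℝ =>
      (Real.exp (-(μ / 2) * x.1) * x.2.1, Real.exp (-(μ / 2) * x.1) * x.2.2)) ⁻¹'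
      {x : ℝ × ℝ | x.1 ≠ 0 ∧ x.2 ≠ 0} = Set.univ ×ˢ {x : ℝ × ℝ | x.1 ≠ 0 ∧ x.2 ≠ 0} := by
    ext x
    simp [Real.exp_ne_zero]
  rw [selfSimilarWeights, Measure.map_apply (measurable_selfSimilarWeights_fun μ) hms, hpre,
    Measure.prod_prod]
  refine mul_ne_zero (fun h0 => ?_) h
  rw [h0, zero_mul] at huniv
  exact zero_ne_one huniv

section Dilate

variable {d : ℕ}

lemma charFun_dilate (c : ℝ) (f : ProbabilityMeasure (Vel d)) (k : Vel d) :
    charFun (dilate c f : Measure (Vel d)) k = charFun (f : Measure (Vel d)) (c • k) :=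
  charFun_map_smul c k

lemma dilate_dilate_of_mul_eq_one {a b : ℝ} (h : a * b = 1) (f : ProbabilityMeasure (Vel d)) :
    dilate a (dilate b f) = f := by
  refine ext_of_charFun_eq fun k => ?_
  rw [charFun_dilate, charFun_dilate, smul_smul, mul_comm, h, one_smul]

lemma dilate_one (f : ProbabilityMeasure (Vel d)) : dilate 1 f = f := by
  refine ext_of_charFun_eq fun k => ?_
  rw [charFun_dilate, one_smul]

end Dilate

namespace IsKacForm

variable {d : ℕ} {𝓜 : MaxwellModel} {ν : Measure (ℝ × ℝ)} [IsFiniteMeasure ν]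
  {gain : ProbabilityMeasure (Vel d) → Measure (Vel d)}

lemma neZero (h : IsKacForm 𝓜 ν gain) : NeZero ν :=
  ⟨fun h0 => h.overlap (by simp [h0])⟩

lemma weightMoment_pos (h : IsKacForm 𝓜 ν gain) {q : ℝ} (hq : 0 < q) : 0 < weightMoment ν q := by
  have hnn : 0 ≤ᵐ[ν] fun x : ℝ × ℝ => x.1 ^ (2 * q) + x.2 ^ (2 * q) := by
    filter_upwards [h.dissipative] with x hx
    exact add_nonneg (Real.rpow_nonneg hx.1 _) (Real.rpow_nonneg hx.2.1 _)
  refine (integral_pos_iff_support_of_nonneg_ae hnn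
    (h.dissipative.integrable (by positivity))).2 (pos_iff_ne_zero.2 fun h0 => h.overlap ?_)
  have h1 : ∀ᵐ x ∂ν, x.1 ^ (2 * q) + x.2 ^ (2 * q) = 0 := by
    rw [ae_iff]; exact h0
  have h2 : ∀ᵐ x ∂ν, ¬ (x.1 ≠ 0 ∧ x.2 ≠ 0) := by
    filter_upwards [h1, h.dissipative] with x hx hx' hne
    have ha := Real.rpow_pos_of_pos (lt_of_le_of_ne hx'.1 hne.1.symm) (2 * q)
    have hb := Real.rpow_nonneg hx'.2.1 (2 * q)
    linarith
  rw [ae_iff] at h2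
  simpa using h2

/-! #### The initial value problem -/

lemma hasDerivWithinAt (h : IsKacForm 𝓜 ν gain) {f : ℝ → ProbabilityMeasure (Vel d)}
    (hf : 𝓜.IsSolution f) (k : Vel d) (t : ℝ) (ht : 0 ≤ t) :
    HasDerivWithinAt (fun τ => charFun (f τ : Measure (Vel d)) k)
      (charFun (gain (f t)) k - (ν.real Set.univ : ℝ) * charFun (f t : Measure (Vel d)) k)
      (Set.Ici 0) t := by
  have := h.gain_finite (f t)
  exact hasDerivWithinAt_charFun (fun ψ => (hf ψ t ht).congr_deriv (h.op_eq _ _)) k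

lemma solution_unique (h : IsKacForm 𝓜 ν gain) {f g : ℝ → ProbabilityMeasure (Vel d)}
    (hf : 𝓜.IsSolution f) (hg : 𝓜.IsSolution g) (h0 : f 0 = g 0) (t : ℝ) (ht : 0 ≤ t) :
    f t = g t :=
  eq_of_charFun_equation (c := 2 * ν.real Set.univ) measureReal_nonneg
    (mul_nonneg zero_le_two measureReal_nonneg) (h.hasDerivWithinAt hf) (h.hasDerivWithinAt hg)
    (fun t _ M _ hM => h.gain_sub_le (f t) (g t) M hM) h0 t ht

lemma exists_solution (h : IsKacForm 𝓜 ν gain) (f₀ : ProbabilityMeasure (Vel d))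
    (hf₀ : IsIsotropic f₀) : ∃ f : ℝ → ProbabilityMeasure (Vel d),
      f 0 = f₀ ∧ 𝓜.IsSolution f ∧ (∀ t, IsIsotropic (f t)) ∧ IsKacSolution ν f := by
  have := h.neZero
  obtain ⟨f, h0, hf, hR⟩ := KacMaxwell.exists_solution ν f₀
  have hiso : ∀ t, IsIsotropic (f t) := fun t R => hR R (hf₀ R) t
  refine ⟨f, h0, fun ψ t ht => (hf ψ t ht).congr_deriv ?_, hiso, fun k t ht => ?_⟩
  · rw [h.op_eq, h.gain_isotropic _ (hiso t)]
  · exact hasDerivWithinAt_charFun (fun ψ => hf ψ t ht) k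

lemma isKacSolution (h : IsKacForm 𝓜 ν gain) {f : ℝ → ProbabilityMeasure (Vel d)}
    (hf : 𝓜.IsSolution f) (hf0 : IsIsotropic (f 0)) : IsKacSolution ν f := by
  obtain ⟨g, h0, hg, hiso, -⟩ := h.exists_solution (f 0) hf0
  intro k t ht
  have := h.hasDerivWithinAt hf k t ht
  rwa [h.gain_isotropic (f t) (by rw [h.solution_unique hf hg h0.symm t ht]; exact hiso t)] at this

lemma isSolution_of_isKacSolution (h : IsKacForm 𝓜 ν gain) {g : ℝ → ProbabilityMeasure (Vel d)}
    (hg : IsKacSolution ν g) (hg0 : IsIsotropic (g 0)) : 𝓜.IsSolution g := by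
  obtain ⟨f, h0, hf, -, hfK⟩ := h.exists_solution (g 0) hg0
  have heq : ∀ t, 0 ≤ t → g t = f t :=
    eq_of_charFun_equation (c := 2 * ν.real Set.univ) measureReal_nonneg
      (mul_nonneg zero_le_two measureReal_nonneg) hg hfK
      (fun t _ M hM h => norm_charFun_smooth_sub_le_of_sup hM h) h0.symm
  intro ψ t ht
  rw [heq t ht]
  exact (hf ψ t ht).congr (fun τ hτ => by rw [heq τ hτ]) (by rw [heq t ht])

/-! #### The profiles -/

/-- A fixed point of the smoothing transform with self-similar weights, as limit of the iterates
that start from a law with the required expansion. -/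
lemma exists_fixedPoint (h : IsKacForm 𝓜 ν gain) {p q₁ : ℝ} (hp : 0 < p) (hp1 : p ≤ 1)
    (hpq : p < q₁) {f₀ : ProbabilityMeasure (Vel d)} (hiso : IsIsotropic f₀)
    (hexp : ∀ q, p < q → q ≤ q₁ → ExpandsUpTo p q (f₀ : Measure (Vel d))) :
    ∃ (F : ProbabilityMeasure (Vel d)) (f : ℕ → ProbabilityMeasure (Vel d)),
      f 0 = f₀ ∧ (∀ n, (f (n + 1) : Measure (Vel d)) =
        smooth (selfSimilarWeights ν (rate ν p)) (f n : Measure (Vel d)) (f n)) ∧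
      Tendsto f atTop (𝓝 F) ∧ (∀ n, IsIsotropic (f n)) ∧ IsIsotropic F ∧
      smooth (selfSimilarWeights ν (rate ν p)) (F : Measure (Vel d)) F = F ∧
      ∃ q, p < q ∧ ExpandsUpTo p q (F : Measure (Vel d)) := by
  have := h.neZero
  have := isProbabilityMeasure_selfSimilarWeights (ν := ν) (rate ν p)
  obtain ⟨q₀, hq₀, hlt⟩ := h.exists_rate_lt
  set q := min (min q₀ (2 * p)) q₁ with hq
  have hpq' : p < q := lt_min (lt_min (by linarith) (by linarith)) hpq
  have hq0 : 0 < q := hp.trans hpq'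
  have hrate := rate_lt_rate h.dissipative hq₀ hlt hp hp1 hpq'
    ((min_le_left _ _).trans (min_le_left _ _))
  have hp' : weightMoment ν p = ν.real Set.univ + rate ν p * p := by
    have := (rate_eq_iff (ν := ν) (c := rate ν p) hp).1 rfl
    linarith
  have hq' : weightMoment ν q < ν.real Set.univ + rate ν p * q := by
    have := (rate_lt_iff (ν := ν) hq0).1 hrate
    linarith
  have hp0 : 0 < ν.real Set.univ + rate ν p * p := hp' ▸ h.weightMoment_pos hp
  have hq0' : 0 < ν.real Set.univ + rate ν p * q :=
    (weightMoment_nonneg h.dissipative q).trans_lt hq'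
  obtain ⟨C, hC, hC'⟩ := hexp q hpq' (min_le_right _ _)
  obtain ⟨F, f, h0, hs, hlim, hfix, ⟨C', hF⟩, hR, hRF⟩ := exists_smooth_fixedPoint
    (selfSimilarWeights_nonneg h.dissipative (rate ν p)) hp hpq'
    ((min_le_left _ _).trans (min_le_right _ _))
    (integrable_selfSimilarWeights h.dissipative hp.le hp0)
    (integrable_selfSimilarWeights h.dissipative hq0.le hq0')
    (by rw [weightMoment_selfSimilarWeights h.dissipative hp0, hp', div_self hp0.ne'])
    (by rw [weightMoment_selfSimilarWeights h.dissipative hq0']; exact (div_lt_one hq0').2 hq')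
    f₀ hC hC'
  refine ⟨F, f, h0, hs, hlim, fun n R => hR R (hiso R) n, fun R => hRF R (hiso R), hfix, q, hpq',
    |C'|, abs_nonneg _, fun k => (hF k).trans ?_⟩
  exact mul_le_mul_of_nonneg_right (le_abs_self _) (by positivity)

lemma hasExpansion_of_expandsUpTo {p q : ℝ} (hp : 0 < p) (hpq : p < q)
    {F : ProbabilityMeasure (Vel d)} (hF : ExpandsUpTo p q (F : Measure (Vel d))) :
    HasExpansion p F := by
  refine (hasExpansion_iff hp F).2 ⟨q - p, by linarith, fun q' hq hq' => ?_⟩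
  obtain ⟨C, hC, hF⟩ := hF
  exact expandsUpTo_of_local hp hq.le (by linarith) hC one_pos fun k _ => hF k

lemma isKacSolution_dilate (h : IsKacForm 𝓜 ν gain) {p : ℝ} (hp : 0 < p)
    {F : ProbabilityMeasure (Vel d)}
    (hfix : smooth (selfSimilarWeights ν (rate ν p)) (F : Measure (Vel d)) F = F) :
    IsKacSolution ν fun t => dilate (Real.exp (𝓜.mu d p * t / 2)) F := by
  have := h.neZero
  refine isKacSolution_of_fixedPoint hfix fun t k => ?_
  rw [charFun_dilate, h.mu_eq p hp]

lemma isSelfSimilarProfile (h : IsKacForm 𝓜 ν gain) {p : ℝ} (hp : 0 < p)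
    {F : ProbabilityMeasure (Vel d)} (hiso : IsIsotropic F)
    (hfix : smooth (selfSimilarWeights ν (rate ν p)) (F : Measure (Vel d)) F = F) :
    𝓜.IsSelfSimilarProfile p F := by
  refine h.isSolution_of_isKacSolution (h.isKacSolution_dilate hp hfix) ?_
  simpa [dilate_one] using hiso

/-- The weighted Fourier distance, of an order `q > p` with `μ(q) < μ(p)`, between a solution and
the self-similar one grows at most like `exp (κ t)` with `κ < q μ(p)`. Rescaling the frequency by
`exp (-μ(p) t / 2)` turns this into decay. -/
lemma attracts (h : IsKacForm 𝓜 ν gain) {p q₁ : ℝ} (hp : 0 < p) (hp1 : p ≤ 1) (hpq : p < q₁)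
    {F : ProbabilityMeasure (Vel d)} (hF : ExpandsUpTo p q₁ (F : Measure (Vel d)))
    (hfix : smooth (selfSimilarWeights ν (rate ν p)) (F : Measure (Vel d)) F = F) :
    𝓜.Attracts p F := by
  intro f hf hf0 hexp
  obtain ⟨q₀, hq₀, hlt⟩ := h.exists_rate_lt
  obtain ⟨ε, hε, hε'⟩ := (hasExpansion_iff hp _).1 hexp
  set q := min (min q₀ q₁) (p + ε) with hq
  have hpq' : p < q := lt_min (lt_min (by linarith) hpq) (by linarith)
  have hq0 : 0 < q := hp.trans hpq'
  have hrate := rate_lt_rate h.dissipative hq₀ hlt hp hp1 hpq'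
    ((min_le_left _ _).trans (min_le_left _ _))
  have hq' := (rate_lt_iff (ν := ν) hq0).1 hrate
  obtain ⟨C₁, hC₁, h1⟩ := hε' q hpq' (min_le_right _ _)
  obtain ⟨C₂, hC₂, h2⟩ : ExpandsUpTo p q (F : Measure (Vel d)) := by
    obtain ⟨C, hC, hF⟩ := hF
    exact expandsUpTo_of_local hp hpq'.le ((min_le_left _ _).trans (min_le_right _ _)) hC one_pos
      fun k _ => hF k
  -- The midpoint of `q μ(q)` and `q μ(p)`.
  set κ := (weightMoment ν q - ν.real Set.univ + rate ν p * q) / 2 with hκ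
  have hinit : ∀ k, ‖charFun (f 0 : Measure (Vel d)) k -
      charFun (dilate (Real.exp (𝓜.mu d p * 0 / 2)) F : Measure (Vel d)) k‖ ≤
      (C₁ + C₂) * ‖k‖ ^ (2 * q) := by
    intro k
    rw [mul_zero, zero_div, Real.exp_zero, dilate_one, add_mul]
    rw [← sub_sub_sub_cancel_right _ _ (((1 - ‖k‖ ^ (2 * p) : ℝ)) : ℂ)]
    exact (norm_sub_le _ _).trans (add_le_add (h1 k) (h2 k))
  obtain ⟨C', hC', hdist⟩ := (h.isKacSolution hf hf0).norm_sub_le h.dissipative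
    (h.isKacSolution_dilate hp hfix) (add_nonneg hC₁ hC₂) hq0 (κ := κ) (by linarith) hinit
  have hlim : Tendsto (fun t : ℝ => Real.exp ((κ - rate ν p * q) * t)) atTop (𝓝 0) := by
    refine Real.tendsto_exp_atBot.comp ?_
    exact tendsto_id.const_mul_atTop_of_neg (by linarith)
  rw [tendsto_iff_seq_tendsto]
  intro s hs
  refine ProbabilityMeasure.tendsto_iff_tendsto_charFun.2 fun k => ?_
  have hbound : ∀ t : ℝ, 0 ≤ t →
      ‖charFun (dilate (Real.exp (-(𝓜.mu d p * t / 2))) (f t) : Measure (Vel d)) k -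
        charFun (F : Measure (Vel d)) k‖ ≤
        C' * ‖k‖ ^ (2 * q) * Real.exp ((κ - rate ν p * q) * t) := by
    intro t ht
    have h3 := hdist t ht (Real.exp (-(𝓜.mu d p * t / 2)) • k)
    rw [charFun_dilate, smul_smul, ← Real.exp_add, add_neg_cancel, Real.exp_zero, one_smul,
      norm_smul_rpow (Real.exp_pos _).le, ← Real.exp_mul] at h3
    rw [charFun_dilate]
    refine h3.trans (le_of_eq ?_)
    rw [h.mu_eq p hp, sub_mul, sub_eq_add_neg, Real.exp_add,
      show -(rate ν p * t / 2) * (2 * q) = -(rate ν p * q * t) by ring]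
    ring
  have hz : Tendsto (fun n => C' * ‖k‖ ^ (2 * q) * Real.exp ((κ - rate ν p * q) * s n)) atTop
      (𝓝 0) := by
    simpa using (hlim.comp hs).const_mul (C' * ‖k‖ ^ (2 * q))
  rw [tendsto_iff_norm_sub_tendsto_zero]
  refine squeeze_zero' (Eventually.of_forall fun n => norm_nonneg _) ?_ hz
  filter_upwards [hs.eventually_ge_atTop 0] with n hn
  exact hbound (s n) hn

/-- An attracting profile is the limit along any self-similar solution with an expansion, so it
agrees with the profile of that solution. -/
lemma eq_of_attracts {p : ℝ} {F F' : ProbabilityMeasure (Vel d)}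
    (hF : 𝓜.Attracts p F) (hF' : 𝓜.IsSelfSimilarProfile p F') (hiso : IsIsotropic F')
    (hexp : HasExpansion p F') : F' = F := by
  have h := hF _ hF' (by simpa [dilate_one] using hiso) (by simpa [dilate_one] using hexp)
  have hconst : ∀ t : ℝ, dilate (Real.exp (-(𝓜.mu d p * t / 2)))
      (dilate (Real.exp (𝓜.mu d p * t / 2)) F') = F' := fun t =>
    dilate_dilate_of_mul_eq_one (by rw [← Real.exp_add, neg_add_cancel, Real.exp_zero]) F'
  simp only [hconst] at h
  exact tendsto_nhds_unique tendsto_const_nhds h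

/-! #### Moments of the profiles -/

/-- A law with an expansion of exponent `p < 1` has exactly the moments of order less than `2p`. -/
lemma integrable_iff_lt_of_expandsUpTo (hd : 2 ≤ d) {p q₁ : ℝ} (hp : 0 < p) (hp1 : p < 1)
    (hpq : p < q₁) {F : ProbabilityMeasure (Vel d)}
    (hF : ExpandsUpTo p q₁ (F : Measure (Vel d))) {q : ℝ} (hq : 0 < q) :
    Integrable (fun v : Vel d => ‖v‖ ^ (2 * q)) (F : Measure (Vel d)) ↔ q < p := by
  have : Nontrivial (Vel d) := by
    have : Nonempty (Fin d) := ⟨⟨0, by linarith⟩⟩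
    infer_instance
  constructor
  · intro hint
    by_contra hle
    rw [not_lt] at hle
    refine hF.not_integrable hp hp1 hpq ((integrable_norm_rpow_iff _ (by positivity)).2 ?_)
    refine ne_top_of_le_ne_top ?_ (absMoment_le_one_add (s := 2 * q) (by positivity)
      (by linarith))
    exact ENNReal.add_ne_top.2
      ⟨ENNReal.one_ne_top, (integrable_norm_rpow_iff _ (by positivity)).1 hint⟩
  · intro hlt
    obtain ⟨A, hA⟩ := hF.one_sub_re_le hp hpq.le
    exact (integrable_norm_rpow_iff _ (by positivity)).2
      (absMoment_ne_top_of_charFun hA hq hlt (by linarith))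

/-- A law with an expansion is not the point mass at the origin. -/
lemma measure_compl_zero_ne_zero (hd : 2 ≤ d) {q₁ : ℝ} (hq : 1 < q₁)
    {F : ProbabilityMeasure (Vel d)} (hF : ExpandsUpTo 1 q₁ (F : Measure (Vel d))) :
    (F : Measure (Vel d)) {0}ᶜ ≠ 0 := by
  intro h0
  have : Nonempty (Fin d) := ⟨⟨0, by linarith⟩⟩
  obtain ⟨e, he⟩ := exists_norm_eq (Vel d) zero_le_one
  obtain ⟨C, hC, hF⟩ := hF
  have hae : ∀ᵐ v ∂(F : Measure (Vel d)), v = 0 := by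
    rw [ae_iff]; exact h0
  have hone : ∀ k, charFun (F : Measure (Vel d)) k = 1 := fun k => by
    rw [charFun_apply, integral_congr_ae (g := fun _ => (1 : ℂ))]
    · simp
    · filter_upwards [hae] with v hv
      simp [hv]
  have hle : ∀ τ : ℝ, 0 < τ → 1 ≤ C * τ ^ (2 * q₁ - 2) := fun τ hτ => by
    have h := hF (τ • e)
    rw [hone, norm_smul, he, mul_one, Real.norm_of_nonneg hτ.le, mul_one] at h
    have h1 : (1 : ℂ) - ((1 - τ ^ (2 : ℝ) : ℝ) : ℂ) = ((τ ^ (2 : ℝ) : ℝ) : ℂ) := by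
      push_cast; ring
    rw [h1, Complex.norm_real, Real.norm_of_nonneg (by positivity)] at h
    rw [Real.rpow_sub hτ, ← mul_div_assoc, one_le_div (by positivity)]
    exact h
  have hlim : Tendsto (fun τ : ℝ => C * τ ^ (2 * q₁ - 2)) (𝓝[>] 0) (𝓝 0) := by
    have h1 : ContinuousAt (fun τ : ℝ => C * τ ^ (2 * q₁ - 2)) 0 :=
      continuousAt_const.mul (Real.continuousAt_rpow_const _ _ (Or.inr (by linarith)))
    have h2 := h1.tendsto
    rw [Real.zero_rpow (by linarith), mul_zero] at h2
    exact h2.mono_left nhdsWithin_le_nhds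
  exact absurd (ge_of_tendsto hlim (eventually_mem_nhdsWithin.mono fun τ hτ => hle τ hτ))
    (by norm_num)

/-- The profile for `p = 1`, as the limit of the iterates of the Maxwellian, has exactly the moments
of order less than `2r`, where `r > 1` is the second root of `μ(r) = μ(1)`. -/
lemma exists_critical_exponent (h : IsKacForm 𝓜 ν gain) (hd : 2 ≤ d) (hneg : rate ν 1 < 0)
    {F : ProbabilityMeasure (Vel d)} {f : ℕ → ProbabilityMeasure (Vel d)}
    (h0 : (f 0 : Measure (Vel d)) = maxwellian d)
    (hs : ∀ n, (f (n + 1) : Measure (Vel d)) =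
        smooth (selfSimilarWeights ν (rate ν 1)) (f n : Measure (Vel d)) (f n))
    (hlim : Tendsto f atTop (𝓝 F)) (hiso : ∀ n, IsIsotropic (f n)) (hisoF : IsIsotropic F)
    (hfix : smooth (selfSimilarWeights ν (rate ν 1)) (F : Measure (Vel d)) F = F)
    {q₁ : ℝ} (hq₁ : 1 < q₁) (hF : ExpandsUpTo 1 q₁ (F : Measure (Vel d))) :
    ∃ r : ℝ, 1 < r ∧ (∀ q, 0 < q → (rate ν q = rate ν 1 ↔ q = 1 ∨ q = r)) ∧
      ∀ q, 0 < q →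
        (Integrable (fun v : Vel d => ‖v‖ ^ (2 * q)) (F : Measure (Vel d)) ↔ q < r) := by
  have := h.neZero
  have := isProbabilityMeasure_selfSimilarWeights (ν := ν) (rate ν 1)
  obtain ⟨q₀, hq₀, hlt⟩ := h.exists_rate_lt
  obtain ⟨r, hr, hroots, hrlt⟩ := exists_second_root h.dissipative hq₀ hlt hneg
  have hmom : ∀ q, 0 < q → (rate ν q = rate ν 1 → weightMoment ν q =
      ν.real Set.univ + rate ν 1 * q) := fun q hq hqr => by
    have := (rate_eq_iff hq).1 hqr; linarith
  have hpos : ∀ q, 1 ≤ q → q ≤ r → 0 < ν.real Set.univ + rate ν 1 * q := by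
    intro q hq1 hqr
    have hq0 : 0 < q := by linarith
    have hw := h.weightMoment_pos hq0
    rcases hqr.eq_or_lt with rfl | hqr
    · rw [← hmom q hq0 ((hroots q hq0).2 (Or.inr rfl))]; exact hw
    · rcases hq1.eq_or_lt with rfl | hq1
      · rw [← hmom 1 hq0 rfl]; exact hw
      · have := (rate_lt_iff hq0).1 (hrlt q hq1 hqr); linarith
  have hwm : ∀ q, 1 ≤ q → q ≤ r → weightMoment (selfSimilarWeights ν (rate ν 1)) q =
      weightMoment ν q / (ν.real Set.univ + rate ν 1 * q) := fun q hq hqr =>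
    weightMoment_selfSimilarWeights h.dissipative (hpos q hq hqr)
  have hnn := selfSimilarWeights_nonneg (ν := ν) h.dissipative (rate ν 1)
  have hcrit : absMoment (F : Measure (Vel d)) (2 * r) = ∞ := by
    have hr0 : 0 < r := by linarith
    refine absMoment_eq_top_of_critical hnn hr
      (integrable_selfSimilarWeights h.dissipative hr0.le (hpos r hr.le le_rfl)) ?_ ?_ hfix
      (hisoF _) (measure_compl_zero_ne_zero hd hq₁ hF)
    · rw [hwm r hr.le le_rfl, hmom r hr0 ((hroots r hr0).2 (Or.inr rfl)),
        div_self (hpos r hr.le le_rfl).ne']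
    · exact selfSimilarWeights_overlap h.overlap _
  refine ⟨r, hr, hroots, fun q hq => ⟨fun hint => ?_, fun hqr => ?_⟩⟩
  · by_contra hle
    rw [not_lt] at hle
    have h1 := absMoment_le_one_add (f := (F : Measure (Vel d))) (r := 2 * r) (s := 2 * q)
      (by linarith) (by linarith)
    rw [hcrit, top_le_iff] at h1
    exact ENNReal.add_ne_top.2
      ⟨ENNReal.one_ne_top, (integrable_norm_rpow_iff _ (by positivity)).1 hint⟩ h1
  · obtain ⟨C, hC, hb⟩ := exists_absMoment_bound (f := fun n => (f n : Measure (Vel d)))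
      (R := 2 * r) (r := 2 * q) hnn
      (fun s hs hsr => integrable_selfSimilarWeights h.dissipative (by linarith)
        (hpos s hs (by linarith))) (by linarith)
      (by rw [hwm 1 le_rfl hr.le, hmom 1 one_pos rfl, div_self (hpos 1 le_rfl hr.le).ne'])
      (fun s hs hsr => by
        have hs' := hpos s hs.le (by linarith)
        rw [hwm s hs.le (by linarith)]
        refine ⟨div_nonneg (weightMoment_nonneg h.dissipative s) hs'.le, (div_lt_one hs').2 ?_⟩
        have := (rate_lt_iff (by linarith)).1 (hrlt s hs (by linarith))
        linarith)
      hs (fun n => hiso n _) (fun s hs => by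
        rw [h0]
        rcases hs.eq_or_lt with rfl | hs
        · simp [absMoment]
        · exact absMoment_maxwellian_ne_top d hs)
      (by positivity) (by linarith)
    exact (integrable_norm_rpow_iff _ (by positivity)).2
      (ne_top_of_le_ne_top hC (absMoment_le_of_tendsto hlim (by positivity) hb))

lemma selfSimilar_asymptotics (h : IsKacForm 𝓜 ν gain) (hd : 2 ≤ d) :
    (∀ f₀ : ProbabilityMeasure (Vel d), IsIsotropic f₀ →
      ∃ f : ℝ → ProbabilityMeasure (Vel d),
        f 0 = f₀ ∧ 𝓜.IsSolution f ∧ (∀ t : ℝ, 0 ≤ t → IsIsotropic (f t)) ∧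
        ∀ f' : ℝ → ProbabilityMeasure (Vel d), f' 0 = f₀ → 𝓜.IsSolution f' →
          ∀ t : ℝ, 0 ≤ t → f' t = f t) ∧
    (∀ p : ℝ, 0 < p → p ≤ 1 →
      ∃ F : ProbabilityMeasure (Vel d),
        IsIsotropic F ∧ 𝓜.IsSelfSimilarProfile p F ∧ HasExpansion p F ∧ 𝓜.Attracts p F ∧
        (∀ F' : ProbabilityMeasure (Vel d), IsIsotropic F' → 𝓜.IsSelfSimilarProfile p F' →
          (HasExpansion p F' ∨ 𝓜.Attracts p F') → F' = F) ∧
        (p < 1 → ∀ q : ℝ, 0 < q →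
          (Integrable (fun v : Vel d => ‖v‖ ^ (2 * q)) (F : Measure (Vel d)) ↔ q < p)) ∧
        (p = 1 → 𝓜.IsElastic →
          𝓜.mu d 1 = 0 ∧ (F : Measure (Vel d)) = maxwellian d) ∧
        (p = 1 → ¬ 𝓜.IsElastic →
          ∃ pstar : ℝ, 1 < pstar ∧
            (∀ q : ℝ, 0 < q → (𝓜.mu d q = 𝓜.mu d 1 ↔ q = 1 ∨ q = pstar)) ∧
            ∀ q : ℝ, 0 < q →
              (Integrable (fun v : Vel d => ‖v‖ ^ (2 * q)) (F : Measure (Vel d)) ↔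
                q < pstar))) := by
  refine ⟨fun f₀ hf₀ => ?_, fun p hp hp1 => ?_⟩
  · obtain ⟨f, h0, hf, hiso, -⟩ := h.exists_solution f₀ hf₀
    exact ⟨f, h0, hf, fun t _ => hiso t, fun f' h0' hf' t ht =>
      h.solution_unique hf' hf (h0'.trans h0.symm) t ht⟩
  have huniq : ∀ (F : ProbabilityMeasure (Vel d)) (q : ℝ), p < q →
      ExpandsUpTo p q (F : Measure (Vel d)) → IsIsotropic F →
      smooth (selfSimilarWeights ν (rate ν p)) (F : Measure (Vel d)) F = F →
      IsIsotropic F ∧ 𝓜.IsSelfSimilarProfile p F ∧ HasExpansion p F ∧ 𝓜.Attracts p F ∧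
        (∀ F' : ProbabilityMeasure (Vel d), IsIsotropic F' → 𝓜.IsSelfSimilarProfile p F' →
          (HasExpansion p F' ∨ 𝓜.Attracts p F') → F' = F) := by
    intro F q hpq hF hiso hfix
    have hprof := h.isSelfSimilarProfile hp hiso hfix
    have hexp := hasExpansion_of_expandsUpTo hp hpq hF
    have hatt := h.attracts hp hp1 hpq hF hfix
    refine ⟨hiso, hprof, hexp, hatt, fun F' hiso' hprof' h' => ?_⟩
    rcases h' with h' | h'
    · exact eq_of_attracts hatt hprof' hiso' h'
    · exact (eq_of_attracts h' hprof hiso hexp).symm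
  rcases hp1.lt_or_eq with hlt | rfl
  · obtain ⟨f₀, hf₀, hexp⟩ := exists_isotropic_expandsUpTo d hp hlt
    obtain ⟨F, f, -, -, -, -, hiso, hfix, q, hpq, hF⟩ := h.exists_fixedPoint hp hp1 hlt hf₀ hexp
    obtain ⟨h1, h2, h3, h4, h5⟩ := huniq F q hpq hF hiso hfix
    exact ⟨F, h1, h2, h3, h4, h5, fun _ r hr => integrable_iff_lt_of_expandsUpTo hd hp hlt hpq hF hr,
      fun h => absurd h hlt.ne, fun h => absurd h hlt.ne⟩
  · set M : ProbabilityMeasure (Vel d) := ⟨maxwellian d, inferInstance⟩ with hM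
    have hMiso : IsIsotropic M := maxwellian_map_isometry d
    have hMexp : ∀ q, 1 < q → q ≤ 2 → ExpandsUpTo 1 q (M : Measure (Vel d)) :=
      fun q hq hq2 => expandsUpTo_maxwellian d hq.le hq2
    obtain ⟨F, f, h0, hs, hlim, hisof, hiso, hfix, q, hpq, hF⟩ :=
      h.exists_fixedPoint hp hp1 one_lt_two hMiso hMexp
    obtain ⟨h1, h2, h3, h4, h5⟩ := huniq F q hpq hF hiso hfix
    refine ⟨F, h1, h2, h3, h4, h5, fun h => absurd h (lt_irrefl _), fun _ hel => ?_,
      fun _ hel => ?_⟩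
    · have hmu : 𝓜.mu d 1 = 0 := by
        rw [h.mu_eq 1 one_pos, rate_eq_iff one_pos, zero_mul, sub_zero, sub_eq_zero, weightMoment,
          integral_congr_ae (g := fun _ => (1 : ℝ))]
        · simp
        · filter_upwards [h.elastic hel] with x hx
          simpa [Real.rpow_two] using hx
      refine ⟨hmu, ?_⟩
      -- The Maxwellian is a stationary solution with expansion of exponent `1`, and the rescaling
      -- is trivial because `μ(1) = 0`; so it converges to `F` without moving.
      have hconst : IsKacSolution ν fun _ : ℝ => M := by
        intro k t _
        have hz : charFun (smooth ν (M : Measure (Vel d)) (M : Measure (Vel d))) k -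
            (ν.real Set.univ : ℝ) * charFun (M : Measure (Vel d)) k = 0 := by
          rw [charFun_smooth, sub_eq_zero, integral_congr_ae
            (g := fun _ => charFun (M : Measure (Vel d)) k)]
          · rw [integral_const, Complex.real_smul]
          · filter_upwards [h.elastic hel] with x hx
            change charFun (maxwellian d) _ * charFun (maxwellian d) _ = charFun (maxwellian d) _
            rw [charFun_maxwellian, charFun_maxwellian, charFun_maxwellian, ← Complex.ofReal_mul,
              ← Real.exp_add, norm_smul, norm_smul, mul_pow, mul_pow, Real.norm_eq_abs,
              Real.norm_eq_abs, sq_abs, sq_abs]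
            congr 2
            linear_combination (-‖k‖ ^ 2) * hx
        rw [hz]
        exact hasDerivWithinAt_const _ _ _
      have hMF := h4 _ (h.isSolution_of_isKacSolution hconst hMiso) hMiso
        (hasExpansion_of_expandsUpTo one_pos one_lt_two (hMexp 2 one_lt_two le_rfl))
      simp only [hmu, zero_mul, zero_div, neg_zero, Real.exp_zero, dilate_one] at hMF
      rw [← tendsto_nhds_unique tendsto_const_nhds hMF]
      rfl
    · obtain ⟨r, hr, hroots, hmom⟩ := h.exists_critical_exponent hd (h.not_elastic hel)
        (by rw [h0]; rfl) hs hlim hisof hiso hfix hpq hF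
      refine ⟨r, hr, fun q hq => ?_, hmom⟩
      rw [h.mu_eq q hq, h.mu_eq 1 one_pos]
      exact hroots q hq

end IsKacForm

end

/-! ### The surface measure of the sphere -/

section

open scoped Pointwise

section Polar

variable {E : Type*} [NormedAddCommGroup E] [NormedSpace ℝ E] [FiniteDimensional ℝ E]
  [Nontrivial E] [MeasurableSpace E] [BorelSpace E]

/-- Integration in polar coordinates. -/
lemma lintegral_polar (μ : Measure E) [μ.IsAddHaarMeasure] {Φ : E → ℝ≥0∞} (hΦ : Measurable Φ) :
    ∫⁻ x, Φ x ∂μ = ∫⁻ ω : Metric.sphere (0 : E) 1, (∫⁻ r in Set.Ioi (0 : ℝ),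
      ENNReal.ofReal (r ^ (Module.finrank ℝ E - 1)) * Φ (r • (ω : E))) ∂μ.toSphere := by
  have hmp := μ.measurePreserving_homeomorphUnitSphereProd
  have h1 : ∫⁻ x, Φ x ∂μ = ∫⁻ x : ({(0)}ᶜ : Set E), Φ x ∂(μ.comap (↑)) := by
    rw [lintegral_subtype_comap (measurableSet_singleton _).compl, restrict_compl_singleton]
  have h2 : ∀ x : ({(0)}ᶜ : Set E), Φ x = (fun y : Metric.sphere (0 : E) 1 × Set.Ioi (0 : ℝ) =>
      Φ ((y.2 : ℝ) • (y.1 : E))) (homeomorphUnitSphereProd E x) := fun x => by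
    have hx : ‖(x : E)‖ ≠ 0 := norm_ne_zero_iff.2 x.2
    simp [smul_smul, hx]
  have hm : Measurable fun y : Metric.sphere (0 : E) 1 × Set.Ioi (0 : ℝ) =>
      Φ ((y.2 : ℝ) • (y.1 : E)) := hΦ.comp (by fun_prop)
  rw [h1]
  simp_rw [h2]
  rw [hmp.lintegral_comp hm, lintegral_prod _ hm.aemeasurable]
  refine lintegral_congr fun ω => ?_
  have hm' : Measurable fun r : Set.Ioi (0 : ℝ) => Φ ((r : ℝ) • (ω : E)) := hΦ.comp (by fun_prop)
  rw [Measure.volumeIoiPow, lintegral_withDensity_eq_lintegral_mul _ (by fun_prop) hm']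
  simp only [Pi.mul_apply]
  exact lintegral_subtype_comap measurableSet_Ioi
    (fun r => ENNReal.ofReal (r ^ (Module.finrank ℝ E - 1)) * Φ (r • (ω : E)))

lemma setLIntegral_pow_mul_indicator (n : ℕ) {a : ℝ} (ha : 0 < a) :
    ∫⁻ r in Set.Ioi (0 : ℝ), ENNReal.ofReal (r ^ n) * (if r * a < 1 then 1 else 0) =
      ENNReal.ofReal (a⁻¹ ^ (n + 1) / (n + 1)) := by
  have hset : {r : Set.Ioi (0 : ℝ) | (r : ℝ) * a < 1} = Set.Iio ⟨a⁻¹, inv_pos.2 ha⟩ := by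
    ext r
    simp only [Set.mem_ofPred_eq, Set.mem_Iio, ← Subtype.coe_lt_coe]
    rw [lt_inv_comm₀ r.2 ha, ← one_div, lt_div_iff₀ r.2, mul_comm]
  have h := Measure.volumeIoiPow_apply_Iio n ⟨a⁻¹, inv_pos.2 ha⟩
  rw [← hset, Measure.volumeIoiPow, withDensity_apply _ (hset ▸ measurableSet_Iio),
    ← lintegral_indicator (hset ▸ measurableSet_Iio)] at h
  rw [← h, ← lintegral_subtype_comap measurableSet_Ioi]
  refine lintegral_congr fun r => ?_
  simp only [Set.indicator_apply, Set.mem_ofPred_eq]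
  split_ifs <;> simp

end Polar

section Slice

variable {n : ℕ}

/-- The splitting `x = (x₀, y)` of space into the first coordinate and the others. -/
lemma measurePreserving_split (n : ℕ) : ∃ e : Vel (n + 1) ≃ᵐ ℝ × Vel n,
    MeasurePreserving e ∧ (∀ x, (e x).1 = x 0) ∧ ∀ x, ‖x‖ ^ 2 = (e x).1 ^ 2 + ‖(e x).2‖ ^ 2 := by
  have e1 := (PiLp.volume_preserving_ofLp (Fin (n + 1)))
  have e2 := volume_preserving_piFinSuccAbove (fun _ : Fin (n + 1) => ℝ) 0
  have e3 := (MeasurePreserving.id (volume : Measure ℝ)).prod (PiLp.volume_preserving_toLp (Fin n))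
  refine ⟨((MeasurableEquiv.toLp 2 (Fin (n + 1) → ℝ)).symm.trans
    (MeasurableEquiv.piFinSuccAbove (fun _ : Fin (n + 1) => ℝ) 0)).trans
    ((MeasurableEquiv.refl ℝ).prodCongr (MeasurableEquiv.toLp 2 (Fin n → ℝ))),
    (e3.comp (e2.comp e1)), fun x => rfl, fun x => ?_⟩
  rw [EuclideanSpace.norm_sq_eq, EuclideanSpace.norm_sq_eq, Fin.sum_univ_succ,
    Real.norm_eq_abs, sq_abs]
  rfl

/-- The image of the line under `t ↦ t / √(1 + t²)`. -/
lemma lintegral_comp_div_sqrt (n : ℕ) (F : ℝ → ℝ≥0∞) :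
    ∫⁻ t : ℝ, F (t / √(1 + t ^ 2)) * ENNReal.ofReal ((√(1 + t ^ 2))⁻¹ ^ (n + 1)) =
      ∫⁻ z in Set.Ioo (-1 : ℝ) 1,
        ENNReal.ofReal ((1 - z ^ 2) ^ (((n + 1 : ℕ) - 3 : ℝ) / 2)) * F z := by
  -- `φ` is the inverse of `t ↦ t / √(1 + t²)`.
  set φ : ℝ → ℝ := fun z => z / √(1 - z ^ 2) with hφ
  have hpos : ∀ z ∈ Set.Ioo (-1 : ℝ) 1, 0 < 1 - z ^ 2 := fun z hz => by
    nlinarith [hz.1, hz.2]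
  have hinv : ∀ z ∈ Set.Ioo (-1 : ℝ) 1, √(1 + φ z ^ 2) = (√(1 - z ^ 2))⁻¹ := fun z hz => by
    have h := hpos z hz
    rw [hφ, ← Real.sqrt_inv]
    congr 1
    simp only [div_pow, Real.sq_sqrt h.le]
    field_simp
    ring
  have hleft : ∀ z ∈ Set.Ioo (-1 : ℝ) 1, φ z / √(1 + φ z ^ 2) = z := fun z hz => by
    rw [hinv z hz]
    have := (Real.sqrt_pos.2 (hpos z hz)).ne'
    simp only [hφ]
    field_simp
  have hinj : Set.InjOn φ (Set.Ioo (-1 : ℝ) 1) := fun x hx y hy hxy => by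
    rw [← hleft x hx, hxy, hleft y hy]
  have himg : φ '' Set.Ioo (-1 : ℝ) 1 = Set.univ := by
    refine Set.eq_univ_of_forall fun t => ?_
    have h1 : 0 < 1 + t ^ 2 := by positivity
    have hs : 0 < √(1 + t ^ 2) := Real.sqrt_pos.2 h1
    have hlt : |t| < √(1 + t ^ 2) := by
      rw [← Real.sqrt_sq_eq_abs]
      exact Real.sqrt_lt_sqrt (sq_nonneg _) (by linarith)
    refine ⟨t / √(1 + t ^ 2), abs_lt.1 (by rwa [abs_div, abs_of_pos hs, div_lt_one hs]), ?_⟩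
    have h2 : 1 - (t / √(1 + t ^ 2)) ^ 2 = (1 + t ^ 2)⁻¹ := by
      rw [div_pow, Real.sq_sqrt h1.le]; field_simp; ring
    simp only [hφ]
    rw [h2, Real.sqrt_inv]
    field_simp
  have hder : ∀ z ∈ Set.Ioo (-1 : ℝ) 1,
      HasDerivWithinAt φ ((1 - z ^ 2) ^ (-(3 / 2) : ℝ)) (Set.Ioo (-1) 1) z := fun z hz => by
    have h := hpos z hz
    have hs := Real.sqrt_pos.2 h
    have h1 : HasDerivAt (fun z : ℝ => 1 - z ^ 2) (-(2 * z)) z := by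
      simpa using (hasDerivAt_pow 2 z).const_sub 1
    have h2 := (hasDerivAt_id z).div (h1.sqrt h.ne') hs.ne'
    refine (h2.congr_deriv ?_).hasDerivWithinAt
    have h3 : (1 - z ^ 2) ^ (-(3 / 2) : ℝ) = (√(1 - z ^ 2) ^ 3)⁻¹ := by
      rw [Real.rpow_neg h.le, Real.sqrt_eq_rpow, ← Real.rpow_natCast _ 3, ← Real.rpow_mul h.le]
      norm_num
    have h4 := Real.sq_sqrt h.le
    rw [h3]
    simp only [id]
    field_simp
    rw [h4]; ring
  have h := lintegral_image_eq_lintegral_abs_deriv_mul measurableSet_Ioo hder hinj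
    (fun t => F (t / √(1 + t ^ 2)) * ENNReal.ofReal ((√(1 + t ^ 2))⁻¹ ^ (n + 1)))
  rw [himg, setLIntegral_univ] at h
  rw [h]
  refine setLIntegral_congr_fun measurableSet_Ioo fun z hz => ?_
  have hz0 := hpos z hz
  rw [hleft z hz, hinv z hz, inv_inv, mul_comm (F z), ← mul_assoc,
    abs_of_pos (Real.rpow_pos_of_pos hz0 _), ← ENNReal.ofReal_mul (Real.rpow_pos_of_pos hz0 _).le,
    Real.sqrt_eq_rpow, ← Real.rpow_natCast _ (n + 1), ← Real.rpow_mul hz0.le, ← Real.rpow_add hz0]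
  congr 3
  push_cast
  ring

/-- Slicing the sphere: the first coordinate has density `|S^{d-2}| (1 - z²)^{(d-3)/2}`. The
function `1_{‖x‖<1} F(x₀/‖x‖)` is integrated in polar coordinates and in cylindrical ones. -/
lemma lintegral_surface_coord (hn : 1 ≤ n) {F : ℝ → ℝ≥0∞} (hF : Measurable F) :
    ∫⁻ ω : UnitSphere (n + 1), F ((ω : Vel (n + 1)) 0) ∂(surface (n + 1)) =
      ∫⁻ z in Set.Ioo (-1 : ℝ) 1, ENNReal.ofReal
        (areaSphere (n + 1) * (1 - z ^ 2) ^ (((n + 1 : ℕ) - 3 : ℝ) / 2)) * F z := by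
  have : Nonempty (Fin n) := ⟨⟨0, hn⟩⟩
  have hn1 : ((n : ℝ) + 1) ≠ 0 := by positivity
  set Ψ : ℝ → ℝ → ℝ≥0∞ := fun x r => (if r < 1 then 1 else 0) * F (x / r) with hΨ
  have hΨm : Measurable fun y : ℝ × ℝ => Ψ y.1 y.2 := by
    refine Measurable.mul ?_ (hF.comp (by fun_prop))
    exact Measurable.ite (measurableSet_lt measurable_snd measurable_const)
      measurable_const measurable_const
  have hpolar : ∫⁻ x : Vel (n + 1), Ψ (x 0) ‖x‖ =
      ENNReal.ofReal (1 / (n + 1)) * ∫⁻ ω : UnitSphere (n + 1), F ((ω : Vel (n + 1)) 0)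
        ∂(surface (n + 1)) := by
    have hm : Measurable fun x : Vel (n + 1) => Ψ (x 0) ‖x‖ :=
      hΨm.comp (by fun_prop : Measurable fun x : Vel (n + 1) => (x 0, ‖x‖))
    have hmF : Measurable fun ω : UnitSphere (n + 1) => F ((ω : Vel (n + 1)) 0) :=
      hF.comp (by fun_prop)
    rw [lintegral_polar volume hm, ← lintegral_const_mul _ hmF]
    refine lintegral_congr fun ω => ?_
    have h := setLIntegral_pow_mul_indicator n one_pos
    rw [inv_one, one_pow] at h
    rw [← h, ← lintegral_mul_const _ (by
      refine Measurable.mul (by fun_prop) (Measurable.ite ?_ measurable_const measurable_const)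
      exact measurableSet_lt (by fun_prop) measurable_const)]
    refine setLIntegral_congr_fun measurableSet_Ioi fun r hr => ?_
    have hr0 : (0 : ℝ) < r := hr
    have hω : ‖(ω : Vel (n + 1))‖ = 1 := norm_eq_of_mem_sphere ω
    simp only [hΨ, norm_smul, hω, mul_one, Real.norm_of_nonneg hr0.le, PiLp.smul_apply, smul_eq_mul,
      finrank_euclideanSpace, Fintype.card_fin, Nat.add_sub_cancel]
    rw [mul_div_cancel_left₀ _ hr0.ne', mul_assoc]
  -- Cylindrical coordinates `x = (x₀, y)` with `ρ = ‖y‖` and `x₀ = ρ t`; the condition `‖x‖ < 1`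
  -- becomes `ρ √(1 + t²) < 1`.
  have hcyl : ∫⁻ x : Vel (n + 1), Ψ (x 0) ‖x‖ = surface n Set.univ *
      (ENNReal.ofReal (1 / (n + 1)) *
        ∫⁻ t : ℝ, F (t / √(1 + t ^ 2)) * ENNReal.ofReal ((√(1 + t ^ 2))⁻¹ ^ (n + 1))) := by
    obtain ⟨e, he, he1, he2⟩ := measurePreserving_split n
    have hm2 : Measurable fun y : ℝ × ℝ => Ψ y.1 √(y.1 ^ 2 + y.2 ^ 2) :=
      hΨm.comp (by fun_prop : Measurable fun y : ℝ × ℝ => (y.1, √(y.1 ^ 2 + y.2 ^ 2)))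
    have hm1 : Measurable fun y : ℝ × Vel n => Ψ y.1 √(y.1 ^ 2 + ‖y.2‖ ^ 2) :=
      hΨm.comp (by fun_prop : Measurable fun y : ℝ × Vel n => (y.1, √(y.1 ^ 2 + ‖y.2‖ ^ 2)))
    have h1 : ∫⁻ x : Vel (n + 1), Ψ (x 0) ‖x‖ =
        ∫⁻ x : ℝ, ∫⁻ y : Vel n, Ψ x √(x ^ 2 + ‖y‖ ^ 2) := by
      rw [← lintegral_prod (fun y : ℝ × Vel n => Ψ y.1 √(y.1 ^ 2 + ‖y.2‖ ^ 2)) hm1.aemeasurable]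
      refine Eq.trans ?_ (he.lintegral_comp hm1)
      refine lintegral_congr fun x => ?_
      rw [← he2, Real.sqrt_sq (norm_nonneg _), he1]
    have h2 : ∀ x : ℝ, ∫⁻ y : Vel n, Ψ x √(x ^ 2 + ‖y‖ ^ 2) = surface n Set.univ *
        ∫⁻ ρ in Set.Ioi (0 : ℝ), ENNReal.ofReal (ρ ^ (n - 1)) * Ψ x √(x ^ 2 + ρ ^ 2) := by
      intro x
      have hm : Measurable fun y : Vel n => Ψ x √(x ^ 2 + ‖y‖ ^ 2) :=
        hΨm.comp (by fun_prop : Measurable fun y : Vel n => (x, √(x ^ 2 + ‖y‖ ^ 2)))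
      rw [lintegral_polar volume hm, surface, mul_comm, ← lintegral_const]
      refine lintegral_congr fun ω => setLIntegral_congr_fun measurableSet_Ioi fun ρ hρ => ?_
      have hω : ‖(ω : Vel n)‖ = 1 := norm_eq_of_mem_sphere ω
      simp only [norm_smul, hω, mul_one, Real.norm_eq_abs, sq_abs, finrank_euclideanSpace,
        Fintype.card_fin]
    have h3 : ∀ ρ ∈ Set.Ioi (0 : ℝ), ∫⁻ x : ℝ, ENNReal.ofReal (ρ ^ (n - 1)) *
        Ψ x √(x ^ 2 + ρ ^ 2) = ∫⁻ t : ℝ, ENNReal.ofReal (ρ ^ n) *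
          ((if ρ * √(1 + t ^ 2) < 1 then 1 else 0) * F (t / √(1 + t ^ 2))) := by
      intro ρ hρ
      have hρ0 : (0 : ℝ) < ρ := hρ
      have hmx : Measurable fun x : ℝ => ENNReal.ofReal (ρ ^ (n - 1)) * Ψ x √(x ^ 2 + ρ ^ 2) :=
        (hΨm.comp (by fun_prop : Measurable fun x : ℝ => (x, √(x ^ 2 + ρ ^ 2)))).const_mul _
      have hmap := Real.smul_map_volume_mul_left hρ0.ne'
      have hmx' := hmx.comp (by fun_prop : Measurable fun t : ℝ => ρ * t)
      conv_lhs => rw [← hmap]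
      rw [lintegral_smul_measure, lintegral_map hmx (by fun_prop), smul_eq_mul, abs_of_pos hρ0]
      refine (lintegral_const_mul _ hmx').symm.trans ?_
      refine lintegral_congr fun t => ?_
      have hsq : √((ρ * t) ^ 2 + ρ ^ 2) = ρ * √(1 + t ^ 2) := by
        rw [show (ρ * t) ^ 2 + ρ ^ 2 = ρ ^ 2 * (1 + t ^ 2) by ring,
          Real.sqrt_mul (sq_nonneg _), Real.sqrt_sq hρ0.le]
      simp only [Function.comp_apply, hΨ, hsq]
      rw [mul_div_mul_left _ _ hρ0.ne', ← mul_assoc, ← ENNReal.ofReal_mul hρ0.le, ← pow_succ',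
        Nat.sub_add_cancel hn]
    rw [h1]
    simp_rw [h2]
    rw [lintegral_const_mul _ (Measurable.lintegral_prod_right' (f := fun y : ℝ × ℝ =>
      ENNReal.ofReal (y.2 ^ (n - 1)) * Ψ y.1 √(y.1 ^ 2 + y.2 ^ 2))
      (Measurable.mul (by fun_prop) hm2))]
    congr 1
    rw [lintegral_lintegral_swap (Measurable.mul (by fun_prop) hm2).aemeasurable,
      setLIntegral_congr_fun measurableSet_Ioi h3, lintegral_lintegral_swap]
    · have hmt : Measurable fun t : ℝ =>
          F (t / √(1 + t ^ 2)) * ENNReal.ofReal ((√(1 + t ^ 2))⁻¹ ^ (n + 1)) :=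
        (hF.comp (by fun_prop : Measurable fun t : ℝ => t / √(1 + t ^ 2))).mul (by fun_prop)
      rw [← lintegral_const_mul _ hmt]
      refine lintegral_congr fun t => ?_
      have ha : 0 < √(1 + t ^ 2) := Real.sqrt_pos.2 (by positivity)
      simp_rw [← mul_assoc]
      rw [lintegral_mul_const _ (by
        refine Measurable.mul (by fun_prop) (Measurable.ite ?_ measurable_const measurable_const)
        exact measurableSet_lt (by fun_prop) measurable_const), setLIntegral_pow_mul_indicator n ha,
        div_eq_mul_one_div, mul_comm _ (1 / ((n : ℝ) + 1)), ENNReal.ofReal_mul (by positivity)]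
      ring
    · refine (Measurable.mul (by fun_prop) (Measurable.mul
        (Measurable.ite ?_ measurable_const measurable_const)
        (hF.comp (by fun_prop : Measurable fun y : ℝ × ℝ => y.2 / √(1 + y.2 ^ 2))))).aemeasurable
      exact measurableSet_lt (by fun_prop) measurable_const
  have hc0 : ENNReal.ofReal (1 / ((n : ℝ) + 1)) ≠ 0 := by
    rw [Ne, ENNReal.ofReal_eq_zero, not_le]; positivity
  rw [hpolar, mul_left_comm] at hcyl
  rw [(ENNReal.mul_right_inj hc0 ENNReal.ofReal_ne_top).1 hcyl, lintegral_comp_div_sqrt,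
    ← lintegral_const_mul' _ _ (by
      have : IsFiniteMeasure (surface n) := by unfold surface; infer_instance
      exact measure_ne_top _ _)]
  refine setLIntegral_congr_fun measurableSet_Ioo fun z hz => ?_
  have hfin : IsFiniteMeasure (surface n) := by unfold surface; infer_instance
  have harea : areaSphere (n + 1) = (surface n).real Set.univ := rfl
  simp only [harea]
  rw [ENNReal.ofReal_mul measureReal_nonneg, ofReal_measureReal, mul_assoc]

end Slice

section Isometry

variable {d : ℕ}

instance isFiniteMeasure_surface (d : ℕ) : IsFiniteMeasure (surface d) := by
  unfold surface; infer_instance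

/-- A linear isometry acting on the sphere. -/
def sphereMap (R : Vel d ≃ₗᵢ[ℝ] Vel d) (ω : UnitSphere d) : UnitSphere d :=
  ⟨R ω, by simp⟩

lemma continuous_sphereMap (R : Vel d ≃ₗᵢ[ℝ] Vel d) : Continuous (sphereMap R) :=
  (R.continuous.comp continuous_subtype_val).subtype_mk _

lemma surface_map_isometry (R : Vel d ≃ₗᵢ[ℝ] Vel d) :
    (surface d).map (sphereMap R) = surface d := by
  ext s hs
  have hm := (continuous_sphereMap R).measurable
  rw [Measure.map_apply hm hs, surface, Measure.toSphere_apply' _ (hm hs),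
    Measure.toSphere_apply' _ hs]
  congr 1
  have hset : Set.Ioo (0 : ℝ) 1 • ((↑) '' (sphereMap R ⁻¹' s) : Set (Vel d)) =
      R ⁻¹' (Set.Ioo (0 : ℝ) 1 • ((↑) '' s : Set (Vel d))) := by
    ext x
    constructor
    · rintro ⟨r, hr, _, ⟨ω, hω, rfl⟩, rfl⟩
      exact ⟨r, hr, _, ⟨_, hω, rfl⟩, by simp [sphereMap]⟩
    · rintro ⟨r, hr, _, ⟨ω, hω, rfl⟩, h⟩
      refine ⟨r, hr, _, ⟨sphereMap R.symm ω, ?_, rfl⟩, ?_⟩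
      · have : sphereMap R (sphereMap R.symm ω) = ω := Subtype.ext (by simp [sphereMap])
        simpa [this] using hω
      · apply R.injective
        simpa [sphereMap] using h
  rw [hset]
  exact R.measurePreserving.measure_preimage_equiv (f := R.toMeasurableEquiv) _

/-- Two vectors of equal length are exchanged by a linear isometry. -/
lemma exists_isometry_swap {x y : Vel d} (h : ‖x‖ = ‖y‖) :
    ∃ R : Vel d ≃ₗᵢ[ℝ] Vel d, R x = y ∧ R y = x ∧ ∀ v w, ⟪v, R w⟫ = ⟪R v, w⟫ := by
  set R := (ℝ ∙ (x - y))ᗮ.reflection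
  have hxy : R x = y := Submodule.reflection_sub h
  have hinv : ∀ v, R (R v) = v := Submodule.reflection_reflection _
  refine ⟨R, hxy, by rw [← hxy, hinv], fun v w => ?_⟩
  rw [← R.inner_map_map v (R w), hinv]

lemma integral_surface_isometry {F : Type*} [NormedAddCommGroup F] [NormedSpace ℝ F]
    (R : Vel d ≃ₗᵢ[ℝ] Vel d) {H : UnitSphere d → F}
    (hH : AEStronglyMeasurable H (surface d)) :
    ∫ ω, H (sphereMap R ω) ∂(surface d) = ∫ ω, H ω ∂(surface d) := by
  conv_rhs => rw [← surface_map_isometry R]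
  rw [integral_map (continuous_sphereMap R).measurable.aemeasurable]
  rwa [surface_map_isometry]

/-- The law of `⟨e, ω⟩` for a unit vector `e`; it has the density
`|S^{d-2}| (1 - z²)^{(d-3)/2}` on `(-1, 1)`. -/
def cosineLaw (d : ℕ) : Measure ℝ :=
  (volume.restrict (Set.Ioo (-1 : ℝ) 1)).withDensity fun z =>
    ENNReal.ofReal (areaSphere d * (1 - z ^ 2) ^ (((d : ℝ) - 3) / 2))

lemma measurable_inner_sphere (e : Vel d) : Measurable fun ω : UnitSphere d => ⟪e, (ω : Vel d)⟫ :=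
  Continuous.measurable (by fun_prop)

/-- By invariance under isometries it is enough to consider a coordinate axis. -/
lemma surface_map_inner (hd : 2 ≤ d) {e : Vel d} (he : ‖e‖ = 1) :
    (surface d).map (fun ω : UnitSphere d => ⟪e, (ω : Vel d)⟫) = cosineLaw d := by
  obtain ⟨n, rfl⟩ : ∃ n, d = n + 1 := ⟨d - 1, by omega⟩
  set e₀ : Vel (n + 1) := EuclideanSpace.single 0 1 with he₀
  obtain ⟨R, hR, -, hsymm⟩ := exists_isometry_swap (d := n + 1) (x := e₀) (y := e)
    (by rw [he, he₀]; simp)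
  have hfun : (fun ω : UnitSphere (n + 1) => ⟪e, (ω : Vel (n + 1))⟫) =
      (fun ω : UnitSphere (n + 1) => (ω : Vel (n + 1)) 0) ∘ sphereMap R := by
    funext ω
    rw [← hR, ← hsymm]
    simp [sphereMap, he₀, EuclideanSpace.inner_single_left]
  have hm0 : Measurable fun ω : UnitSphere (n + 1) => (ω : Vel (n + 1)) 0 := by fun_prop
  rw [hfun, ← Measure.map_map hm0 (continuous_sphereMap R).measurable, surface_map_isometry]
  have hdens : Measurable fun z : ℝ => ENNReal.ofReal
      (areaSphere (n + 1) * (1 - z ^ 2) ^ ((((n + 1 : ℕ) : ℝ) - 3) / 2)) := by fun_prop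
  refine Measure.ext_of_lintegral _ fun F hF => ?_
  rw [lintegral_map hF hm0, lintegral_surface_coord (by omega) hF, cosineLaw,
    lintegral_withDensity_eq_lintegral_mul _ hdens hF]
  rfl

end Isometry

end

/-! ### Collision rules and Bobylev's identity -/

section

section Direction

variable {d : ℕ}

/-- The direction of `u`; the direction of `0` is `e` by convention. -/
def dir (e u : Vel d) : Vel d := if u = 0 then e else ‖u‖⁻¹ • u

lemma norm_dir {e : Vel d} (he : ‖e‖ = 1) (u : Vel d) : ‖dir e u‖ = 1 := by
  unfold dir
  split_ifs with h
  · exact he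
  · rw [norm_smul, norm_inv, norm_norm, inv_mul_cancel₀ (norm_ne_zero_iff.2 h)]

lemma eq_norm_smul_dir (e u : Vel d) : u = ‖u‖ • dir e u := by
  unfold dir
  split_ifs with h
  · simp [h]
  · rw [smul_smul, mul_inv_cancel₀ (norm_ne_zero_iff.2 h), one_smul]

lemma measurable_dir (e : Vel d) : Measurable (dir e) :=
  Measurable.ite (measurableSet_singleton _) measurable_const (by fun_prop)

lemma inner_dir_of_ne {u : Vel d} (e : Vel d) (hu : u ≠ 0) (ω : Vel d) :
    ⟪dir e u, ω⟫ = ⟪u, ω⟫ / ‖u‖ := by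
  rw [dir, if_neg hu, real_inner_smul_left, inv_mul_eq_div]

end Direction

/-- A collision law `(v, w, ω) ↦ v'` together with its Fourier dual: the phase `⟨v', k⟩` and the
phase `⟨v, k₁⟩ + ⟨w, k₂⟩` are exchanged when the directions of `v - w` and of `k` are. The lengths
of `k₁` and `k₂` relative to `k` depend only on the angle between `k` and `ω`. -/
structure CollisionRule (d : ℕ) where
  /-- the velocity after the collision -/
  post : Vel d → Vel d → Vel d → Vel d
  continuous_post : Continuous fun x : (Vel d × Vel d) × Vel d => post x.1.1 x.1.2 x.2
  post_self : ∀ v ω, post v v ω = v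
  /-- the frequency at which the law of `v` is evaluated -/
  k₁ : Vel d → Vel d → Vel d
  /-- the frequency at which the law of `w` is evaluated -/
  k₂ : Vel d → Vel d → Vel d
  continuous_k₁ : ∀ k, Continuous (k₁ k)
  continuous_k₂ : ∀ k, Continuous (k₂ k)
  /-- the ratio `‖k₁‖ / ‖k‖` -/
  a : ℝ → ℝ
  /-- the ratio `‖k₂‖ / ‖k‖` -/
  b : ℝ → ℝ
  measurable_a : Measurable a
  measurable_b : Measurable b
  a_nonneg : ∀ z, 0 ≤ a z
  b_nonneg : ∀ z, 0 ≤ b z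
  norm_k₁ : ∀ k e ω, ‖e‖ = 1 → ‖ω‖ = 1 → k = ‖k‖ • e → ‖k₁ k ω‖ = a ⟪e, ω⟫ * ‖k‖
  norm_k₂ : ∀ k e ω, ‖e‖ = 1 → ‖ω‖ = 1 → k = ‖k‖ • e → ‖k₂ k ω‖ = b ⟪e, ω⟫ * ‖k‖
  duality : ∀ v w k e e', v - w = ‖v - w‖ • e → k = ‖k‖ • e' → ∃ Φ : ℝ → ℝ → ℝ, ∀ ω,
    ⟪post v w ω, k⟫ = Φ ⟪e, ω⟫ ⟪e', ω⟫ ∧ ⟪v, k₁ k ω⟫ + ⟪w, k₂ k ω⟫ = Φ ⟪e', ω⟫ ⟪e, ω⟫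

/-- Collisions with a particle of mass `m`; elastic collisions of equal particles are the case
`m = 1`. -/
def thermostatRule (d : ℕ) {m : ℝ} (hm : 0 < m) : CollisionRule d where
  post v w ω := (1 + m)⁻¹ • (v + m • (w + ‖v - w‖ • ω))
  continuous_post := by fun_prop
  post_self v ω := by
    have : (1 + m) ≠ 0 := by positivity
    rw [sub_self, norm_zero, zero_smul, add_zero]
    nth_rewrite 1 [← one_smul ℝ v]
    rw [← add_smul, smul_smul, inv_mul_cancel₀ this, one_smul]
  k₁ k ω := (1 + m)⁻¹ • (k + (m * ‖k‖) • ω)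
  k₂ k ω := (1 + m)⁻¹ • (m • (k - ‖k‖ • ω))
  continuous_k₁ k := by fun_prop
  continuous_k₂ k := by fun_prop
  a z := √((1 + m ^ 2 + 2 * m * z) / (1 + m) ^ 2)
  b z := √(2 * m ^ 2 * (1 - z) / (1 + m) ^ 2)
  measurable_a := by fun_prop
  measurable_b := by fun_prop
  a_nonneg z := Real.sqrt_nonneg _
  b_nonneg z := Real.sqrt_nonneg _
  norm_k₁ k e ω he hω hk := by
    have hm0 : (1 + m) ≠ 0 := by positivity
    have h : ‖(1 + m)⁻¹ • (k + (m * ‖k‖) • ω)‖ ^ 2 =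
        (1 + m ^ 2 + 2 * m * ⟪e, ω⟫) / (1 + m) ^ 2 * ‖k‖ ^ 2 := by
      have hin : ⟪k, ω⟫ = ‖k‖ * ⟪e, ω⟫ := by
        conv_lhs => rw [hk]
        rw [real_inner_smul_left]
      rw [norm_smul, mul_pow, norm_add_sq_real, norm_smul, hω, real_inner_smul_right, hin,
        Real.norm_eq_abs, Real.norm_eq_abs, sq_abs, mul_one, sq_abs]
      field_simp
      ring
    rw [← Real.sqrt_sq (norm_nonneg _), h, Real.sqrt_mul', Real.sqrt_sq (norm_nonneg _)]
    positivity
  norm_k₂ k e ω he hω hk := by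
    have hm0 : (1 + m) ≠ 0 := by positivity
    have h : ‖(1 + m)⁻¹ • (m • (k - ‖k‖ • ω))‖ ^ 2 =
        2 * m ^ 2 * (1 - ⟪e, ω⟫) / (1 + m) ^ 2 * ‖k‖ ^ 2 := by
      have hin : ⟪k, ω⟫ = ‖k‖ * ⟪e, ω⟫ := by
        conv_lhs => rw [hk]
        rw [real_inner_smul_left]
      rw [norm_smul, norm_smul, mul_pow, mul_pow, norm_sub_sq_real, norm_smul, hω,
        real_inner_smul_right, hin, Real.norm_eq_abs, Real.norm_eq_abs, sq_abs, sq_abs, mul_one,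
        norm_norm]
      field_simp
      ring
    rw [← Real.sqrt_sq (norm_nonneg _), h, Real.sqrt_mul', Real.sqrt_sq (norm_nonneg _)]
    positivity
  duality v w k e e' hu hk := by
    refine ⟨fun _ y => (1 + m)⁻¹ * (⟪v, k⟫ + m * ⟪w, k⟫ + m * ‖v - w‖ * ‖k‖ * y), fun ω => ?_⟩
    have h1 : ⟪ω, k⟫ = ‖k‖ * ⟪e', ω⟫ := by
      conv_lhs => rw [hk]
      rw [real_inner_smul_right, real_inner_comm]
    have h2 : ⟪v, ω⟫ - ⟪w, ω⟫ = ‖v - w‖ * ⟪e, ω⟫ := by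
      rw [← inner_sub_left]
      conv_lhs => rw [hu]
      rw [real_inner_smul_left]
    constructor
    · simp only [real_inner_smul_left, inner_add_left, h1]
      ring
    · simp only [real_inner_smul_right, inner_add_right, inner_sub_right]
      linear_combination (1 + m)⁻¹ * m * ‖k‖ * h2

/-- Inelastic collisions, `v' = v - c ⟨v - w, ω⟩ ω`. -/
def inelasticRule (d : ℕ) {c : ℝ} (hc : 0 ≤ c) : CollisionRule d where
  post v w ω := v - (c * ⟪v - w, ω⟫) • ω
  continuous_post := by fun_prop
  post_self v ω := by simp
  k₁ k ω := k - (c * ⟪k, ω⟫) • ω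
  k₂ k ω := (c * ⟪k, ω⟫) • ω
  continuous_k₁ k := by fun_prop
  continuous_k₂ k := by fun_prop
  a z := √(1 - c * (2 - c) * z ^ 2)
  b z := c * |z|
  measurable_a := by fun_prop
  measurable_b := by fun_prop
  a_nonneg z := Real.sqrt_nonneg _
  b_nonneg z := by positivity
  norm_k₁ k e ω he hω hk := by
    have h : ‖k - (c * ⟪k, ω⟫) • ω‖ ^ 2 = (1 - c * (2 - c) * ⟪e, ω⟫ ^ 2) * ‖k‖ ^ 2 := by
      have hin : ⟪k, ω⟫ = ‖k‖ * ⟪e, ω⟫ := by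
        conv_lhs => rw [hk]
        rw [real_inner_smul_left]
      rw [norm_sub_sq_real, norm_smul, hω, real_inner_smul_right, hin, Real.norm_eq_abs, mul_one,
        sq_abs]
      ring
    rw [← Real.sqrt_sq (norm_nonneg _), h, Real.sqrt_mul', Real.sqrt_sq (norm_nonneg _)]
    positivity
  norm_k₂ k e ω he hω hk := by
    have hin : ⟪k, ω⟫ = ‖k‖ * ⟪e, ω⟫ := by
      conv_lhs => rw [hk]
      rw [real_inner_smul_left]
    rw [norm_smul, hω, hin, Real.norm_eq_abs, abs_mul, abs_mul, abs_of_nonneg hc, abs_norm]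
    ring
  duality v w k e e' hu hk := by
    refine ⟨fun x y => ⟪v, k⟫ - c * ‖v - w‖ * ‖k‖ * (x * y), fun ω => ?_⟩
    have h1 : ⟪ω, k⟫ = ‖k‖ * ⟪e', ω⟫ := by
      conv_lhs => rw [hk]
      rw [real_inner_smul_right, real_inner_comm]
    have h2 : ⟪v - w, ω⟫ = ‖v - w‖ * ⟪e, ω⟫ := by
      conv_lhs => rw [hu]
      rw [real_inner_smul_left]
    constructor
    · rw [inner_sub_left, real_inner_smul_left, h1, h2]
      ring
    · rw [inner_sub_right, real_inner_smul_right, real_inner_smul_right,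
        real_inner_comm ω k, h1]
      rw [inner_sub_left] at h2
      linear_combination (-c * ‖k‖ * ⟪e', ω⟫) * h2

namespace CollisionRule

variable {d : ℕ} (C : CollisionRule d) {g : ℝ → ℝ}

/-- Angular kernels: measurable, non-negative on `[-1, 1]`, and integrable for the law of the cosine
of the scattering angle. -/
structure IsAngularKernel (d : ℕ) (g : ℝ → ℝ) : Prop where
  measurable : Measurable g
  nonneg : ∀ z ∈ Set.Icc (-1 : ℝ) 1, 0 ≤ g z
  integrable : Integrable g (cosineLaw d)

lemma inner_mem_Icc {e ω : Vel d} (he : ‖e‖ = 1) (hω : ‖ω‖ = 1) : ⟪e, ω⟫ ∈ Set.Icc (-1 : ℝ) 1 := by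
  have := abs_real_inner_le_norm e ω
  rw [he, hω, mul_one] at this
  exact abs_le.1 this

lemma IsAngularKernel.nonneg_inner (hg : IsAngularKernel d g) {e : Vel d} (he : ‖e‖ = 1)
    (ω : UnitSphere d) : 0 ≤ g ⟪e, (ω : Vel d)⟫ :=
  hg.nonneg _ (inner_mem_Icc he (norm_eq_of_mem_sphere ω))

lemma IsAngularKernel.integrable_inner (hg : IsAngularKernel d g) (hd : 2 ≤ d) {e : Vel d}
    (he : ‖e‖ = 1) : Integrable (fun ω : UnitSphere d => g ⟪e, (ω : Vel d)⟫) (surface d) := by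
  have h := hg.integrable
  rw [← surface_map_inner hd he] at h
  exact (integrable_map_measure hg.measurable.aestronglyMeasurable
    (measurable_inner_sphere e).aemeasurable).1 h

lemma integral_inner {F : Type*} [NormedAddCommGroup F] [NormedSpace ℝ F] (hd : 2 ≤ d) {e : Vel d}
    (he : ‖e‖ = 1) {H : ℝ → F} (hH : AEStronglyMeasurable H (cosineLaw d)) :
    ∫ ω : UnitSphere d, H ⟪e, (ω : Vel d)⟫ ∂(surface d) = ∫ z, H z ∂(cosineLaw d) := by
  rw [← surface_map_inner hd he] at hH ⊢
  exact (integral_map (measurable_inner_sphere e).aemeasurable hH).symm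

/-- The collision kernel as a function of the incoming velocities and of `ω`. Where the relative
velocity vanishes its direction is taken to be `e`; this changes neither the weak form of the
operator nor the total collision frequency. -/
def kernel (g : ℝ → ℝ) (e : Vel d) (x : (Vel d × Vel d) × UnitSphere d) : ℝ :=
  g ⟪dir e (x.1.1 - x.1.2), (x.2 : Vel d)⟫

lemma integrable_kernel_right (hg : IsAngularKernel d g) (hd : 2 ≤ d) {e : Vel d} (he : ‖e‖ = 1)
    (p : Vel d × Vel d) : Integrable (fun ω => kernel g e (p, ω)) (surface d) := by
  have h := hg.integrable_inner hd (norm_dir he (p.1 - p.2))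
  unfold kernel
  exact h

lemma integral_kernel_right {F : Type*} [NormedAddCommGroup F] [NormedSpace ℝ F] (hd : 2 ≤ d)
    (hg : Measurable g) {e : Vel d} (he : ‖e‖ = 1) (p : Vel d × Vel d) {H : ℝ → F}
    (hH : StronglyMeasurable H) :
    ∫ ω, H (kernel g e (p, ω)) ∂(surface d) = ∫ z, H (g z) ∂(cosineLaw d) := by
  have h := integral_inner hd (norm_dir he (p.1 - p.2)) (H := fun z => H (g z))
    (hH.comp_measurable hg).aestronglyMeasurable
  unfold kernel
  exact h

lemma measurable_kernel (hg : Measurable g) (e : Vel d) : Measurable (kernel g e) := by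
  have h : Measurable fun x : (Vel d × Vel d) × UnitSphere d => dir e (x.1.1 - x.1.2) :=
    (measurable_dir e).comp (by fun_prop)
  exact hg.comp (h.inner (by fun_prop))

/-- The gain term of the collision operator for colliding particles with laws `f` and `h`. -/
def gain (g : ℝ → ℝ) (e : Vel d) (f h : Measure (Vel d)) : Measure (Vel d) :=
  (((f.prod h).prod (surface d)).withDensity fun x => ENNReal.ofReal (kernel g e x)).map
    fun x => C.post x.1.1 x.1.2 x.2

lemma measurable_post : Measurable fun x : (Vel d × Vel d) × UnitSphere d =>
    C.post x.1.1 x.1.2 x.2 :=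
  (C.continuous_post.comp (by fun_prop : Continuous fun x : (Vel d × Vel d) × UnitSphere d =>
    (x.1, (x.2 : Vel d)))).measurable

variable {f h : Measure (Vel d)} [IsProbabilityMeasure f] [IsProbabilityMeasure h]

lemma integrable_kernel (hg : IsAngularKernel d g) (hd : 2 ≤ d) {e : Vel d} (he : ‖e‖ = 1) :
    Integrable (kernel g e) ((f.prod h).prod (surface d)) := by
  rw [integrable_prod_iff (measurable_kernel hg.measurable e).aestronglyMeasurable]
  refine ⟨Eventually.of_forall fun p => integrable_kernel_right hg hd he p, ?_⟩
  have hc : ∀ p : Vel d × Vel d, ∫ ω, ‖kernel g e (p, ω)‖ ∂(surface d) =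
      ∫ z, ‖g z‖ ∂(cosineLaw d) := fun p =>
    integral_kernel_right hd hg.measurable he p (H := fun x => ‖x‖) stronglyMeasurable_id.norm
  simp_rw [hc]
  exact integrable_const _

lemma kernel_nonneg (hg : IsAngularKernel d g) {e : Vel d} (he : ‖e‖ = 1)
    (x : (Vel d × Vel d) × UnitSphere d) : 0 ≤ kernel g e x :=
  hg.nonneg_inner (norm_dir he _) x.2

lemma isFiniteMeasure_gain (hg : IsAngularKernel d g) (hd : 2 ≤ d) {e : Vel d} (he : ‖e‖ = 1) :
    IsFiniteMeasure (C.gain g e f h) := by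
  have := isFiniteMeasure_withDensity_ofReal
    (integrable_kernel (f := f) (h := h) hg hd he).hasFiniteIntegral
  unfold gain
  infer_instance

lemma integral_gain {F : Type*} [NormedAddCommGroup F] [NormedSpace ℝ F]
    [CompleteSpace F] [SecondCountableTopology F] (hg : IsAngularKernel d g) (hd : 2 ≤ d)
    {e : Vel d} (he : ‖e‖ = 1) {Ψ : Vel d → F} (hΨ : Continuous Ψ) {B : ℝ} (hB : ∀ v, ‖Ψ v‖ ≤ B) :
    ∫ v, Ψ v ∂(C.gain g e f h) = ∫ p, ∫ ω, kernel g e (p, ω) • Ψ (C.post p.1 p.2 ω)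
      ∂(surface d) ∂(f.prod h) := by
  have hm := measurable_kernel hg.measurable e
  have hΨm : StronglyMeasurable fun x : (Vel d × Vel d) × UnitSphere d =>
      Ψ (C.post x.1.1 x.1.2 x.2) := hΨ.stronglyMeasurable.comp_measurable C.measurable_post
  have hint : Integrable (fun x : (Vel d × Vel d) × UnitSphere d =>
      kernel g e x • Ψ (C.post x.1.1 x.1.2 x.2)) ((f.prod h).prod (surface d)) := by
    refine ((integrable_kernel hg hd he).mul_const B).mono'
      (hm.stronglyMeasurable.smul hΨm).aestronglyMeasurable (Eventually.of_forall fun x => ?_)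
    rw [norm_smul, Real.norm_of_nonneg (kernel_nonneg hg he x)]
    exact mul_le_mul_of_nonneg_left (hB _) (kernel_nonneg hg he x)
  rw [gain, integral_map C.measurable_post.aemeasurable hΨ.aestronglyMeasurable,
    integral_withDensity_eq_integral_toReal_smul hm.ennreal_ofReal
      (Eventually.of_forall fun x => ENNReal.ofReal_lt_top)]
  simp_rw [ENNReal.toReal_ofReal (kernel_nonneg hg he _)]
  rw [integral_prod _ hint]

/-- The weak form of the collision operator is gain minus loss. -/
lemma integral_collision (hg : IsAngularKernel d g) (hd : 2 ≤ d) {e : Vel d} (he : ‖e‖ = 1)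
    (ψ : Vel d →ᵇ ℝ) :
    ∫ v, ∫ w, ∫ ω : UnitSphere d, g (⟪v - w, (ω : Vel d)⟫ / ‖v - w‖) *
      (ψ (C.post v w ω) - ψ v) ∂(surface d) ∂h ∂f =
    ∫ v, ψ v ∂(C.gain g e f h) - (∫ z, g z ∂(cosineLaw d)) * ∫ v, ψ v ∂f := by
  have hpost : ∀ p : Vel d × Vel d, Continuous fun ω : UnitSphere d => ψ (C.post p.1 p.2 ω) :=
    fun p => ψ.continuous.comp (C.continuous_post.comp
      (by fun_prop : Continuous fun ω : UnitSphere d => (p, (ω : Vel d))))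
  have hi : ∀ p : Vel d × Vel d,
      Integrable (fun ω => kernel g e (p, ω) * ψ (C.post p.1 p.2 ω)) (surface d) := fun p =>
    (integrable_kernel_right hg hd he p).mul_bdd (c := ‖ψ‖)
      (hpost p).aestronglyMeasurable (Eventually.of_forall fun ω => ψ.norm_coe_le_norm _)
  have hin : ∀ v w, ∫ ω : UnitSphere d, g (⟪v - w, (ω : Vel d)⟫ / ‖v - w‖) *
      (ψ (C.post v w ω) - ψ v) ∂(surface d) =
      ∫ ω, kernel g e ((v, w), ω) * ψ (C.post v w ω) ∂(surface d) -
        (∫ z, g z ∂(cosineLaw d)) * ψ v := by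
    intro v w
    have h1 : ∀ ω : UnitSphere d, g (⟪v - w, (ω : Vel d)⟫ / ‖v - w‖) *
        (ψ (C.post v w ω) - ψ v) =
        kernel g e ((v, w), ω) * ψ (C.post v w ω) - kernel g e ((v, w), ω) * ψ v := by
      intro ω
      rw [← mul_sub]
      rcases eq_or_ne v w with rfl | hvw
      · rw [C.post_self]; simp
      · rw [kernel, inner_dir_of_ne e (sub_ne_zero.2 hvw)]
    simp_rw [h1]
    rw [integral_sub (hi (v, w)) ((integrable_kernel_right hg hd he (v, w)).mul_const _),
      integral_mul_const]
    congr 2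
    exact integral_kernel_right hd hg.measurable he (v, w) (H := fun x => x) stronglyMeasurable_id
  have hG : Integrable (fun p : Vel d × Vel d =>
      ∫ ω, kernel g e (p, ω) * ψ (C.post p.1 p.2 ω) ∂(surface d)) (f.prod h) := by
    have hΨm : StronglyMeasurable fun x : (Vel d × Vel d) × UnitSphere d =>
      ψ (C.post x.1.1 x.1.2 x.2) := ψ.continuous.stronglyMeasurable.comp_measurable C.measurable_post
    exact ((integrable_kernel hg hd he).mul_bdd (c := ‖ψ‖) hΨm.aestronglyMeasurable
      (Eventually.of_forall fun x => ψ.norm_coe_le_norm _)).integral_prod_left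
  simp_rw [hin]
  rw [C.integral_gain hg hd he ψ.continuous ψ.norm_coe_le_norm]
  simp only [smul_eq_mul]
  have hψ : Integrable (fun p : Vel d × Vel d => (∫ z, g z ∂(cosineLaw d)) * ψ p.1) (f.prod h) :=
    ((ψ.integrable f).comp_fst h).const_mul _
  rw [← integral_prod (fun p : Vel d × Vel d =>
    (∫ ω, kernel g e (p, ω) * ψ (C.post p.1 p.2 ω) ∂(surface d)) -
      (∫ z, g z ∂(cosineLaw d)) * ψ p.1) (hG.sub hψ), integral_sub hG hψ, integral_const_mul,
    integral_fun_fst]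
  simp

/-- Bobylev's identity. For fixed incoming velocities the reflection that exchanges the directions
of `v - w` and `k` turns the phase `⟨v', k⟩` into `⟨v, k₁⟩ + ⟨w, k₂⟩`. -/
lemma charFun_gain (hg : IsAngularKernel d g) (hd : 2 ≤ d) {e : Vel d} (he : ‖e‖ = 1) (k : Vel d) :
    charFun (C.gain g e f h) k = ∫ ω : UnitSphere d, g ⟪dir e k, (ω : Vel d)⟫ •
      (charFun f (C.k₁ k ω) * charFun h (C.k₂ k ω)) ∂(surface d) := by
  have hexp : ∀ v : Vel d, ‖Complex.exp ((⟪v, k⟫ : ℝ) * Complex.I)‖ ≤ 1 := fun v => by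
    rw [Complex.norm_exp_ofReal_mul_I]
  rw [charFun_apply, C.integral_gain hg hd he (by fun_prop) hexp]
  have hpt : ∀ p : Vel d × Vel d, ∫ ω : UnitSphere d, kernel g e (p, ω) •
      Complex.exp ((⟪C.post p.1 p.2 ω, k⟫ : ℝ) * Complex.I) ∂(surface d) =
      ∫ ω : UnitSphere d, g ⟪dir e k, (ω : Vel d)⟫ •
        (Complex.exp ((⟪p.1, C.k₁ k ω⟫ : ℝ) * Complex.I) *
          Complex.exp ((⟪p.2, C.k₂ k ω⟫ : ℝ) * Complex.I)) ∂(surface d) := by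
    intro p
    obtain ⟨R, hR1, hR2, hsymm⟩ := exists_isometry_swap (x := dir e (p.1 - p.2)) (y := dir e k)
      (by rw [norm_dir he, norm_dir he])
    obtain ⟨Φ, hΦ⟩ := C.duality p.1 p.2 k _ _ (eq_norm_smul_dir e _) (eq_norm_smul_dir e k)
    have hm : AEStronglyMeasurable (fun ω : UnitSphere d => kernel g e (p, ω) •
        Complex.exp ((⟪C.post p.1 p.2 ω, k⟫ : ℝ) * Complex.I)) (surface d) := by
      have hc : Continuous fun ω : UnitSphere d => C.post p.1 p.2 ω := C.continuous_post.comp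
        (by fun_prop : Continuous fun ω : UnitSphere d => (p, (ω : Vel d)))
      exact (integrable_kernel_right hg hd he p).aestronglyMeasurable.smul
        (Continuous.aestronglyMeasurable (by fun_prop))
    rw [← integral_surface_isometry R hm]
    refine integral_congr_ae (Eventually.of_forall fun ω => ?_)
    simp only [kernel]
    have hω : ((sphereMap R ω : UnitSphere d) : Vel d) = R ω := rfl
    rw [hω, (hΦ _).1, hsymm, hsymm, hR1, hR2, ← Complex.exp_add, ← add_mul, ← Complex.ofReal_add,
      (hΦ _).2]
  simp_rw [hpt]
  have hmeas : Measurable fun x : (Vel d × Vel d) × UnitSphere d =>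
      Complex.exp ((⟪x.1.1, C.k₁ k x.2⟫ : ℝ) * Complex.I) *
          Complex.exp ((⟪x.1.2, C.k₂ k x.2⟫ : ℝ) * Complex.I) := by
    have h1 := C.continuous_k₁ k
    have h2 := C.continuous_k₂ k
    exact Continuous.measurable (by fun_prop)
  have hK : Integrable (fun x : (Vel d × Vel d) × UnitSphere d => g ⟪dir e k, (x.2 : Vel d)⟫)
      ((f.prod h).prod (surface d)) := (hg.integrable_inner hd (norm_dir he k)).comp_snd _
  rw [integral_integral_swap]
  · refine integral_congr_ae (Eventually.of_forall fun ω => ?_)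
    simp only []
    rw [integral_smul, integral_prod_mul
      (fun v : Vel d => Complex.exp ((⟪v, C.k₁ k ω⟫ : ℝ) * Complex.I))
      (fun w : Vel d => Complex.exp ((⟪w, C.k₂ k ω⟫ : ℝ) * Complex.I)), charFun_apply, charFun_apply]
  · refine hK.smul_bdd 1 hmeas.aestronglyMeasurable (Eventually.of_forall fun x => ?_)
    rw [norm_mul, Complex.norm_exp_ofReal_mul_I, Complex.norm_exp_ofReal_mul_I, mul_one]

lemma integrable_charFun_gain (hg : IsAngularKernel d g) (hd : 2 ≤ d) {e : Vel d} (he : ‖e‖ = 1)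
    (k : Vel d) (f h : Measure (Vel d)) [IsProbabilityMeasure f] [IsProbabilityMeasure h] :
    Integrable (fun ω : UnitSphere d => g ⟪dir e k, (ω : Vel d)⟫ •
      (charFun f (C.k₁ k ω) * charFun h (C.k₂ k ω))) (surface d) := by
  have h1 := C.continuous_k₁ k
  have h2 := C.continuous_k₂ k
  have hm : Measurable fun ω : UnitSphere d => charFun f (C.k₁ k ω) * charFun h (C.k₂ k ω) :=
    (measurable_charFun.comp (by fun_prop)).mul (measurable_charFun.comp (by fun_prop))
  refine (hg.integrable_inner hd (norm_dir he k)).smul_bdd 1 hm.aestronglyMeasurable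
    (Eventually.of_forall fun ω => ?_)
  rw [norm_mul]
  exact mul_le_one₀ (norm_charFun_le_one _) (norm_nonneg _) (norm_charFun_le_one _)

/-- The gain term is Lipschitz in the supremum norm of characteristic functions, for all laws and
not only isotropic ones. -/
lemma norm_charFun_gain_sub_le (hg : IsAngularKernel d g) (hd : 2 ≤ d) {e : Vel d} (he : ‖e‖ = 1)
    {f' h' : Measure (Vel d)} [IsProbabilityMeasure f'] [IsProbabilityMeasure h'] {M M' : ℝ}
    (hf : ∀ k, ‖charFun f k - charFun f' k‖ ≤ M) (hh : ∀ k, ‖charFun h k - charFun h' k‖ ≤ M')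
    (k : Vel d) : ‖charFun (C.gain g e f h) k - charFun (C.gain g e f' h') k‖ ≤
      (∫ z, g z ∂(cosineLaw d)) * (M + M') := by
  rw [C.charFun_gain hg hd he, C.charFun_gain hg hd he,
    ← integral_sub (C.integrable_charFun_gain hg hd he k f h)
      (C.integrable_charFun_gain hg hd he k f' h'),
    ← integral_inner hd (norm_dir he k) hg.measurable.aestronglyMeasurable, ← integral_mul_const]
  refine norm_integral_le_of_norm_le
    ((hg.integrable_inner hd (norm_dir he k)).mul_const _) (Eventually.of_forall fun ω => ?_)
  rw [← smul_sub, norm_smul, Real.norm_of_nonneg (hg.nonneg_inner (norm_dir he k) ω)]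
  refine mul_le_mul_of_nonneg_left ?_ (hg.nonneg_inner (norm_dir he k) ω)
  set x := charFun f (C.k₁ k ω)
  set y := charFun h (C.k₂ k ω)
  set x' := charFun f' (C.k₁ k ω)
  set y' := charFun h' (C.k₂ k ω)
  have hxy : x * y - x' * y' = (x - x') * y + x' * (y - y') := by ring
  rw [hxy]
  refine (norm_add_le _ _).trans (add_le_add ?_ ?_)
  · rw [norm_mul]
    exact (mul_le_of_le_one_right (norm_nonneg _) (norm_charFun_le_one _)).trans (hf _)
  · rw [norm_mul]
    exact (mul_le_of_le_one_left (norm_nonneg _) (norm_charFun_le_one _)).trans (hh _)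

/-- The characteristic function of an isotropic law is radial. -/
lemma charFun_eq_of_norm_eq (hf : ∀ R : Vel d ≃ₗᵢ[ℝ] Vel d, f.map R = f) {k k' : Vel d}
    (hk : ‖k‖ = ‖k'‖) : charFun f k = charFun f k' := by
  obtain ⟨R, -, hR, -⟩ := exists_isometry_swap hk
  have h := charFun_map_isometry f R.symm k'
  rw [hf R.symm, LinearIsometryEquiv.symm_symm, hR] at h
  exact h.symm

/-- For isotropic laws the gain term depends on the angle between `k` and `ω` only. -/
lemma charFun_gain_isotropic (hg : IsAngularKernel d g) (hd : 2 ≤ d) {e : Vel d} (he : ‖e‖ = 1)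
    (hf : ∀ R : Vel d ≃ₗᵢ[ℝ] Vel d, f.map R = f) (hh : ∀ R : Vel d ≃ₗᵢ[ℝ] Vel d, h.map R = h)
    (k : Vel d) : charFun (C.gain g e f h) k =
      ∫ z, g z • (charFun f (C.a z • k) * charFun h (C.b z • k)) ∂(cosineLaw d) := by
  have hm : Measurable fun z : ℝ => g z • (charFun f (C.a z • k) * charFun h (C.b z • k)) := by
    have ha := C.measurable_a
    have hb := C.measurable_b
    exact hg.measurable.smul ((measurable_charFun.comp (by fun_prop)).mul
      (measurable_charFun.comp (by fun_prop)))
  rw [C.charFun_gain hg hd he, ← integral_inner hd (norm_dir he k) hm.aestronglyMeasurable]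
  refine integral_congr_ae (Eventually.of_forall fun ω => ?_)
  have hω : ‖(ω : Vel d)‖ = 1 := norm_eq_of_mem_sphere ω
  simp only []
  rw [charFun_eq_of_norm_eq hf (k' := C.a ⟪dir e k, (ω : Vel d)⟫ • k),
    charFun_eq_of_norm_eq hh (k' := C.b ⟪dir e k, (ω : Vel d)⟫ • k)]
  · rw [norm_smul, Real.norm_of_nonneg (C.b_nonneg _)]
    exact C.norm_k₂ k _ _ (norm_dir he k) hω (eq_norm_smul_dir e k)
  · rw [norm_smul, Real.norm_of_nonneg (C.a_nonneg _)]
    exact C.norm_k₁ k _ _ (norm_dir he k) hω (eq_norm_smul_dir e k)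

end CollisionRule

end

/-! ### Weights parametrized by the scattering angle -/

section

section Weights

/-- The law of `(√(1 - α s), √(β s))` when `s` has law `κ`. -/
def affineWeights (κ : Measure ℝ) (α β : ℝ) : Measure (ℝ × ℝ) :=
  κ.map fun s => (√(1 - α * s), √(β * s))

/-- The weights of collisions with restitution parameter `c` (`c = 1` for elastic collisions),
together with a fraction `θ` of collisions with cold particles. -/
def modelWeights (κ : Measure ℝ) (c b θ : ℝ) : Measure (ℝ × ℝ) :=
  affineWeights κ (c * (2 - c)) (c ^ 2) + ENNReal.ofReal θ • affineWeights κ b 0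

variable {κ : Measure ℝ} [IsFiniteMeasure κ] {c b θ : ℝ}

lemma measurable_affineWeights_fun (α β : ℝ) :
    Measurable fun s : ℝ => (√(1 - α * s), √(β * s)) := by
  fun_prop

instance (α β : ℝ) : IsFiniteMeasure (affineWeights κ α β) := by
  unfold affineWeights; infer_instance

instance : IsFiniteMeasure (modelWeights κ c b θ) := by
  unfold modelWeights
  have : IsFiniteMeasure (ENNReal.ofReal θ • affineWeights κ b 0) :=
    Measure.smul_finite _ ENNReal.ofReal_ne_top
  infer_instance

lemma sqrt_affine_mem {α s : ℝ} (hα : 0 ≤ α) (hα1 : α ≤ 1) (hs : s ∈ Set.Ioo (0 : ℝ) 1) :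
    0 ≤ 1 - α * s ∧ 1 - α * s ≤ 1 ∧ 0 ≤ α * s ∧ α * s ≤ 1 := by
  have h1 : 0 ≤ α * s := mul_nonneg hα hs.1.le
  have h2 : α * s ≤ 1 := mul_le_one₀ hα1 hs.1.le hs.2.le
  exact ⟨by linarith, by linarith, h1, h2⟩

lemma ae_modelWeights (hκ : ∀ᵐ s ∂κ, s ∈ Set.Ioo (0 : ℝ) 1) {P : ℝ × ℝ → Prop}
    (hP : MeasurableSet {x | P x})
    (h1 : ∀ s ∈ Set.Ioo (0 : ℝ) 1, P (√(1 - c * (2 - c) * s), √(c ^ 2 * s)))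
    (h2 : 0 < θ → ∀ s ∈ Set.Ioo (0 : ℝ) 1, P (√(1 - b * s), √(0 * s))) :
    ∀ᵐ x ∂(modelWeights κ c b θ), P x := by
  rw [modelWeights, ae_add_measure_iff]
  constructor
  · rw [affineWeights, ae_map_iff (measurable_affineWeights_fun _ _).aemeasurable hP]
    exact hκ.mono h1
  · rcases le_or_gt θ 0 with hθ | hθ
    · simp [ENNReal.ofReal_of_nonpos hθ]
    · refine Measure.ae_smul_measure ?_ _
      rw [affineWeights, ae_map_iff (measurable_affineWeights_fun _ _).aemeasurable hP]
      exact hκ.mono (h2 hθ)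

/-- Integration against the weights of functions that are bounded on the unit square. -/
lemma integrable_and_integral_modelWeights {F : Type*} [NormedAddCommGroup F] [NormedSpace ℝ F]
    (hκ : ∀ᵐ s ∂κ, s ∈ Set.Ioo (0 : ℝ) 1) (hc : 0 ≤ c) (hc1 : c ≤ 1) (hb : 0 ≤ b) (hb1 : b ≤ 1)
    (hθ : 0 ≤ θ) {H : ℝ × ℝ → F} (hH : StronglyMeasurable H) {B : ℝ}
    (hB : ∀ x y, 0 ≤ x → x ≤ 1 → 0 ≤ y → y ≤ 1 → ‖H (x, y)‖ ≤ B) :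
    Integrable (fun s => H (√(1 - c * (2 - c) * s), √(c ^ 2 * s))) κ ∧
    Integrable (fun s => H (√(1 - b * s), √(0 * s))) κ ∧
    ∫ x, H x ∂(modelWeights κ c b θ) =
      ∫ s, H (√(1 - c * (2 - c) * s), √(c ^ 2 * s)) ∂κ +
        θ • ∫ s, H (√(1 - b * s), √(0 * s)) ∂κ := by
  have hα : 0 ≤ c * (2 - c) := mul_nonneg hc (by linarith)
  have hα1 : c * (2 - c) ≤ 1 := by nlinarith [sq_nonneg (1 - c)]
  have hc2 : c ^ 2 ≤ 1 := pow_le_one₀ hc hc1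
  have key : ∀ α β, 0 ≤ α → α ≤ 1 → 0 ≤ β → β ≤ 1 →
      Integrable (fun s => H (√(1 - α * s), √(β * s))) κ := by
    intro α β h1 h2 h3 h4
    refine Integrable.of_bound (C := B)
      (hH.comp_measurable (measurable_affineWeights_fun α β)).aestronglyMeasurable ?_
    filter_upwards [hκ] with s hs
    have ha := sqrt_affine_mem h1 h2 hs
    have hb := sqrt_affine_mem h3 h4 hs
    exact hB _ _ (Real.sqrt_nonneg _) (Real.sqrt_le_one.2 ha.2.1) (Real.sqrt_nonneg _)
      (Real.sqrt_le_one.2 hb.2.2.2)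
  have hi1 := key _ _ hα hα1 (sq_nonneg c) hc2
  have hi2 := key b 0 hb hb1 le_rfl zero_le_one
  have hj : ∀ α β, Integrable (fun s => H (√(1 - α * s), √(β * s))) κ →
      Integrable H (affineWeights κ α β) ∧
      ∫ x, H x ∂(affineWeights κ α β) = ∫ s, H (√(1 - α * s), √(β * s)) ∂κ := fun α β h =>
    ⟨(integrable_map_measure hH.aestronglyMeasurable
      (measurable_affineWeights_fun α β).aemeasurable).2 h,
      integral_map (measurable_affineWeights_fun α β).aemeasurable hH.aestronglyMeasurable⟩
  refine ⟨hi1, hi2, ?_⟩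
  rw [modelWeights, integral_add_measure (hj _ _ hi1).1
    ((hj _ _ hi2).1.smul_measure ENNReal.ofReal_ne_top), integral_smul_measure, (hj _ _ hi1).2,
    (hj _ _ hi2).2, ENNReal.toReal_ofReal hθ]

lemma sqrt_rpow_two_mul {x : ℝ} (hx : 0 ≤ x) (q : ℝ) : √x ^ (2 * q) = x ^ q := by
  rw [Real.sqrt_eq_rpow, ← Real.rpow_mul hx]; congr 1; ring

lemma isDissipative_modelWeights (hκ : ∀ᵐ s ∂κ, s ∈ Set.Ioo (0 : ℝ) 1) (hc : 0 ≤ c) (hc1 : c ≤ 1)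
    (hb : 0 ≤ b) (hb1 : b ≤ 1) : IsDissipative (modelWeights κ c b θ) := by
  have hα : 0 ≤ c * (2 - c) := mul_nonneg hc (by linarith)
  have hα1 : c * (2 - c) ≤ 1 := by nlinarith [sq_nonneg (1 - c)]
  refine ae_modelWeights hκ ?_ (fun s hs => ?_) fun _ s hs => ?_
  · exact (measurableSet_le measurable_const measurable_fst).inter
      ((measurableSet_le measurable_const measurable_snd).inter
        (measurableSet_le (by fun_prop : Measurable fun x : ℝ × ℝ => x.1 ^ 2 + x.2 ^ 2)
          measurable_const))
  · refine ⟨Real.sqrt_nonneg _, Real.sqrt_nonneg _, ?_⟩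
    rw [Real.sq_sqrt (sqrt_affine_mem hα hα1 hs).1, Real.sq_sqrt (mul_nonneg (sq_nonneg c) hs.1.le)]
    nlinarith [mul_nonneg (mul_nonneg hc (sub_nonneg.2 hc1)) hs.1.le]
  · refine ⟨Real.sqrt_nonneg _, Real.sqrt_nonneg _, ?_⟩
    have := sqrt_affine_mem hb hb1 hs
    rw [Real.sq_sqrt this.1, zero_mul, Real.sqrt_zero]
    nlinarith [this.2.1]

/-- The binary collisions already have two nonzero weights for every `s ∈ (0, 1)`. -/
lemma overlap_modelWeights (hκ : ∀ᵐ s ∂κ, s ∈ Set.Ioo (0 : ℝ) 1) (hκ0 : κ ≠ 0) (hc : 0 < c) :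
    modelWeights κ c b θ {x | x.1 ≠ 0 ∧ x.2 ≠ 0} ≠ 0 := by
  have hα1 : c * (2 - c) ≤ 1 := by nlinarith [sq_nonneg (1 - c)]
  have hms : MeasurableSet {x : ℝ × ℝ | x.1 ≠ 0 ∧ x.2 ≠ 0} := by measurability
  intro h0
  rw [modelWeights, Measure.add_apply, add_eq_zero, affineWeights,
    Measure.map_apply (measurable_affineWeights_fun _ _) hms] at h0
  refine hκ0 (Measure.measure_univ_eq_zero.1 ?_)
  have h1 : ∀ᵐ s ∂κ, s ∉ (fun s : ℝ => (√(1 - c * (2 - c) * s), √(c ^ 2 * s))) ⁻¹'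
      {x : ℝ × ℝ | x.1 ≠ 0 ∧ x.2 ≠ 0} := measure_eq_zero_iff_ae_notMem.1 h0.1
  have h2 : ∀ᵐ _ ∂κ, False := by
    filter_upwards [h1, hκ] with s hs hs'
    apply hs
    have h3 : c * (2 - c) * s < 1 := by nlinarith [hs'.1, hs'.2]
    exact ⟨(Real.sqrt_pos.2 (by linarith)).ne', (Real.sqrt_pos.2 (by
      have := hs'.1
      positivity)).ne'⟩
  simpa using ae_iff.1 h2

lemma real_univ_modelWeights (hκ : ∀ᵐ s ∂κ, s ∈ Set.Ioo (0 : ℝ) 1) (hc : 0 ≤ c) (hc1 : c ≤ 1)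
    (hb : 0 ≤ b) (hb1 : b ≤ 1) (hθ : 0 ≤ θ) :
    (modelWeights κ c b θ).real Set.univ = (1 + θ) * κ.real Set.univ := by
  have h := (integrable_and_integral_modelWeights hκ hc hc1 hb hb1 hθ (H := fun _ => (1 : ℝ))
    stronglyMeasurable_const (B := 1) (by simp)).2.2
  simp only [integral_const, smul_eq_mul, mul_one] at h
  rw [h]; ring

lemma weightMoment_modelWeights (hκ : ∀ᵐ s ∂κ, s ∈ Set.Ioo (0 : ℝ) 1) (hc : 0 ≤ c) (hc1 : c ≤ 1)
    (hb : 0 ≤ b) (hb1 : b ≤ 1) (hθ : 0 ≤ θ) {q : ℝ} (hq : 0 < q) :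
    weightMoment (modelWeights κ c b θ) q - (modelWeights κ c b θ).real Set.univ =
      ∫ s, ((c ^ 2 * s) ^ q + (1 - c * (2 - c) * s) ^ q - 1 + θ * ((1 - b * s) ^ q - 1)) ∂κ := by
  have hα : 0 ≤ c * (2 - c) := mul_nonneg hc (by linarith)
  have hα1 : c * (2 - c) ≤ 1 := by nlinarith [sq_nonneg (1 - c)]
  obtain ⟨hi1, hi2, h⟩ := integrable_and_integral_modelWeights hκ hc hc1 hb hb1 hθ
    (H := fun x : ℝ × ℝ => x.1 ^ (2 * q) + x.2 ^ (2 * q)) (B := 2)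
    (measurable_rpow_add (2 * q)).stronglyMeasurable (fun x y hx hx1 hy hy1 => by
      have h1 := Real.rpow_le_one hx hx1 (by positivity : 0 ≤ 2 * q)
      have h2 := Real.rpow_le_one hy hy1 (by positivity : 0 ≤ 2 * q)
      rw [Real.norm_of_nonneg (by positivity)]
      linarith)
  have e1 : (fun s => √(1 - c * (2 - c) * s) ^ (2 * q) + √(c ^ 2 * s) ^ (2 * q)) =ᵐ[κ]
      fun s => (c ^ 2 * s) ^ q + (1 - c * (2 - c) * s) ^ q := by
    filter_upwards [hκ] with s hs
    rw [sqrt_rpow_two_mul (sqrt_affine_mem hα hα1 hs).1,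
      sqrt_rpow_two_mul (mul_nonneg (sq_nonneg c) hs.1.le), add_comm]
  have e2 : (fun s => √(1 - b * s) ^ (2 * q) + √(0 * s) ^ (2 * q)) =ᵐ[κ]
      fun s => (1 - b * s) ^ q := by
    filter_upwards [hκ] with s hs
    rw [sqrt_rpow_two_mul (sqrt_affine_mem hb hb1 hs).1, zero_mul, Real.sqrt_zero,
      Real.zero_rpow (by positivity), add_zero]
  have i1 := hi1.congr e1
  have i2 := hi2.congr e2
  have hsum := integral_add (μ := κ)
    (f := fun s => (c ^ 2 * s) ^ q + (1 - c * (2 - c) * s) ^ q - 1)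
    (g := fun s => θ * ((1 - b * s) ^ q - 1)) (i1.sub (integrable_const _))
    ((i2.sub (integrable_const _)).const_mul θ)
  rw [integral_sub i1 (integrable_const _), integral_const_mul,
    integral_sub i2 (integrable_const _)] at hsum
  simp only [integral_const, smul_eq_mul, mul_one] at hsum
  rw [weightMoment, h, real_univ_modelWeights hκ hc hc1 hb hb1 hθ, hsum, integral_congr_ae e1,
    integral_congr_ae e2, smul_eq_mul]
  ring

lemma abs_mul_log_le_one {x : ℝ} (hx : 0 ≤ x) (hx1 : x ≤ 1) : |x * Real.log x| ≤ 1 := by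
  rcases hx.eq_or_lt with rfl | hx
  · simp
  · rw [mul_comm]
    exact (Real.abs_log_mul_self_lt x hx hx1).le

/-- Both sides are `μ'(1)`, since `μ(p) p = ∫ (a^{2p} + b^{2p} - 1) dν`. -/
lemma integral_entropy_modelWeights (hκ : ∀ᵐ s ∂κ, s ∈ Set.Ioo (0 : ℝ) 1) (hc : 0 ≤ c)
    (hc1 : c ≤ 1) (hb : 0 ≤ b) (hb1 : b ≤ 1) (hθ : 0 ≤ θ) :
    ∫ x, (x.1 ^ 2 * Real.log (x.1 ^ 2) + x.2 ^ 2 * Real.log (x.2 ^ 2)) ∂(modelWeights κ c b θ) -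
      (weightMoment (modelWeights κ c b θ) 1 - (modelWeights κ c b θ).real Set.univ) =
    ∫ s, ((1 - c * (2 - c) * s) * Real.log (1 - c * (2 - c) * s) +
      c ^ 2 * s * Real.log (c ^ 2 * s) + c * (2 - c) * s - c ^ 2 * s) ∂κ +
    θ * ∫ s, (b * s + (1 - b * s) * Real.log (1 - b * s)) ∂κ := by
  have hα : 0 ≤ c * (2 - c) := mul_nonneg hc (by linarith)
  have hα1 : c * (2 - c) ≤ 1 := by nlinarith [sq_nonneg (1 - c)]
  obtain ⟨hi1, hi2, h⟩ := integrable_and_integral_modelWeights hκ hc hc1 hb hb1 hθ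
    (H := fun x : ℝ × ℝ => x.1 ^ 2 * Real.log (x.1 ^ 2) + x.2 ^ 2 * Real.log (x.2 ^ 2)) (B := 2)
    (Measurable.stronglyMeasurable (by fun_prop)) (fun x y hx hx1 hy hy1 => by
      have h1 := abs_mul_log_le_one (sq_nonneg x) (pow_le_one₀ hx hx1)
      have h2 := abs_mul_log_le_one (sq_nonneg y) (pow_le_one₀ hy hy1)
      exact (norm_add_le _ _).trans (by rw [Real.norm_eq_abs, Real.norm_eq_abs]; linarith))
  have hid : Integrable (fun s : ℝ => s) κ := by
    refine Integrable.of_bound (C := 1) measurable_id.aestronglyMeasurable ?_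
    filter_upwards [hκ] with s hs
    rw [Real.norm_of_nonneg hs.1.le]; exact hs.2.le
  have e1 : (fun s => √(1 - c * (2 - c) * s) ^ 2 * Real.log (√(1 - c * (2 - c) * s) ^ 2) +
      √(c ^ 2 * s) ^ 2 * Real.log (√(c ^ 2 * s) ^ 2)) =ᵐ[κ]
      fun s => (1 - c * (2 - c) * s) * Real.log (1 - c * (2 - c) * s) +
        c ^ 2 * s * Real.log (c ^ 2 * s) := by
    filter_upwards [hκ] with s hs
    rw [Real.sq_sqrt (sqrt_affine_mem hα hα1 hs).1, Real.sq_sqrt (mul_nonneg (sq_nonneg c) hs.1.le)]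
  have e2 : (fun s => √(1 - b * s) ^ 2 * Real.log (√(1 - b * s) ^ 2) +
      √(0 * s) ^ 2 * Real.log (√(0 * s) ^ 2)) =ᵐ[κ]
      fun s => (1 - b * s) * Real.log (1 - b * s) := by
    filter_upwards [hκ] with s hs
    rw [Real.sq_sqrt (sqrt_affine_mem hb hb1 hs).1]
    simp
  have i1 := hi1.congr e1
  have i2 := hi2.congr e2
  have hw := weightMoment_modelWeights hκ hc hc1 hb hb1 hθ one_pos
  rw [hw, h, integral_congr_ae e1, integral_congr_ae e2, smul_eq_mul]
  have hw2 : ∀ s : ℝ, (c ^ 2 * s) ^ (1 : ℝ) + (1 - c * (2 - c) * s) ^ (1 : ℝ) - 1 +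
      θ * ((1 - b * s) ^ (1 : ℝ) - 1) = (c ^ 2 - c * (2 - c) - θ * b) * s := fun s => by
    simp only [Real.rpow_one]; ring
  simp_rw [hw2]
  have s1 := integral_sub (μ := κ)
    (f := fun s => (1 - c * (2 - c) * s) * Real.log (1 - c * (2 - c) * s) +
      c ^ 2 * s * Real.log (c ^ 2 * s) + c * (2 - c) * s) (g := fun s => c ^ 2 * s)
    (i1.add (hid.const_mul _)) (hid.const_mul _)
  have s2 := integral_add (μ := κ) i1 (hid.const_mul (c * (2 - c)))
  have s3 := integral_add (μ := κ) (hid.const_mul b) i2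
  rw [s1, s2, s3]
  have hlin : ∀ r : ℝ, ∫ s, r * s ∂κ = r * ∫ s, s ∂κ := fun r => integral_const_mul r _
  rw [hlin, hlin, hlin, hlin]
  ring

/-- The contribution of the binary collisions to `μ'(1)` is negative. By strict convexity of
`x log x` it is less than `s` times its value at `s = 1`, and that value is at most `0` because
`log x ≤ x - 1` for `x = c` and `x = 1 - c`. -/
lemma entropy_neg (hc : 0 < c) (hc1 : c ≤ 1) {s : ℝ} (hs : s ∈ Set.Ioo (0 : ℝ) 1) :
    (1 - c * (2 - c) * s) * Real.log (1 - c * (2 - c) * s) +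
      c ^ 2 * s * Real.log (c ^ 2 * s) + c * (2 - c) * s - c ^ 2 * s < 0 := by
  have hs1 : 0 < 1 - s := by linarith [hs.2]
  have h1 := Real.convexOn_mul_log.2 (x := 1) (Set.mem_Ici.2 zero_le_one) (y := (1 - c) ^ 2)
    (Set.mem_Ici.2 (sq_nonneg _)) hs1.le hs.1.le (by ring)
  have h2 := Real.strictConvexOn_mul_log.2 (x := 0) (Set.mem_Ici.2 le_rfl) (y := c ^ 2)
    (Set.mem_Ici.2 (sq_nonneg _)) (by positivity) hs1 hs.1 (by ring)
  simp only [smul_eq_mul, Real.log_one, mul_zero, zero_add, Real.log_zero, mul_one] at h1 h2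
  rw [show 1 - s + s * (1 - c) ^ 2 = 1 - c * (2 - c) * s by ring] at h1
  rw [mul_comm s (c ^ 2)] at h2
  have h3 : (1 - c) ^ 2 * Real.log ((1 - c) ^ 2) ≤ -2 * c * (1 - c) ^ 2 := by
    rcases hc1.eq_or_lt with rfl | hc1
    · simp
    · rw [Real.log_pow]
      have := Real.log_le_sub_one_of_pos (by linarith : 0 < 1 - c)
      push_cast
      nlinarith [sq_nonneg (1 - c)]
  have h4 : c ^ 2 * Real.log (c ^ 2) ≤ 2 * (c - 1) * c ^ 2 := by
    rw [Real.log_pow]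
    have := Real.log_le_sub_one_of_pos hc
    push_cast
    nlinarith [sq_nonneg c]
  nlinarith [mul_le_mul_of_nonneg_left h3 hs.1.le, mul_le_mul_of_nonneg_left h4 hs.1.le]

lemma integrable_entropy (hκ : ∀ᵐ s ∂κ, s ∈ Set.Ioo (0 : ℝ) 1) (hc : 0 ≤ c) (hc1 : c ≤ 1) :
    Integrable (fun s => (1 - c * (2 - c) * s) * Real.log (1 - c * (2 - c) * s) +
      c ^ 2 * s * Real.log (c ^ 2 * s) + c * (2 - c) * s - c ^ 2 * s) κ := by
  have hα : 0 ≤ c * (2 - c) := mul_nonneg hc (by linarith)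
  have hα1 : c * (2 - c) ≤ 1 := by nlinarith [sq_nonneg (1 - c)]
  refine Integrable.of_bound (C := 4) (Measurable.aestronglyMeasurable (by fun_prop)) ?_
  filter_upwards [hκ] with s hs
  have ha := sqrt_affine_mem hα hα1 hs
  have hb := sqrt_affine_mem (sq_nonneg c) (pow_le_one₀ hc hc1) hs
  have h1 := abs_le.1 (abs_mul_log_le_one ha.1 ha.2.1)
  have h2 := abs_le.1 (abs_mul_log_le_one hb.2.2.1 hb.2.2.2)
  rw [Real.norm_eq_abs, abs_le]
  constructor <;> linarith

lemma integral_neg_of_ae_neg (hκ0 : κ ≠ 0) {h : ℝ → ℝ} (hi : Integrable h κ)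
    (hneg : ∀ᵐ s ∂κ, h s < 0) : ∫ s, h s ∂κ < 0 := by
  have hnn : 0 ≤ᵐ[κ] fun s => -h s := hneg.mono fun s hs => by
    simp only [Pi.zero_apply]; linarith
  have hpos := (integral_pos_iff_support_of_nonneg_ae hnn hi.neg).2 (by
    refine pos_iff_ne_zero.2 fun h0 => hκ0 (Measure.measure_univ_eq_zero.1 ?_)
    have h1 : ∀ᵐ s ∂κ, -h s = 0 := by rw [ae_iff]; exact h0
    have h2 : ∀ᵐ _ ∂κ, False := by
      filter_upwards [h1, hneg] with s hs hs'
      linarith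
    simpa using ae_iff.1 h2)
  rw [integral_neg] at hpos
  linarith

lemma integral_entropy_neg (hκ : ∀ᵐ s ∂κ, s ∈ Set.Ioo (0 : ℝ) 1) (hκ0 : κ ≠ 0) (hc : 0 < c)
    (hc1 : c ≤ 1) : ∫ s, ((1 - c * (2 - c) * s) * Real.log (1 - c * (2 - c) * s) +
      c ^ 2 * s * Real.log (c ^ 2 * s) + c * (2 - c) * s - c ^ 2 * s) ∂κ < 0 :=
  integral_neg_of_ae_neg hκ0 (integrable_entropy hκ hc.le hc1)
    (hκ.mono fun _ hs => entropy_neg hc hc1 hs)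

lemma rate_one_neg_modelWeights (hκ : ∀ᵐ s ∂κ, s ∈ Set.Ioo (0 : ℝ) 1) (hκ0 : κ ≠ 0) (hc : 0 < c)
    (hc1 : c ≤ 1) (hb : 0 ≤ b) (hb1 : b ≤ 1) (hθ : 0 ≤ θ) (h : c < 1 ∨ 0 < θ * b) :
    rate (modelWeights κ c b θ) 1 < 0 := by
  rw [rate, div_one, weightMoment_modelWeights hκ hc.le hc1 hb hb1 hθ one_pos]
  have hw2 : ∀ s : ℝ, (c ^ 2 * s) ^ (1 : ℝ) + (1 - c * (2 - c) * s) ^ (1 : ℝ) - 1 +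
      θ * ((1 - b * s) ^ (1 : ℝ) - 1) = (2 * c * (c - 1) - θ * b) * s := fun s => by
    simp only [Real.rpow_one]; ring
  simp_rw [hw2]
  have hneg : 2 * c * (c - 1) - θ * b < 0 := by
    have h1 : 0 ≤ θ * b := mul_nonneg hθ hb
    have h2 : 2 * c * (c - 1) ≤ 0 := mul_nonpos_of_nonneg_of_nonpos (by positivity) (by linarith)
    rcases h with h | h
    · have : 2 * c * (c - 1) < 0 := mul_neg_of_pos_of_neg (by positivity) (by linarith)
      linarith
    · linarith
  refine integral_neg_of_ae_neg hκ0 ?_ (hκ.mono fun s hs => mul_neg_of_neg_of_pos hneg hs.1)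
  refine Integrable.const_mul (Integrable.of_bound (C := 1) measurable_id.aestronglyMeasurable ?_) _
  filter_upwards [hκ] with s hs
  rw [id, Real.norm_of_nonneg hs.1.le]; exact hs.2.le

end Weights

/-! ### Models of binary collisions with an additional cold thermostat -/

section Model

variable {d : ℕ}

lemma charFun_add_smul_measure {f h : Measure (Vel d)} [IsFiniteMeasure f] [IsFiniteMeasure h]
    {θ : ℝ} (hθ : 0 ≤ θ) (k : Vel d) :
    charFun (f + ENNReal.ofReal θ • h) k = charFun f k + θ • charFun h k := by
  have hi : ∀ (f : Measure (Vel d)) [IsFiniteMeasure f],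
      Integrable (fun v => Complex.exp ((⟪v, k⟫ : ℝ) * Complex.I)) f := fun f _ => by
    refine Integrable.of_bound (C := 1) (Continuous.aestronglyMeasurable (by fun_prop))
      (Eventually.of_forall fun v => ?_)
    rw [Complex.norm_exp_ofReal_mul_I]
  rw [charFun_apply, integral_add_measure (hi f) ((hi h).smul_measure ENNReal.ofReal_ne_top),
    integral_smul_measure, ENNReal.toReal_ofReal hθ]
  rfl

lemma integral_add_smul_measure {f h : Measure (Vel d)} [IsFiniteMeasure f] [IsFiniteMeasure h]
    {θ : ℝ} (hθ : 0 ≤ θ) (ψ : Vel d →ᵇ ℝ) :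
    ∫ v, ψ v ∂(f + ENNReal.ofReal θ • h) = ∫ v, ψ v ∂f + θ * ∫ v, ψ v ∂h := by
  rw [integral_add_measure (ψ.integrable f) ((ψ.integrable h).smul_measure ENNReal.ofReal_ne_top),
    integral_smul_measure, ENNReal.toReal_ofReal hθ, smul_eq_mul]

lemma ae_cosineLaw_mem (d : ℕ) : ∀ᵐ z ∂(cosineLaw d), z ∈ Set.Icc (-1 : ℝ) 1 := by
  have h : ∀ᵐ z ∂(volume.restrict (Set.Ioo (-1 : ℝ) 1)), z ∈ Set.Icc (-1 : ℝ) 1 :=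
    (ae_restrict_iff' measurableSet_Ioo).2 (Eventually.of_forall fun z hz => ⟨hz.1.le, hz.2.le⟩)
  exact (withDensity_absolutelyContinuous _ _).ae_le h

lemma integral_withDensity_cosineLaw {F : Type*} [NormedAddCommGroup F] [NormedSpace ℝ F]
    {g : ℝ → ℝ} (hg : CollisionRule.IsAngularKernel d g) (H : ℝ → F) :
    ∫ z, H z ∂((cosineLaw d).withDensity fun z => ENNReal.ofReal (g z)) =
      ∫ z, g z • H z ∂(cosineLaw d) := by
  rw [integral_withDensity_eq_integral_toReal_smul hg.measurable.ennreal_ofReal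
    (Eventually.of_forall fun z => ENNReal.ofReal_lt_top)]
  refine integral_congr_ae ?_
  filter_upwards [ae_cosineLaw_mem d] with z hz
  rw [ENNReal.toReal_ofReal (hg.nonneg z hz)]

/-- A model made of binary collisions with rule `C` and of collisions with particles at rest with
rule `C'` is of Kac form. -/
lemma isKacForm_of_rules (hd : 2 ≤ d) {𝓜 : MaxwellModel} {C C' : CollisionRule d} {g : ℝ → ℝ}
    (hg : CollisionRule.IsAngularKernel d g) {e : Vel d} (he : ‖e‖ = 1)
    {κ : Measure ℝ} [IsFiniteMeasure κ] (hκ : ∀ᵐ s ∂κ, s ∈ Set.Ioo (0 : ℝ) 1) (hκ0 : κ ≠ 0)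
    {c b θ : ℝ} (hc : 0 < c) (hc1 : c ≤ 1) (hb : 0 ≤ b) (hb1 : b ≤ 1) (hθ : 0 ≤ θ)
    (hw : ((cosineLaw d).withDensity fun z => ENNReal.ofReal (g z)).map
      (fun z => (C.a z, C.b z)) = affineWeights κ (c * (2 - c)) (c ^ 2))
    (hw' : ((cosineLaw d).withDensity fun z => ENNReal.ofReal (g z)).map
      (fun z => (C'.a z, 0)) = affineWeights κ b 0)
    (hmu : ∀ p, 0 < p → 𝓜.mu d p = 1 / p * ∫ s, ((c ^ 2 * s) ^ p + (1 - c * (2 - c) * s) ^ p - 1 +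
      θ * ((1 - b * s) ^ p - 1)) ∂κ)
    (hop : ∀ (f : Measure (Vel d)) (ψ : Vel d →ᵇ ℝ), 𝓜.op d f ψ =
      ∫ v, ∫ w, ∫ ω : UnitSphere d, g (⟪v - w, (ω : Vel d)⟫ / ‖v - w‖) *
        (ψ (C.post v w ω) - ψ v) ∂(surface d) ∂f ∂f +
      θ * ∫ v, ∫ w, ∫ ω : UnitSphere d, g (⟪v - w, (ω : Vel d)⟫ / ‖v - w‖) *
        (ψ (C'.post v w ω) - ψ v) ∂(surface d) ∂(Measure.dirac 0) ∂f)
    (hent : ∫ s, ((1 - c * (2 - c) * s) * Real.log (1 - c * (2 - c) * s) +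
      c ^ 2 * s * Real.log (c ^ 2 * s) + c * (2 - c) * s - c ^ 2 * s) ∂κ +
      θ * ∫ s, (b * s + (1 - b * s) * Real.log (1 - b * s)) ∂κ < 0)
    (hel : 𝓜.IsElastic → c = 1 ∧ θ = 0) (hnel : ¬ 𝓜.IsElastic → c < 1 ∨ 0 < θ * b) :
    IsKacForm 𝓜 (modelWeights κ c b θ) fun f =>
      C.gain g e (f : Measure (Vel d)) (f : Measure (Vel d)) +
        ENNReal.ofReal θ • C'.gain g e (f : Measure (Vel d)) (Measure.dirac 0) := by
  have hα : 0 ≤ c * (2 - c) := mul_nonneg hc.le (by linarith)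
  have hα1 : c * (2 - c) ≤ 1 := by nlinarith [sq_nonneg (1 - c)]
  have hdis := isDissipative_modelWeights (θ := θ) hκ hc.le hc1 hb hb1
  have hm1 : Measurable fun z => (C.a z, C.b z) := C.measurable_a.prodMk C.measurable_b
  have hm2 : Measurable fun z => (C'.a z, (0 : ℝ)) := C'.measurable_a.prodMk measurable_const
  have hfin1 : ∀ f : ProbabilityMeasure (Vel d),
      IsFiniteMeasure (C.gain g e (f : Measure (Vel d)) (f : Measure (Vel d))) := fun f =>
    C.isFiniteMeasure_gain hg hd he
  have hfin2 : ∀ f : ProbabilityMeasure (Vel d),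
      IsFiniteMeasure (C'.gain g e (f : Measure (Vel d)) (Measure.dirac 0)) := fun f =>
    C'.isFiniteMeasure_gain hg hd he
  have hfin3 : ∀ f : ProbabilityMeasure (Vel d), IsFiniteMeasure
      (ENNReal.ofReal θ • C'.gain g e (f : Measure (Vel d)) (Measure.dirac 0)) := fun f =>
    Measure.smul_finite _ ENNReal.ofReal_ne_top
  have htot : ∫ z, g z ∂(cosineLaw d) = κ.real Set.univ := by
    have h1 := integral_withDensity_cosineLaw hg (fun _ => (1 : ℝ))
    simp only [smul_eq_mul, mul_one] at h1
    rw [← h1, integral_const, smul_eq_mul, mul_one]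
    have h2 := congrArg (fun μ : Measure (ℝ × ℝ) => μ.real Set.univ) hw
    simpa [affineWeights, measureReal_def, Measure.map_apply hm1 MeasurableSet.univ,
      Measure.map_apply (measurable_affineWeights_fun _ _) MeasurableSet.univ] using h2
  have hΛ : (modelWeights κ c b θ).real Set.univ = (1 + θ) * ∫ z, g z ∂(cosineLaw d) := by
    rw [htot, real_univ_modelWeights hκ hc.le hc1 hb hb1 hθ]
  have hΛ0 : 0 ≤ ∫ z, g z ∂(cosineLaw d) := htot ▸ measureReal_nonneg
  refine
    { dissipative := hdis
      overlap := overlap_modelWeights hκ hκ0 hc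
      mu_eq := fun p hp => ?_
      exists_rate_lt := exists_rate_lt_rate_one hdis ?_
      op_eq := fun f ψ => ?_
      gain_finite := fun f => inferInstance
      gain_sub_le := fun f f' M hM k => ?_
      gain_isotropic := fun f hf => ?_
      elastic := fun h => ?_
      not_elastic := fun h => rate_one_neg_modelWeights hκ hκ0 hc hc1 hb hb1 hθ (hnel h) }
  · rw [hmu p hp, rate, weightMoment_modelWeights hκ hc.le hc1 hb hb1 hθ hp, one_div_mul_eq_div]
  · have := integral_entropy_modelWeights hκ hc.le hc1 hb hb1 hθ
    linarith
  · rw [hop, C.integral_collision hg hd he, C'.integral_collision hg hd he, hΛ,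
      integral_add_smul_measure hθ]
    ring
  · have h0 : 0 ≤ M := (norm_nonneg _).trans (hM 0)
    have h1 := C.norm_charFun_gain_sub_le hg hd he hM hM k
    have h2 := C'.norm_charFun_gain_sub_le hg hd he hM
      (h := Measure.dirac 0) (h' := Measure.dirac 0) (M' := 0) (fun _ => by simp) k
    rw [charFun_add_smul_measure hθ, charFun_add_smul_measure hθ, add_sub_add_comm, ← smul_sub]
    refine (norm_add_le _ _).trans ?_
    rw [norm_smul, Real.norm_of_nonneg hθ, hΛ]
    have h3 := mul_le_mul_of_nonneg_left h2 hθ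
    nlinarith [mul_nonneg hθ (mul_nonneg hΛ0 h0)]
  · have hdirac : ∀ R : Vel d ≃ₗᵢ[ℝ] Vel d,
        (Measure.dirac (0 : Vel d)).map R = Measure.dirac 0 := fun R => by
      rw [Measure.map_dirac' R.continuous.measurable, map_zero]
    refine Measure.ext_of_charFun ?_
    funext k
    set φ := charFun (f : Measure (Vel d)) with hφ
    have hHm : StronglyMeasurable fun x : ℝ × ℝ => φ (x.1 • k) * φ (x.2 • k) := by
      refine Measurable.stronglyMeasurable (Measurable.mul ?_ ?_)
      · exact measurable_charFun.comp (by fun_prop)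
      · exact measurable_charFun.comp (by fun_prop)
    have hint := (integrable_and_integral_modelWeights hκ hc.le hc1 hb hb1 hθ hHm (B := 1)
      (fun x y _ _ _ _ => by
        rw [norm_mul]
        exact mul_le_one₀ (norm_charFun_le_one _) (norm_nonneg _) (norm_charFun_le_one _))).2.2
    rw [charFun_add_smul_measure hθ, charFun_smooth, hint,
      C.charFun_gain_isotropic hg hd he hf hf, C'.charFun_gain_isotropic hg hd he hf hdirac,
      ← integral_withDensity_cosineLaw hg, ← integral_withDensity_cosineLaw hg]
    congr 1
    · refine (integral_map hm1.aemeasurable hHm.aestronglyMeasurable).symm.trans ?_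
      rw [hw, affineWeights, integral_map (measurable_affineWeights_fun _ _).aemeasurable
        hHm.aestronglyMeasurable]
    · congr 1
      -- Particles at rest have the characteristic function `1 = φ(0)`, so the second weight may be
      -- replaced by `0`.
      have h1 : ∀ z, φ (C'.a z • k) * charFun (Measure.dirac (0 : Vel d)) (C'.b z • k) =
          φ (C'.a z • k) * φ ((0 : ℝ) • k) := fun z => by
        rw [zero_smul, hφ, charFun_zero, charFun_dirac]; simp
      refine (integral_congr_ae (Eventually.of_forall h1)).trans ?_
      refine (integral_map hm2.aemeasurable hHm.aestronglyMeasurable).symm.trans ?_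
      rw [hw', affineWeights, integral_map (measurable_affineWeights_fun _ _).aemeasurable
        hHm.aestronglyMeasurable]
  · obtain ⟨rfl, rfl⟩ := hel h
    refine ae_modelWeights hκ ((measurableSet_eq_fun (by fun_prop) measurable_const))
      (fun s hs => ?_) (fun h => absurd h (lt_irrefl _))
    rw [Real.sq_sqrt (sqrt_affine_mem hα hα1 hs).1, Real.sq_sqrt (mul_nonneg (sq_nonneg _) hs.1.le)]
    ring

end Model

end

/-! ### The kernels `G` and the three models -/

section

section Kernel

/-- One-dimensional change of variables for measures given by densities. -/
lemma map_withDensity_image {s : Set ℝ} (hs : MeasurableSet s) {f f' : ℝ → ℝ} (hf : Measurable f)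
    (hf' : ∀ x ∈ s, HasDerivWithinAt f (f' x) s x) (hinj : Set.InjOn f s) (ρ : ℝ → ℝ≥0∞) :
    ((volume.restrict s).withDensity fun x => ENNReal.ofReal |f' x| * ρ (f x)).map f =
      (volume.restrict (f '' s)).withDensity ρ := by
  ext A hA
  rw [Measure.map_apply hf hA, withDensity_apply _ (hf hA), withDensity_apply _ hA,
    ← lintegral_indicator hA, lintegral_image_eq_lintegral_abs_deriv_mul hs hf' hinj,
    ← lintegral_indicator (hf hA)]
  congr 1
  funext x
  by_cases hx : f x ∈ A <;> simp [Set.indicator, hx]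

/-- The measure with density `G` on the unit interval (with the positive part of `G` in general). -/
def kernelMeasure (G : ℝ → ℝ) : Measure ℝ :=
  (volume.restrict (Set.Ioo (0 : ℝ) 1)).withDensity fun s => ENNReal.ofReal (G s)

variable {G : ℝ → ℝ}

lemma ae_kernelMeasure (G : ℝ → ℝ) : ∀ᵐ s ∂(kernelMeasure G), s ∈ Set.Ioo (0 : ℝ) 1 :=
  (withDensity_absolutelyContinuous _ _).ae_le (ae_restrict_mem measurableSet_Ioo)

lemma isFiniteMeasure_kernelMeasure (hi : IntegrableOn G (Set.Ioo 0 1)) :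
    IsFiniteMeasure (kernelMeasure G) :=
  isFiniteMeasure_withDensity_ofReal hi.hasFiniteIntegral

lemma integral_kernelMeasure (hm : Measurable G) (hG : ∀ s ∈ Set.Ioo (0 : ℝ) 1, 0 ≤ G s)
    (F : ℝ → ℝ) : ∫ s, F s ∂(kernelMeasure G) = ∫ s in (0 : ℝ)..1, G s * F s := by
  rw [kernelMeasure, integral_withDensity_eq_integral_toReal_smul hm.ennreal_ofReal
    (Eventually.of_forall fun z => ENNReal.ofReal_lt_top),
    intervalIntegral.integral_of_le zero_le_one, integral_Ioc_eq_integral_Ioo]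
  refine setIntegral_congr_fun measurableSet_Ioo fun s hs => ?_
  simp only [ENNReal.toReal_ofReal (hG s hs), smul_eq_mul]

lemma kernelMeasure_ne_zero (hm : Measurable G) (hG : ∀ s ∈ Set.Ioo (0 : ℝ) 1, 0 ≤ G s)
    (hpos : 0 < ∫ s in (0 : ℝ)..1, G s) : kernelMeasure G ≠ 0 := by
  intro h0
  have h := integral_kernelMeasure hm hG fun _ => 1
  rw [h0, integral_zero_measure] at h
  simp only [mul_one] at h
  exact hpos.ne h

end Kernel

section Models

variable {d : ℕ} {g : ℝ → ℝ}

lemma areaSphere_pos (hd : 2 ≤ d) : 0 < areaSphere d := by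
  obtain ⟨n, rfl⟩ : ∃ n, d = n + 2 := ⟨d - 2, by omega⟩
  have h : surface (n + 1) ≠ 0 := by
    rw [surface, Ne, Measure.toSphere_eq_zero_iff_finrank]
    simp
  have h' : NeZero (surface (n + 2 - 1)) := ⟨h⟩
  exact measureReal_univ_pos

lemma measurable_kernelG (hg : Measurable g) : Measurable (kernelG d g) := by
  unfold kernelG
  fun_prop

lemma kernelG_nonneg (hg : ∀ z ∈ Set.Icc (-1 : ℝ) 1, 0 ≤ g z) :
    ∀ s ∈ Set.Ioo (0 : ℝ) 1, 0 ≤ kernelG d g s := fun s hs => by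
  have h1 : 0 ≤ areaSphere d := measureReal_nonneg
  have h2 := hg (1 - 2 * s) ⟨by linarith [hs.2], by linarith [hs.1]⟩
  have h3 : 0 ≤ s * (1 - s) := mul_nonneg hs.1.le (by linarith [hs.2])
  unfold kernelG
  positivity

/-- The substitution `z = 1 - 2 s` carries `G(s) ds` to `g(z)` times the law of the cosine of the
scattering angle. -/
lemma cosineLaw_withDensity (hd : 2 ≤ d) (hg : IsCollisionKernel d g) :
    (cosineLaw d).withDensity (fun z => ENNReal.ofReal (g z)) =
      (kernelMeasure (kernelG d g)).map fun s => 1 - 2 * s := by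
  have himg : (fun s : ℝ => 1 - 2 * s) '' Set.Ioo 0 1 = Set.Ioo (-1) 1 := by
    ext z
    constructor
    · rintro ⟨s, hs, rfl⟩
      exact ⟨by linarith [hs.2], by linarith [hs.1]⟩
    · intro hz
      exact ⟨(1 - z) / 2, ⟨by linarith [hz.2], by linarith [hz.1]⟩, by ring⟩
  have hm : Measurable fun z : ℝ =>
      ENNReal.ofReal (areaSphere d * (1 - z ^ 2) ^ (((d : ℝ) - 3) / 2)) := by fun_prop
  have h := map_withDensity_image (s := Set.Ioo 0 1) measurableSet_Ioo
    (f := fun s => 1 - 2 * s) (f' := fun _ => -2) (by fun_prop)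
    (fun x _ => by simpa using (((hasDerivAt_id x).const_mul 2).const_sub 1).hasDerivWithinAt)
    (fun x _ y _ hxy => by simpa using hxy)
    ((fun z => ENNReal.ofReal (areaSphere d * (1 - z ^ 2) ^ (((d : ℝ) - 3) / 2))) *
      fun z => ENNReal.ofReal (g z))
  rw [cosineLaw, ← withDensity_mul _ hm hg.measurable.ennreal_ofReal, ← himg, ← h, kernelMeasure]
  congr 1
  refine withDensity_congr_ae ?_
  filter_upwards [ae_restrict_mem measurableSet_Ioo] with s hs
  have h1 : 0 ≤ areaSphere d := measureReal_nonneg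
  have h3 : 0 ≤ s * (1 - s) := mul_nonneg hs.1.le (by linarith [hs.2])
  have h4 : (1 - (1 - 2 * s) ^ 2) ^ (((d : ℝ) - 3) / 2) =
      4 ^ (((d : ℝ) - 3) / 2) * (s * (1 - s)) ^ (((d : ℝ) - 3) / 2) := by
    rw [← Real.mul_rpow (by norm_num) h3]
    ring_nf
  -- The factor `2` is the Jacobian; for `d = 2` both sides are `1`.
  have h5 : (2 : ℝ) * 4 ^ (((d : ℝ) - 3) / 2) = 2 ^ (d - 2) := by
    rw [show (4 : ℝ) = 2 ^ (2 : ℝ) by norm_num, ← Real.rpow_mul (by norm_num),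
      ← Real.rpow_natCast, Nat.cast_sub hd]
    nth_rewrite 1 [← Real.rpow_one 2]
    rw [← Real.rpow_add two_pos]
    congr 1
    push_cast
    ring
  have h6 : 0 ≤ areaSphere d * (1 - (1 - 2 * s) ^ 2) ^ (((d : ℝ) - 3) / 2) := by
    rw [h4]; positivity
  rw [Pi.mul_apply, ← ENNReal.ofReal_mul h6, ← ENNReal.ofReal_mul (abs_nonneg _), h4, kernelG, ← h5]
  congr 1
  norm_num
  ring

lemma isAngularKernel_of_isCollisionKernel (hd : 2 ≤ d) (hg : IsCollisionKernel d g) :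
    CollisionRule.IsAngularKernel d g where
  measurable := hg.measurable
  nonneg := hg.nonneg
  integrable := by
    refine ⟨hg.measurable.aestronglyMeasurable, ?_⟩
    have := isFiniteMeasure_kernelMeasure hg.integrable
    have h := measure_lt_top ((kernelMeasure (kernelG d g)).map fun s => 1 - 2 * s) Set.univ
    rw [← cosineLaw_withDensity hd hg, withDensity_apply _ MeasurableSet.univ,
      Measure.restrict_univ] at h
    rw [hasFiniteIntegral_iff_ofReal]
    · exact h
    · filter_upwards [ae_cosineLaw_mem d] with z hz using hg.nonneg z hz

lemma betaOf_mem {m : ℝ} (hm : 0 < m) : 0 < betaOf m ∧ betaOf m ≤ 1 := by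
  unfold betaOf
  refine ⟨by positivity, ?_⟩
  rw [div_le_one (by positivity)]
  nlinarith [sq_nonneg (1 - m)]

/-- The contraction factor of collisions with a particle of mass `m` at rest. -/
lemma map_thermostatRule (hd : 2 ≤ d) (hg : IsCollisionKernel d g) {m : ℝ} (hm : 0 < m) :
    ((cosineLaw d).withDensity fun z => ENNReal.ofReal (g z)).map
      (fun z => ((thermostatRule d hm).a z, (0 : ℝ))) =
        affineWeights (kernelMeasure (kernelG d g)) (betaOf m) 0 := by
  rw [cosineLaw_withDensity hd hg, Measure.map_map
    ((thermostatRule d hm).measurable_a.prodMk measurable_const) (by fun_prop), affineWeights]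
  congr 1
  funext s
  simp only [Function.comp, thermostatRule, zero_mul, Real.sqrt_zero, Prod.mk.injEq, and_true]
  congr 1
  unfold betaOf
  field_simp
  ring

lemma map_thermostatRule_one (hd : 2 ≤ d) (hg : IsCollisionKernel d g) :
    ((cosineLaw d).withDensity fun z => ENNReal.ofReal (g z)).map
      (fun z => ((thermostatRule d one_pos).a z, (thermostatRule d one_pos).b z)) =
        affineWeights (kernelMeasure (kernelG d g)) (1 * (2 - 1)) (1 ^ 2) := by
  rw [cosineLaw_withDensity hd hg, Measure.map_map
    ((thermostatRule d one_pos).measurable_a.prodMk (thermostatRule d one_pos).measurable_b)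
    (by fun_prop), affineWeights]
  congr 1
  funext s
  simp only [Function.comp, thermostatRule, Prod.mk.injEq]
  constructor <;> congr 1 <;> ring

lemma elasticOp_eq (f : Measure (Vel d)) (ψ : Vel d →ᵇ ℝ) :
    elasticOp d g f ψ = ∫ v, ∫ w, ∫ ω : UnitSphere d, g (⟪v - w, (ω : Vel d)⟫ / ‖v - w‖) *
      (ψ ((thermostatRule d one_pos).post v w ω) - ψ v) ∂(surface d) ∂f ∂f := by
  have h : ∀ v w ω : Vel d, (thermostatRule d one_pos).post v w ω =
      (1 / 2 : ℝ) • (v + w + ‖v - w‖ • ω) := fun v w ω => by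
    simp only [thermostatRule, one_smul, add_assoc]
    norm_num
  simp_rw [h]
  rfl

lemma exists_unit_vector (hd : 2 ≤ d) : ∃ e : Vel d, ‖e‖ = 1 :=
  ⟨EuclideanSpace.single ⟨0, by omega⟩ 1, by simp⟩

lemma isKacForm_elastic (hd : 2 ≤ d) (hg : IsCollisionKernel d g) :
    ∃ ν gain, IsFiniteMeasure ν ∧ IsKacForm (d := d) (.elastic g) ν gain := by
  obtain ⟨e, he⟩ := exists_unit_vector hd
  have := isFiniteMeasure_kernelMeasure hg.integrable
  have hκ := ae_kernelMeasure (kernelG d g)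
  have hκ0 := kernelMeasure_ne_zero (measurable_kernelG hg.measurable) (kernelG_nonneg hg.nonneg)
    hg.pos
  have hβ := betaOf_mem one_pos
  -- With `θ = 0` the second collision rule plays no role.
  refine ⟨_, _, inferInstance, isKacForm_of_rules hd (C := thermostatRule d one_pos)
    (C' := thermostatRule d one_pos) (isAngularKernel_of_isCollisionKernel hd hg) he hκ hκ0
    one_pos le_rfl hβ.1.le hβ.2 (θ := 0) le_rfl (map_thermostatRule_one hd hg)
    (map_thermostatRule hd hg one_pos) (fun p _ => ?_) (fun f ψ => ?_) ?_ (fun _ => ⟨rfl, rfl⟩)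
    (fun h => absurd trivial h)⟩
  · rw [integral_kernelMeasure (measurable_kernelG hg.measurable) (kernelG_nonneg hg.nonneg)]
    simp only [MaxwellModel.mu]
    congr 2
    funext s
    ring_nf
  · rw [zero_mul, add_zero, ← elasticOp_eq]
    rfl
  · rw [zero_mul, add_zero]
    exact integral_entropy_neg hκ hκ0 one_pos le_rfl

/-- The condition `θ < θ_*` says that the negative contribution of the binary collisions to `μ'(1)`
outweighs the positive contribution of the thermostat. -/
lemma isKacForm_thermostat (hd : 2 ≤ d) (hg : IsCollisionKernel d g) {m θ : ℝ} (hm : 0 < m)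
    (hθ : 0 < θ) (hθ' : θ < thetaStar d g m) :
    ∃ ν gain, IsFiniteMeasure ν ∧ IsKacForm (d := d) (.thermostat g m θ) ν gain := by
  obtain ⟨e, he⟩ := exists_unit_vector hd
  have := isFiniteMeasure_kernelMeasure hg.integrable
  have hκ := ae_kernelMeasure (kernelG d g)
  have hG := measurable_kernelG (d := d) hg.measurable
  have hG0 := kernelG_nonneg (d := d) hg.nonneg
  have hκ0 := kernelMeasure_ne_zero hG hG0 hg.pos
  have hβ := betaOf_mem hm
  refine ⟨_, _, inferInstance, isKacForm_of_rules hd (C := thermostatRule d one_pos)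
    (C' := thermostatRule d hm) (isAngularKernel_of_isCollisionKernel hd hg) he hκ hκ0
    one_pos le_rfl hβ.1.le hβ.2 hθ.le (map_thermostatRule_one hd hg)
    (map_thermostatRule hd hg hm) (fun p _ => ?_) (fun f ψ => ?_) ?_ (fun h => h.elim)
    (fun _ => Or.inr (mul_pos hθ hβ.1))⟩
  · rw [integral_kernelMeasure hG hG0]
    simp only [MaxwellModel.mu]
    congr 2
    funext s
    ring_nf
  · rw [← elasticOp_eq]
    rfl
  · have h1 := integral_entropy_neg hκ hκ0 one_pos le_rfl
    rw [integral_kernelMeasure hG hG0] at h1 ⊢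
    rw [integral_kernelMeasure hG hG0]
    have h2 : ∀ s : ℝ, (1 - 1 * (2 - 1) * s) * Real.log (1 - 1 * (2 - 1) * s) +
        1 ^ 2 * s * Real.log (1 ^ 2 * s) + 1 * (2 - 1) * s - 1 ^ 2 * s =
        s * Real.log s + (1 - s) * Real.log (1 - s) := fun s => by ring_nf
    simp_rw [h2] at h1 ⊢
    rw [thetaStar] at hθ'
    set A := ∫ s in (0 : ℝ)..1, kernelG d g s * (s * Real.log s + (1 - s) * Real.log (1 - s))
    set B := ∫ s in (0 : ℝ)..1, kernelG d g s *
      (betaOf m * s + (1 - betaOf m * s) * Real.log (1 - betaOf m * s))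
    -- Were the denominator of `θ_*` not positive, then `θ_* ≤ 0`; so `0 < θ < θ_*` settles its
    -- sign.
    have hB : 0 < B := by
      by_contra hB
      have := div_nonpos_of_nonneg_of_nonpos (by linarith : 0 ≤ -A) (not_lt.1 hB)
      linarith
    rw [lt_div_iff₀ hB] at hθ'
    linarith

lemma measurable_kernelInel (d : ℕ) : Measurable (kernelInel d) := by
  unfold kernelInel
  fun_prop

lemma kernelInel_nonneg (d : ℕ) : ∀ s ∈ Set.Ioo (0 : ℝ) 1, 0 ≤ kernelInel d s := fun s hs => by
  have h1 : 0 ≤ areaSphere d := measureReal_nonneg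
  have h3 : 0 ≤ 1 - s := by linarith [hs.2]
  unfold kernelInel
  positivity

/-- The substitution `s = z²`; each of the two half intervals contributes one half. -/
lemma map_sq_cosineLaw (d : ℕ) :
    ((cosineLaw d).withDensity fun z => ENNReal.ofReal |z|).map (fun z => z ^ 2) =
      kernelMeasure (kernelInel d) := by
  have hm : Measurable fun z : ℝ =>
      ENNReal.ofReal (areaSphere d * (1 - z ^ 2) ^ (((d : ℝ) - 3) / 2)) := by fun_prop
  have hsq : Measurable fun z : ℝ => z ^ 2 := by fun_prop
  have hhalf : ∀ S : Set ℝ, MeasurableSet S → (S ⊆ Set.Ioo (-1) 1) →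
      Set.InjOn (fun z : ℝ => z ^ 2) S → (fun z : ℝ => z ^ 2) '' S = Set.Ioo 0 1 →
      ((volume.restrict S).withDensity ((fun z =>
        ENNReal.ofReal (areaSphere d * (1 - z ^ 2) ^ (((d : ℝ) - 3) / 2))) *
          fun z => ENNReal.ofReal |z|)).map (fun z => z ^ 2) =
        (volume.restrict (Set.Ioo 0 1)).withDensity fun s => ENNReal.ofReal (kernelInel d s / 2) := by
    intro S hS hS1 hinj himg
    rw [← himg, ← map_withDensity_image hS (f' := fun z => 2 * z) hsq (fun x _ => by
      simpa using (hasDerivAt_pow 2 x).hasDerivWithinAt) hinj]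
    congr 1
    refine withDensity_congr_ae ?_
    filter_upwards [ae_restrict_mem hS] with z hz
    have h1 : 0 ≤ areaSphere d := measureReal_nonneg
    have h2 : 0 ≤ 1 - z ^ 2 := by
      have := hS1 hz
      nlinarith [this.1, this.2]
    rw [Pi.mul_apply, ← ENNReal.ofReal_mul (by positivity), ← ENNReal.ofReal_mul (by positivity),
      abs_mul, abs_two, kernelInel]
    congr 1
    ring
  have hR := hhalf (Set.Ioo 0 1) measurableSet_Ioo (Set.Ioo_subset_Ioo_left (by norm_num))
    (fun x hx y hy hxy => (sq_eq_sq₀ hx.1.le hy.1.le).1 hxy) (by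
      ext s
      refine ⟨?_, fun hs => ⟨√s, ⟨Real.sqrt_pos.2 hs.1, (Real.sqrt_lt' one_pos).2
        (by simpa using hs.2)⟩, Real.sq_sqrt hs.1.le⟩⟩
      rintro ⟨z, hz, rfl⟩
      exact ⟨pow_pos hz.1 2, pow_lt_one₀ hz.1.le hz.2 two_ne_zero⟩)
  have hL := hhalf (Set.Ioo (-1) 0) measurableSet_Ioo (Set.Ioo_subset_Ioo_right zero_le_one)
    (fun x hx y hy hxy => neg_injective ((sq_eq_sq₀ (neg_nonneg.2 hx.2.le)
      (neg_nonneg.2 hy.2.le)).1 (by simpa using hxy))) (by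
      ext s
      refine ⟨?_, fun hs => ⟨-√s, ⟨neg_lt_neg ((Real.sqrt_lt' one_pos).2 (by simpa using hs.2)),
        neg_neg_of_pos (Real.sqrt_pos.2 hs.1)⟩, by simp [Real.sq_sqrt hs.1.le]⟩⟩
      rintro ⟨z, hz, rfl⟩
      exact ⟨sq_pos_of_neg hz.2, by nlinarith [hz.1, hz.2]⟩)
  have hunion : volume.restrict (Set.Ioo (-1 : ℝ) 1) =
      volume.restrict (Set.Ioo (-1 : ℝ) 0) + volume.restrict (Set.Ioo (0 : ℝ) 1) := by
    have hdisj : Disjoint (Set.Ioo (-1 : ℝ) 0) (Set.Ico (0 : ℝ) 1) :=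
      Set.disjoint_left.2 fun x hx hx' => (hx.2.trans_le hx'.1).false
    rw [restrict_Ioo_eq_restrict_Ico (a := (0 : ℝ)), ← Measure.restrict_union hdisj
      measurableSet_Ico, Set.Ioo_union_Ico_eq_Ioo (by norm_num) zero_le_one]
  rw [cosineLaw, ← withDensity_mul _ hm (by fun_prop), hunion, withDensity_add_measure,
    Measure.map_add _ _ hsq, hL, hR, kernelMeasure, ← withDensity_add_left (by
      have := measurable_kernelInel d
      fun_prop)]
  refine withDensity_congr_ae ?_
  filter_upwards [ae_restrict_mem measurableSet_Ioo] with s hs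
  have := kernelInel_nonneg d s hs
  rw [Pi.add_apply, ← ENNReal.ofReal_add (by positivity) (by positivity), add_halves]

lemma isAngularKernel_abs (hd : 2 ≤ d) : CollisionRule.IsAngularKernel d fun z => |z| where
  measurable := by fun_prop
  nonneg z _ := abs_nonneg z
  integrable := by
    obtain ⟨e, he⟩ := exists_unit_vector hd
    have : IsFiniteMeasure (cosineLaw d) := by
      rw [← surface_map_inner hd he]
      infer_instance
    refine Integrable.of_bound (C := 1) (Measurable.aestronglyMeasurable (by fun_prop)) ?_
    filter_upwards [ae_cosineLaw_mem d] with z hz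
    rw [Real.norm_eq_abs, abs_abs]
    exact abs_le.2 hz

lemma map_inelasticRule {c : ℝ} (hc : 0 ≤ c) :
    ((cosineLaw d).withDensity fun z => ENNReal.ofReal |z|).map
      (fun z => ((inelasticRule d hc).a z, (inelasticRule d hc).b z)) =
        affineWeights (kernelMeasure (kernelInel d)) (c * (2 - c)) (c ^ 2) := by
  rw [← map_sq_cosineLaw, affineWeights, Measure.map_map (measurable_affineWeights_fun _ _)
    (by fun_prop)]
  congr 1
  funext z
  simp only [Function.comp, inelasticRule, Prod.mk.injEq, true_and]
  rw [Real.sqrt_mul (sq_nonneg c), Real.sqrt_sq hc, Real.sqrt_sq_eq_abs]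

lemma map_inelasticRule_fst {c : ℝ} (hc : 0 ≤ c) :
    ((cosineLaw d).withDensity fun z => ENNReal.ofReal |z|).map
      (fun z => ((inelasticRule d hc).a z, (0 : ℝ))) =
        affineWeights (kernelMeasure (kernelInel d)) (c * (2 - c)) 0 := by
  rw [← map_sq_cosineLaw, affineWeights, Measure.map_map (measurable_affineWeights_fun _ _)
    (by fun_prop)]
  congr 1
  funext z
  simp [inelasticRule]

lemma isKacForm_inelastic (hd : 2 ≤ d) {e : ℝ} (h0 : 0 < e) (h1 : e ≤ 1) :
    ∃ ν gain, IsFiniteMeasure ν ∧ IsKacForm (d := d) (.inelastic e) ν gain := by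
  obtain ⟨n, hn⟩ := exists_unit_vector hd
  have hg := isAngularKernel_abs hd
  have hG := measurable_kernelInel d
  have hG0 := kernelInel_nonneg d
  have hκ := ae_kernelMeasure (kernelInel d)
  have hfin : IsFiniteMeasure ((cosineLaw d).withDensity fun z => ENNReal.ofReal |z|) :=
    isFiniteMeasure_withDensity_ofReal hg.integrable.hasFiniteIntegral
  have : IsFiniteMeasure (kernelMeasure (kernelInel d)) := by
    rw [← map_sq_cosineLaw]
    infer_instance
  have hκ0 : kernelMeasure (kernelInel d) ≠ 0 := by
    intro h
    rw [kernelMeasure, withDensity_eq_zero_iff hG.ennreal_ofReal.aemeasurable] at h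
    have hF : ∀ᵐ s ∂(volume.restrict (Set.Ioo (0 : ℝ) 1)), False := by
      filter_upwards [h, ae_restrict_mem measurableSet_Ioo] with s hs hs'
      have hpos : 0 < kernelInel d s :=
        mul_pos (areaSphere_pos hd) (Real.rpow_pos_of_pos (by linarith [hs'.2]) _)
      exact hpos.not_ge (ENNReal.ofReal_eq_zero.1 hs)
    simpa using ae_iff.1 hF
  set c := (1 + e) / 2 with hc
  have hc0 : 0 < c := by positivity
  have hc1 : c ≤ 1 := by linarith
  have hb : 0 ≤ c * (2 - c) := mul_nonneg hc0.le (by linarith)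
  have hb1 : c * (2 - c) ≤ 1 := by nlinarith [sq_nonneg (1 - c)]
  -- With `θ = 0` the second collision rule plays no role.
  refine ⟨_, _, inferInstance, isKacForm_of_rules hd (C := inelasticRule d hc0.le)
    (C' := inelasticRule d hc0.le) hg hn hκ hκ0 hc0 hc1 hb hb1 (θ := 0) le_rfl
    (map_inelasticRule hc0.le) (map_inelasticRule_fst hc0.le) (fun p _ => ?_) (fun f ψ => ?_) ?_
    (fun h => ⟨?_, rfl⟩) (fun h => Or.inl ?_)⟩
  · rw [integral_kernelMeasure hG hG0]
    simp only [MaxwellModel.mu]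
    congr 2
    funext s
    rw [show (1 + e) ^ 2 / 4 * s = c ^ 2 * s by rw [hc]; ring,
      show (1 + e) * (3 - e) / 4 * s = c * (2 - c) * s by rw [hc]; ring]
    ring
  · simp only [MaxwellModel.op, inelasticOp, zero_mul, add_zero, abs_div, abs_norm]
    rfl
  · rw [zero_mul, add_zero]
    exact integral_entropy_neg hκ hκ0 hc0 hc1
  · have h' : e = 1 := h
    linarith
  · have h' : e ≠ 1 := h
    have := lt_of_le_of_ne h1 h'
    linarith

/-- Each of the three models is of Kac form. -/
lemma exists_isKacForm (hd : 2 ≤ d) {𝓜 : MaxwellModel} (h : 𝓜.Admissible d) :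
    ∃ ν gain, IsFiniteMeasure ν ∧ IsKacForm (d := d) 𝓜 ν gain := by
  cases 𝓜 with
  | elastic g => exact isKacForm_elastic hd h
  | thermostat g m θ => exact isKacForm_thermostat hd h.1 h.2.1 h.2.2.1 h.2.2.2
  | inelastic e => exact isKacForm_inelastic hd h.1 h.2

end Models

end

end

end KacMaxwell

theorem theorem11p1 (d : ℕ) (hd : 2 ≤ d) (𝓜 : MaxwellModel) (h𝓜 : 𝓜.Admissible d) :
    -- existence and uniqueness for the initial value problem
    (∀ f₀ : ProbabilityMeasure (Vel d), IsIsotropic f₀ →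
      ∃ f : ℝ → ProbabilityMeasure (Vel d),
        f 0 = f₀ ∧ 𝓜.IsSolution f ∧ (∀ t : ℝ, 0 ≤ t → IsIsotropic (f t)) ∧
        ∀ f' : ℝ → ProbabilityMeasure (Vel d), f' 0 = f₀ → 𝓜.IsSolution f' →
          ∀ t : ℝ, 0 ≤ t → f' t = f t) ∧
    -- the self-similar profile for each exponent
    (∀ p : ℝ, 0 < p → p ≤ 1 →
      ∃ F : ProbabilityMeasure (Vel d),
        IsIsotropic F ∧ 𝓜.IsSelfSimilarProfile p F ∧ HasExpansion p F ∧ 𝓜.Attracts p F ∧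
        -- uniqueness of the profile
        (∀ F' : ProbabilityMeasure (Vel d), IsIsotropic F' → 𝓜.IsSelfSimilarProfile p F' →
          (HasExpansion p F' ∨ 𝓜.Attracts p F') → F' = F) ∧
        -- moments
        (p < 1 → ∀ q : ℝ, 0 < q →
          (Integrable (fun v : Vel d => ‖v‖ ^ (2 * q)) (F : Measure (Vel d)) ↔ q < p)) ∧
        (p = 1 → 𝓜.IsElastic →
          𝓜.mu d 1 = 0 ∧ (F : Measure (Vel d)) = maxwellian d) ∧
        (p = 1 → ¬ 𝓜.IsElastic →
          ∃ pstar : ℝ, 1 < pstar ∧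
            (∀ q : ℝ, 0 < q → (𝓜.mu d q = 𝓜.mu d 1 ↔ q = 1 ∨ q = pstar)) ∧
            ∀ q : ℝ, 0 < q →
              (Integrable (fun v : Vel d => ‖v‖ ^ (2 * q)) (F : Measure (Vel d)) ↔
                q < pstar))) := by
  obtain ⟨ν, gain, hν, h⟩ := KacMaxwell.exists_isKacForm hd h𝓜
  exact h.selfSimilar_asymptotics hd
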